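/- Let $n\ge 0$ and write $\langle x\rangle=(1+|x|^2)^{1/2}$ for $x\in\mathbb R^n$. For a smooth $b(x,y,\xi)$ of polynomial growth together with all its derivatives, and a real-valued function $\phi(x,\xi)$ which is Lebesgue measurable in $\xi$ for every $x$, let $T_{\phi,b}$ be the operator on $\mathcal S(\mathbb R^n)$ \[ T_{\phi,b}u(x)=(2\pi)^{-n}\int_{\mathbb R^n}\int_{\mathbb R^n}e^{i(\phi(x,\xi)-y\cdot\xi)}\,b(x,y,\xi)\,u(y)\,dy\,d\xi, \] understood, for each $x$, as the limit for $\varepsilon\to0^+$ of the integrals with $b(x,y,\xi)$ replaced by $b(x,y,\xi)\chi(\varepsilon y,\varepsilon\xi)$; here $\chi\in C_0^\infty(\mathbb R^n\times\mathbb R^n)$ is any function that equals $1$ near the origin, and it is part of the claim below that the limits exist and do not depend on $\chi$. Let $m_1,m_2,m_3,t_1,t_2\in\mathbb R$. Let $a\in C^\infty(\mathbb R^n\times\mathbb R^n\times\mathbb R^n)$ be complex-valued with \[ |\partial_x^\alpha\partial_y^\beta\partial_\xi^\gamma a(x,y,\xi)|\le C_{\alpha\beta\gamma}\langle x\rangle^{m_1}\langle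 y\rangle^{m_2}\langle\xi\rangle^{m_3}\quad\text{for all } x,y,\xi\in\mathbb R^n \] for all multi-indices $\alpha,\beta,\gamma$, and let $p\in C^\infty(\mathbb R^n\times\mathbb R^n)$ be complex-valued with \[ |\partial_y^\alpha\partial_\eta^\beta p(y,\eta)|\le C_{\alpha\beta}\langle y\rangle^{t_1}\langle\eta\rangle^{t_2-|\beta|}\quad\text{for all } y,\eta\in\mathbb R^n \] for all $\alpha,\beta$. Let $P=p(x,D)$, $Pu(x)=(2\pi)^{-n}\iint e^{i(x-y)\cdot\xi}p(x,\xi)u(y)\,dy\,d\xi$ (understood in the same way, with phase $x\cdot\xi$ and amplitude $p(x,\xi)$). Then $P$ is a well-defined linear map of $\mathcal S(\mathbb R^n)$ into itself, and there is a smooth function $c(x,z,\xi)$, depending on $a$ and $p$ but not on a phase, with the following properties. 1. For every real-valued phase $\phi(x,\xi)$ (measurable in $\xi$ for every $x$, otherwise arbitrary), $T_{\phi,a}$ and $T_{\phi,c}$ are well defined on $\mathcal S(\mathbb R^n)$ and $T_{\phi,a}\circ P=T_{\phi,c}$, i.e. \[ (T_{\phi,a}Pu)(x)=(2\pi)^{-n}\int_{\mathbb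 R^n}\int_{\mathbb R^n}e^{i(\phi(x,\xi)-z\cdot\xi)}c(x,z,\xi)u(z)\,dz\,d\xi . \] 2. For all $\alpha,\beta,\gamma$ there is $C_{\alpha\beta\gamma}$ such that for all $x,z,\xi\in\mathbb R^n$ \[ |\partial_x^\alpha\partial_z^\beta\partial_\xi^\gamma c(x,z,\xi)|\le C_{\alpha\beta\gamma}\langle x\rangle^{m_1}\langle z\rangle^{m_2+t_1}\langle\xi\rangle^{m_3+t_2}. \] 3. There is the asymptotic expansion, improving in $\xi$, \[ c(x,z,\xi)\sim\sum_\alpha\frac{i^{|\alpha|}}{\alpha!}\,\partial_y^\alpha\bigl[a(x,y,\xi)\,\partial_\xi^\alpha p(y,\xi)\bigr]\Big|_{y=z}, \] which means: for all $\alpha,\beta,\gamma$ and $M$ there is $N_0$ such that for every $N\ge N_0$ there is $C$ with \[ \Bigl|\partial_x^\alpha\partial_z^\beta\partial_\xi^\gamma\Bigl(c(x,z,\xi)-\sum_{|\delta|<N}\frac{i^{|\delta|}}{\delta!}\,\partial_y^\delta\bigl[a(x,y,\xi)\,\partial_\xi^\delta p(y,\xi)\bigr]\Big|_{y=z}\Bigr)\Bigr|\le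 C\langle x\rangle^{m_1}\langle z\rangle^{m_2+t_1}\langle\xi\rangle^{m_3+t_2-M}\quad\text{for all } x,z,\xi\in\mathbb R^n. \] -/

import Mathlib

open Filter Topology MeasureTheory
open scoped ContDiff

noncomputable section

namespace FIOCalc

/-- Euclidean space of dimension `n`. -/
abbrev E (n : ℕ) : Type := EuclideanSpace ℝ (Fin n)

/-- The bracket `⟨x⟩ = (1 + |x|²)^{1/2}`. -/
def bracket {n : ℕ} (x : E n) : ℝ := Real.sqrt (1 + ‖x‖ ^ 2)

/-- The partial derivative `∂_j f`. -/
def partialD {n : ℕ} (j : Fin n) (f : E n → ℂ) : E n → ℂ :=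
  fun x => fderiv ℝ f x (EuclideanSpace.single j (1 : ℝ))

/-- The multi-index derivative `∂^α f = ∂_1^{α_1} ⋯ ∂_n^{α_n} f`. -/
def multiD {n : ℕ} (α : Fin n → ℕ) (f : E n → ℂ) : E n → ℂ :=
  (List.finRange n).foldr (fun j g => (partialD j)^[α j] g) f

/-- The mixed derivative `∂_y^α ∂_η^β p(y, η)`. -/
def mixedD₂ {n : ℕ} (α β : Fin n → ℕ) (p : E n → E n → ℂ) : E n → E n → ℂ :=
  fun y η => multiD α (fun y' => multiD β (fun η' => p y' η') η) y

/-- The mixed derivative `∂_x^α ∂_y^β ∂_ξ^γ a(x, y, ξ)`. -/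
def mixedD₃ {n : ℕ} (α β γ : Fin n → ℕ) (a : E n → E n → E n → ℂ) :
    E n → E n → E n → ℂ :=
  fun x y ξ => multiD α (fun x' => multiD β (fun y' => multiD γ (fun ξ' => a x' y' ξ') ξ) y) x

/-- Smooth amplitudes with
`|∂_x^α ∂_y^β ∂_ξ^γ a(x, y, ξ)| ≤ C_{αβγ} ⟨x⟩^{m₁} ⟨y⟩^{m₂} ⟨ξ⟩^{m₃}`. -/
def IsAmplitude {n : ℕ} (m₁ m₂ m₃ : ℝ) (a : E n → E n → E n → ℂ) : Prop :=
  ContDiff ℝ ∞ (fun q : E n × E n × E n => a q.1 q.2.1 q.2.2) ∧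
  ∀ α β γ : Fin n → ℕ, ∃ C : ℝ, ∀ x y ξ : E n,
    ‖mixedD₃ α β γ a x y ξ‖ ≤ C * bracket x ^ m₁ * bracket y ^ m₂ * bracket ξ ^ m₃

/-- Smooth symbols with
`|∂_y^α ∂_η^β p(y, η)| ≤ C_{αβ} ⟨y⟩^{t₁} ⟨η⟩^{t₂ - |β|}`. -/
def IsSymbol {n : ℕ} (t₁ t₂ : ℝ) (p : E n → E n → ℂ) : Prop :=
  ContDiff ℝ ∞ (fun q : E n × E n => p q.1 q.2) ∧
  ∀ α β : Fin n → ℕ, ∃ C : ℝ, ∀ y η : E n,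
    ‖mixedD₂ α β p y η‖ ≤ C * bracket y ^ t₁ * bracket η ^ (t₂ - ((∑ j, β j : ℕ) : ℝ))

/-- Cut-offs in `C₀^∞(ℝⁿ × ℝⁿ)` that equal `1` near the origin. -/
def IsCutoff {n : ℕ} (χ : E n × E n → ℂ) : Prop :=
  ContDiff ℝ ∞ χ ∧ HasCompactSupport χ ∧ ∀ᶠ q in 𝓝 (0 : E n × E n), χ q = 1

/-- The regularized operator, with amplitude `a(x, y, ξ) χ(εy, εξ)`:
`(2π)^{-n} ∫∫ e^{i(φ(x,ξ) - y·ξ)} a(x, y, ξ) χ(εy, εξ) u(y) dy dξ`. -/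
def regularizedFIO {n : ℕ} (φ : E n → E n → ℝ) (a : E n → E n → E n → ℂ)
    (χ : E n × E n → ℂ) (ε : ℝ) (u : E n → ℂ) (x : E n) : ℂ :=
  ((2 * Real.pi : ℂ) ^ n)⁻¹ *
    ∫ ξ : E n, ∫ y : E n,
      Complex.exp (Complex.I * ((φ x ξ - inner ℝ y ξ : ℝ) : ℂ)) * a x y ξ *
        χ (ε • y, ε • ξ) * u y

/-- `T` is the operator
`Tu(x) = (2π)^{-n} ∫∫ e^{i(φ(x,ξ) - y·ξ)} a(x, y, ξ) u(y) dy dξ` on Schwartz functions, the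
oscillatory integral being the limit of the regularized ones as `ε → 0+`, for every cut-off. -/
def IsFIO {n : ℕ} (φ : E n → E n → ℝ) (a : E n → E n → E n → ℂ)
    (T : SchwartzMap (E n) ℂ → E n → ℂ) : Prop :=
  ∀ χ : E n × E n → ℂ, IsCutoff χ → ∀ (u : SchwartzMap (E n) ℂ) (x : E n),
    Tendsto (fun ε : ℝ => regularizedFIO φ a χ ε u x) (𝓝[>] 0) (𝓝 (T u x))

/-- `P = p(x, D)`: the operator with phase `x·ξ` and amplitude `p(x, ξ)`, that is
`Pu(x) = (2π)^{-n} ∫∫ e^{i(x - y)·ξ} p(x, ξ) u(y) dy dξ`. -/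
def IsPDO {n : ℕ} (p : E n → E n → ℂ) (P : SchwartzMap (E n) ℂ → E n → ℂ) : Prop :=
  IsFIO (fun x ξ => inner ℝ x ξ) (fun x _ ξ => p x ξ) P

/-- The sum over `|α| = k` of
`i^{|α|} / α! * ∂_y^α [a(x, y, ξ) ∂_ξ^α p(y, ξ)]` at `y = z`. -/
def compositionTerm {n : ℕ} (a : E n → E n → E n → ℂ) (p : E n → E n → ℂ) (k : ℕ)
    (x z ξ : E n) : ℂ :=
  ∑ α ∈ Finset.piAntidiag (Finset.univ : Finset (Fin n)) k,
    Complex.I ^ (∑ j, α j) / ((∏ j, (α j).factorial : ℕ) : ℂ) *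
      multiD α (fun y => a x y ξ * multiD α (fun ξ' => p y ξ') ξ) z

/-- `c ∼ ∑_k b_k`, improving in `ξ`, relative to the orders `m₁, m₂, m₃`: for all multi-indices
and all `M`, the given derivative of `c - ∑_{k < N} b_k` is
`O(⟨x⟩^{m₁} ⟨z⟩^{m₂} ⟨ξ⟩^{m₃ - M})` for all sufficiently large `N`. -/
def ExpansionImprovingInXi {n : ℕ} (m₁ m₂ m₃ : ℝ) (c : E n → E n → E n → ℂ)
    (b : ℕ → E n → E n → E n → ℂ) : Prop :=
  ∀ (α β γ : Fin n → ℕ) (M : ℝ), ∃ N₀ : ℕ, ∀ N : ℕ, N₀ ≤ N → ∃ C : ℝ, ∀ x z ξ : E n,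
    ‖mixedD₃ α β γ (fun x' z' ξ' => c x' z' ξ' - ∑ k ∈ Finset.range N, b k x' z' ξ') x z ξ‖ ≤
      C * bracket x ^ m₁ * bracket z ^ m₂ * bracket ξ ^ (m₃ - M)

end FIOCalc

end

open FIOCalc

/-!
For a smooth symbol `G(y, η)` of polynomial growth, `Os G = (2π)^{-n} ∫∫ e^{i y·η} G(y, η) dy dη`
is defined as an oscillatory integral: the first-order operator `L` (`oscL`) with
`∫ e^{i y·η} L G = ∫ e^{i y·η} G` lowers the order of a symbol by one, so that the integrals of
`L^M G` converge absolutely and agree for large `M`. The amplitude of the composition is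

`c(x, z, ξ) = Os_{(y, η)} [a(x, z + y, ξ) p(z + y, ξ + η)]`   (`compAmp`).

No phase enters. Everything is expressed through one kind of symbol class, `Sym w f`: all iterated
directional derivatives of `f` are bounded by multiples of the weight `w`. The weights are products
of powers of brackets, and families of functions are allowed, with bounds that are uniform in the
index. Five facts carry the proof.

* *Bounds.* If `G(v, q)` is a symbol in all its variables of weight `w(v) ⟨q⟩^K`, then `Os G(v, ·)`
  is a symbol of weight `w` (`Sym.os`). By Peetre's inequality the integrand of `c` is such a symbol
  (`sym_amp_mul`), whence `c` is an amplitude (`isAmplitude_compAmp`).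
* *Cut-offs.* The error of a cut-off `χ(ε·)` is `ε` times a symbol of one order more, so the
  oscillatory integrals of the cut-off symbols converge at rate `ε` (`os_cutoff`). Together with the
  rapid decay of Fourier integrals of decaying symbols (`fourier_decay`), this makes the operators
  with a measurable phase well defined and independent of the cut-off (`isFIO_fioOp`); a
  pseudodifferential operator maps Schwartz functions to Schwartz functions (`pdo`).
* *Composition.* A phase only enters through the factor `e^{i φ(x, ξ)}` of the outer integral, so the
  composition formula follows from the identity
  `∫ e^{-i z·ξ} c(x, z, ξ) u(z) dz = ∫ e^{-i y·ξ} a(x, y, ξ) Pu(y) dy` for every `ξ`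
  (`innerInt_compAmp`), which is Fubini's theorem once cut-offs are inserted.
* *Fourier inversion.* `Os` of a symbol `g(y)` is `g(0)` (`os_comp_fst`), and
  `Os (η^α G) = i^{|α|} Os (∂_y^α G)` (`os_monom_mul`).
* *Expansion.* Taylor's formula for `p(z + y, ξ + η)` in `η` (`taylor`) and the two preceding
  identities turn the terms of order less than `N` into those of the expansion, and the remainder
  into oscillatory integrals of symbols of order `m₃ + t₂ - N` in `ξ` (`compAmp_eq`), to which
  `Sym.os` applies.
-/

noncomputable section

set_option linter.unusedSectionVars false

namespace FIOCalc

variable {ι ι' V V' : Type*} [NormedAddCommGroup V] [NormedSpace ℝ V]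
  [NormedAddCommGroup V'] [NormedSpace ℝ V']

/-! ### Weighted symbol classes -/

/-- The directional derivative of `f` in the constant direction `v`, as an operator on functions. -/
def D (v : V) (f : V → ℂ) : V → ℂ := fun x => fderiv ℝ f x v

/-- The family `f i` is bounded by a constant times the weight `w i`, uniformly in `i`. -/
def BddBy (w : ι → V → ℝ) (f : ι → V → ℂ) : Prop :=
  ∃ C : ℝ, 0 ≤ C ∧ ∀ i v, ‖f i v‖ ≤ C * w i v

/-- All iterated directional derivatives of order at most `k` of the family `f i` exist and are
bounded by constants times the weight `w i`, uniformly in the index `i`. -/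
def SymN : ℕ → (ι → V → ℝ) → (ι → V → ℂ) → Prop
  | 0, w, f => BddBy w f
  | k + 1, w, f => BddBy w f ∧ (∀ i, Differentiable ℝ (f i)) ∧
      ∀ v : V, SymN k w (fun i => D v (f i))

/-- The symbol class of the weight `w`: all iterated directional derivatives of `f i` are bounded
by constants times `w i`, uniformly in the index `i`. The derivatives do not see the index, so a
variable placed in the index is a parameter in which no smoothness is asked. -/
def Sym (w : ι → V → ℝ) (f : ι → V → ℂ) : Prop := ∀ k, SymN k w f

theorem SymN.bdd {k : ℕ} {w : ι → V → ℝ} {f : ι → V → ℂ} (h : SymN k w f) : BddBy w f := by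
  cases k with
  | zero => exact h
  | succ k => exact h.1

theorem SymN.pred {k : ℕ} : ∀ {w : ι → V → ℝ} {f : ι → V → ℂ}, SymN (k + 1) w f → SymN k w f := by
  induction k with
  | zero => exact fun h => h.1
  | succ k ih => exact fun h => ⟨h.1, h.2.1, fun v => ih (h.2.2 v)⟩

theorem Sym.bdd {w : ι → V → ℝ} {f : ι → V → ℂ} (h : Sym w f) : BddBy w f := h 0

theorem Sym.differentiable {w : ι → V → ℝ} {f : ι → V → ℂ} (h : Sym w f) (i : ι) :
    Differentiable ℝ (f i) := (h 1).2.1 i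

theorem Sym.continuous {w : ι → V → ℝ} {f : ι → V → ℂ} (h : Sym w f) (i : ι) :
    Continuous (f i) := (h.differentiable i).continuous

theorem Sym.D {w : ι → V → ℝ} {f : ι → V → ℂ} (h : Sym w f) (v : V) :
    Sym w (fun i => D v (f i)) := fun k => (h (k + 1)).2.2 v

theorem BddBy.mono {w w' : ι → V → ℝ} {f : ι → V → ℂ} (h : BddBy w f) {K : ℝ} (hK : 0 ≤ K)
    (hw : ∀ i v, w i v ≤ K * w' i v) : BddBy w' f := by
  obtain ⟨C, hC, h⟩ := h
  refine ⟨C * K, by positivity, fun i v => (h i v).trans ?_⟩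
  rw [mul_assoc]
  exact mul_le_mul_of_nonneg_left (hw i v) hC

theorem SymN.mono {k : ℕ} {w w' : ι → V → ℝ} {K : ℝ} (hK : 0 ≤ K)
    (hw : ∀ i v, w i v ≤ K * w' i v) :
    ∀ {f : ι → V → ℂ}, SymN k w f → SymN k w' f := by
  induction k with
  | zero => exact fun h => BddBy.mono h hK hw
  | succ k ih => exact fun h => ⟨h.1.mono hK hw, h.2.1, fun v => ih (h.2.2 v)⟩

theorem Sym.mono {w w' : ι → V → ℝ} {f : ι → V → ℂ} (h : Sym w f) (K : ℝ) (hK : 0 ≤ K)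
    (hw : ∀ i v, w i v ≤ K * w' i v) : Sym w' f := fun k => (h k).mono hK hw

theorem Sym.mono_le {w w' : ι → V → ℝ} {f : ι → V → ℂ} (h : Sym w f)
    (hw : ∀ i v, w i v ≤ w' i v) : Sym w' f :=
  h.mono 1 zero_le_one (fun i v => by rw [one_mul]; exact hw i v)

theorem BddBy.add {w : ι → V → ℝ} {f g : ι → V → ℂ} (hf : BddBy w f) (hg : BddBy w g) :
    BddBy w (fun i v => f i v + g i v) := by
  obtain ⟨C, hC, hf⟩ := hf
  obtain ⟨C', hC', hg⟩ := hg
  refine ⟨C + C', by positivity, fun i v => (norm_add_le _ _).trans ?_⟩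
  rw [add_mul]
  exact add_le_add (hf i v) (hg i v)

theorem BddBy.mul {w w' : ι → V → ℝ} {f g : ι → V → ℂ} (hf : BddBy w f) (hg : BddBy w' g) :
    BddBy (fun i v => w i v * w' i v) (fun i v => f i v * g i v) := by
  obtain ⟨C, hC, hf⟩ := hf
  obtain ⟨C', hC', hg⟩ := hg
  refine ⟨C * C', by positivity, fun i v => ?_⟩
  rw [norm_mul]
  calc ‖f i v‖ * ‖g i v‖ ≤ (C * w i v) * (C' * w' i v) :=
        mul_le_mul (hf i v) (hg i v) (norm_nonneg _) ((norm_nonneg _).trans (hf i v))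
    _ = _ := by ring

theorem D_add (v : V) {f g : V → ℂ} (hf : Differentiable ℝ f) (hg : Differentiable ℝ g) :
    D v (fun x => f x + g x) = fun x => D v f x + D v g x := by
  ext x
  simp only [D]
  rw [fderiv_fun_add (hf x) (hg x)]
  rfl

theorem D_mul (v : V) {f g : V → ℂ} (hf : Differentiable ℝ f) (hg : Differentiable ℝ g) :
    D v (fun x => f x * g x) = fun x => D v f x * g x + f x * D v g x := by
  ext x
  simp only [D]
  rw [fderiv_fun_mul (hf x) (hg x)]
  simp only [_root_.add_apply, _root_.smul_apply, smul_eq_mul]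
  ring

theorem D_const (v : V) (c : ℂ) : D v (fun _ => c) = fun _ => 0 := by
  ext x
  simp [D]

theorem D_const_mul (v : V) (c : ℂ) {f : V → ℂ} (hf : Differentiable ℝ f) :
    D v (fun x => c * f x) = fun x => c * D v f x := by
  rw [D_mul v (differentiable_const c) hf, D_const]
  simp

theorem SymN.add {k : ℕ} {w : ι → V → ℝ} : ∀ {f g : ι → V → ℂ}, SymN k w f → SymN k w g →
    SymN k w (fun i v => f i v + g i v) := by
  induction k with
  | zero => exact fun hf hg => BddBy.add hf hg
  | succ k ih =>
    refine fun hf hg => ⟨hf.1.add hg.1, fun i => (hf.2.1 i).add (hg.2.1 i), fun v => ?_⟩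
    have := ih (hf.2.2 v) (hg.2.2 v)
    convert this using 2 with i
    exact D_add v (hf.2.1 i) (hg.2.1 i)

theorem SymN.mul {k : ℕ} {w w' : ι → V → ℝ} : ∀ {f g : ι → V → ℂ}, SymN k w f → SymN k w' g →
    SymN k (fun i v => w i v * w' i v) (fun i v => f i v * g i v) := by
  induction k with
  | zero => exact fun hf hg => BddBy.mul hf hg
  | succ k ih =>
    refine fun hf hg => ⟨hf.1.mul hg.1, fun i => (hf.2.1 i).mul (hg.2.1 i), fun v => ?_⟩
    have := (ih (hf.2.2 v) hg.pred).add (ih hf.pred (hg.2.2 v))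
    convert this using 2 with i
    exact D_mul v (hf.2.1 i) (hg.2.1 i)

theorem SymN.zero (k : ℕ) {w : ι → V → ℝ} : SymN k w (fun _ _ => 0) := by
  have hb : BddBy w (fun _ _ => (0 : ℂ)) := ⟨0, le_rfl, fun i v => by simp⟩
  induction k with
  | zero => exact hb
  | succ k ih =>
    refine ⟨hb, fun i => differentiable_const _, fun v => ?_⟩
    convert ih using 2 with i
    exact D_const v 0

/-- Scalars `c i` may depend on the index: they are absorbed in the weight. -/
theorem Sym.const (c : ι → ℂ) {w : ι → V → ℝ} (hw : ∀ i v, ‖c i‖ ≤ w i v) :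
    Sym w (fun i (_ : V) => c i) := by
  intro k
  have hb : BddBy w (fun i (_ : V) => c i) := ⟨1, zero_le_one, fun i v => by
    rw [one_mul]; exact hw i v⟩
  cases k with
  | zero => exact hb
  | succ k =>
    refine ⟨hb, fun i => differentiable_const _, fun v => ?_⟩
    convert SymN.zero (ι := ι) (V := V) k (w := w) using 2 with i
    exact D_const v (c i)

theorem Sym.one : Sym (fun (_ : ι) (_ : V) => (1 : ℝ)) (fun _ _ => 1) :=
  Sym.const _ (by simp)

theorem Sym.add {w : ι → V → ℝ} {f g : ι → V → ℂ} (hf : Sym w f) (hg : Sym w g) :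
    Sym w (fun i v => f i v + g i v) := fun k => (hf k).add (hg k)

theorem Sym.mul {w w' : ι → V → ℝ} {f g : ι → V → ℂ} (hf : Sym w f) (hg : Sym w' g) :
    Sym (fun i v => w i v * w' i v) (fun i v => f i v * g i v) := fun k => (hf k).mul (hg k)

theorem SymN.const_mul {k : ℕ} {w : ι → V → ℝ} {f : ι → V → ℂ} (c : ι → ℂ) {B : ℝ}
    (hB : 0 ≤ B) (hc : ∀ i, ‖c i‖ ≤ B) (hf : SymN k w f) :
    SymN k w (fun i v => c i * f i v) := by
  have := (Sym.const (V := V) c (w := fun _ _ => B) (fun i _ => hc i) k).mul hf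
  exact this.mono hB (fun i v => le_rfl)

theorem Sym.const_mul {w : ι → V → ℝ} {f : ι → V → ℂ} (hf : Sym w f) (c : ℂ) :
    Sym w (fun i v => c * f i v) :=
  fun k => (hf k).const_mul (fun _ => c) (norm_nonneg c) (fun _ => le_rfl)

theorem Sym.neg {w : ι → V → ℝ} {f : ι → V → ℂ} (hf : Sym w f) : Sym w (fun i v => -f i v) := by
  simpa using hf.const_mul (-1)

theorem SymN.sum {S : Type*} (s : Finset S) {k : ℕ} {w : ι → V → ℝ}
    {f : S → ι → V → ℂ} (h : ∀ a ∈ s, SymN k w (f a)) :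
    SymN k w (fun i v => ∑ a ∈ s, f a i v) := by
  classical
  induction s using Finset.induction_on with
  | empty => simpa using SymN.zero k
  | insert a s ha ih =>
    simp only [Finset.sum_insert ha]
    exact (h a (Finset.mem_insert_self a s)).add
      (ih (fun b hb => h b (Finset.mem_insert_of_mem hb)))

theorem Sym.sum {S : Type*} (s : Finset S) {w : ι → V → ℝ}
    {f : S → ι → V → ℂ} (h : ∀ a ∈ s, Sym w (f a)) :
    Sym w (fun i v => ∑ a ∈ s, f a i v) :=
  fun k => SymN.sum s (fun a ha => h a ha k)

theorem Sym.congr {w : ι → V → ℝ} {f g : ι → V → ℂ} (h : Sym w f) (e : ∀ i v, g i v = f i v) :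
    Sym w g := by
  have : g = f := by ext i v; exact e i v
  rwa [this]

section FiniteDim
variable [FiniteDimensional ℝ V]

theorem D_eq_sum_basis {S : Type*} [Fintype S] (b : Module.Basis S ℝ V) (v : V) (f : V → ℂ) :
    D v f = fun x => ∑ s, ((b.repr v s : ℝ) : ℂ) * D (b s) f x := by
  ext x
  have h := congrArg (fderiv ℝ f x) (b.sum_repr v)
  rw [map_sum] at h
  simp only [D, ← h, map_smul, Complex.real_smul]

/-- It is enough to bound the derivatives along a basis. -/
theorem SymN.succ_of_basis {S : Type*} [Fintype S] (b : Module.Basis S ℝ V) {k : ℕ}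
    {w : ι → V → ℝ} {f : ι → V → ℂ} (hb : BddBy w f) (hd : ∀ i, Differentiable ℝ (f i))
    (h : ∀ s, SymN k w (fun i => FIOCalc.D (b s) (f i))) :
    SymN (k + 1) w f := by
  refine ⟨hb, hd, fun v => ?_⟩
  simp only [D_eq_sum_basis b v]
  exact SymN.sum _ fun s _ => (h s).const_mul (fun _ => _) (norm_nonneg _) fun _ => le_rfl

theorem Sym.contDiff_nat (k : ℕ) : ∀ {w : ι → V → ℝ} {f : ι → V → ℂ}, Sym w f → ∀ i,
    ContDiff ℝ k (f i) := by
  induction k with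
  | zero => exact fun h i => contDiff_zero.2 (h.continuous i)
  | succ k ih =>
    intro w f h i
    push_cast
    rw [contDiff_succ_iff_fderiv_apply]
    exact ⟨h.differentiable i, by simp, fun v => ih (h.D v) i⟩

theorem Sym.contDiff {w : ι → V → ℝ} {f : ι → V → ℂ} (h : Sym w f) (i : ι) :
    ContDiff ℝ ∞ (f i) := contDiff_infty.2 fun k => h.contDiff_nat k i

theorem Sym.exists_fderiv_le {w : ι → V → ℝ} {f : ι → V → ℂ} (h : Sym w f) :
    ∃ C : ℝ, 0 ≤ C ∧ ∀ i v, ‖fderiv ℝ (f i) v‖ ≤ C * w i v := by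
  have b := Module.finBasis ℝ V
  obtain ⟨C, hC, hb⟩ := b.exists_opNorm_le (F := ℂ)
  choose K hK hKb using fun s => (h.D (b s)).bdd
  obtain ⟨C0, hC0, hb0⟩ := h.bdd
  have hK0 := Finset.sum_nonneg (fun s (_ : s ∈ Finset.univ) => hK s)
  refine ⟨C * (C0 + ∑ s, K s), by positivity, fun i v => ?_⟩
  rw [mul_assoc]
  have hsum : ∀ s, K s ≤ ∑ s, K s := fun s =>
    Finset.single_le_sum (f := K) (fun s _ => hK s) (Finset.mem_univ s)
  have h0 : 0 ≤ C0 * w i v := (norm_nonneg _).trans (hb0 i v)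
  have hs : ∀ s, 0 ≤ K s * w i v := fun s => (norm_nonneg _).trans (hKb s i v)
  have hS : 0 ≤ (∑ s, K s) * w i v := by
    rw [Finset.sum_mul]; exact Finset.sum_nonneg fun s _ => hs s
  refine hb (by rw [add_mul]; exact add_nonneg h0 hS) fun s => (hKb s i v).trans ?_
  rw [add_mul, Finset.sum_mul]
  have := Finset.single_le_sum (f := fun s => K s * w i v) (fun s _ => hs s) (Finset.mem_univ s)
  linarith

/-- A family of affine maps with bounded linear parts pulls symbols back to symbols. -/
theorem SymN.comp {k : ℕ} {w : ι → V → ℝ} (σ : ι' → ι) (A : ι' → V' →L[ℝ] V) (c : ι' → V)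
    {B : ℝ} (hB : ∀ i, ‖A i‖ ≤ B) : ∀ {f : ι → V → ℂ}, SymN k w f →
    SymN k (fun i v => w (σ i) (A i v + c i)) (fun i v => f (σ i) (A i v + c i)) := by
  induction k with
  | zero =>
    rintro f ⟨C, hC, h⟩
    exact ⟨C, hC, fun i v => h _ _⟩
  | succ k ih =>
    intro f h
    obtain ⟨C, hC, hb⟩ := h.1
    refine ⟨⟨C, hC, fun i v => hb _ _⟩, fun i => ?_, fun v => ?_⟩
    · exact (h.2.1 (σ i)).comp ((A i).differentiable.add_const _)
    · have hD : ∀ i, FIOCalc.D v (fun v => f (σ i) (A i v + c i)) =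
          fun x => FIOCalc.D (A i v) (f (σ i)) (A i x + c i) := by
        intro i
        ext x
        have h1 : HasFDerivAt (fun v => f (σ i) (A i v + c i))
            ((fderiv ℝ (f (σ i)) (A i x + c i)).comp (A i)) x :=
          (h.2.1 (σ i) (A i x + c i)).hasFDerivAt.comp x ((A i).hasFDerivAt.add_const (c i))
        simp only [FIOCalc.D, h1.fderiv]
        rfl
      have b := Module.finBasis ℝ V
      have hD' : (fun i => FIOCalc.D v (fun v => f (σ i) (A i v + c i))) = fun i x =>
          ∑ s, ((b.repr (A i v) s : ℝ) : ℂ) * FIOCalc.D (b s) (f (σ i)) (A i x + c i) := by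
        ext i x
        rw [hD, D_eq_sum_basis b]
      rw [hD']
      refine SymN.sum _ fun s _ => ?_
      have hlin := LinearMap.continuous_of_finiteDimensional (b.coord s)
      let l : V →L[ℝ] ℝ := ⟨b.coord s, hlin⟩
      refine (ih (h.2.2 (b s))).const_mul (fun i => _) (B := ‖l‖ * (|B| * ‖v‖)) (by positivity) fun i => ?_
      have : b.repr (A i v) s = l (A i v) := rfl
      rw [this, Complex.norm_real]
      refine (l.le_opNorm _).trans ?_
      gcongr
      exact ((A i).le_opNorm v).trans (by gcongr; exact (hB i).trans (le_abs_self B))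

theorem Sym.comp {w : ι → V → ℝ} {f : ι → V → ℂ} (h : Sym w f)
    (σ : ι' → ι) (A : ι' → V' →L[ℝ] V) (c : ι' → V) {B : ℝ} (hB : ∀ i, ‖A i‖ ≤ B) :
    Sym (fun i v => w (σ i) (A i v + c i)) (fun i v => f (σ i) (A i v + c i)) :=
  fun k => (h k).comp σ A c hB

/-- Restriction and relabelling of the index, with a fixed linear map. -/
theorem Sym.comp_affine {w : ι → V → ℝ} {f : ι → V → ℂ} (h : Sym w f)
    (σ : ι' → ι) (A : V' →L[ℝ] V) (c : ι' → V) :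
    Sym (fun i v => w (σ i) (A v + c i)) (fun i v => f (σ i) (A v + c i)) :=
  h.comp σ (fun _ => A) c (fun _ => le_rfl)

end FiniteDim

theorem Sym.reindex {w : ι → V → ℝ} {f : ι → V → ℂ} (h : Sym w f) (σ : ι' → ι) :
    Sym (fun i v => w (σ i) v) (fun i v => f (σ i) v) := by
  intro k
  have : ∀ {f : ι → V → ℂ}, SymN k w f → SymN k (fun i v => w (σ i) v) (fun i v => f (σ i) v) := by
    induction k with
    | zero =>
      rintro f ⟨C, hC, h⟩
      exact ⟨C, hC, fun i v => h _ _⟩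
    | succ k ih =>
      rintro f ⟨⟨C, hC, h⟩, h2, h3⟩
      exact ⟨⟨C, hC, fun i v => h _ _⟩, fun i => h2 _, fun v => ih (h3 v)⟩
  exact this (h k)

/-- A family of symbols integrates to a symbol, when the weight of the family splits off a factor
that is integrable in the variable of integration. -/
theorem SymN.integral [FiniteDimensional ℝ V] {Ω : Type*} [MeasurableSpace Ω] {μ : Measure Ω}
    {ρ : Ω → ℝ} (hρ : Integrable ρ μ) (hρ0 : ∀ θ, 0 ≤ ρ θ) {w : ι → V → ℝ}
    (hw : ∀ i, Continuous (w i)) {ψ : Ω → ℂ}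
    (hψ : AEStronglyMeasurable ψ μ) (hψ1 : ∀ θ, ‖ψ θ‖ ≤ 1) (k : ℕ) :
    ∀ {f : Ω × ι → V → ℂ}, Sym (fun q v => ρ q.1 * w q.2 v) f →
      (∀ i v, AEStronglyMeasurable (fun θ => f (θ, i) v) μ) →
      SymN k w (fun i v => ∫ θ, ψ θ * f (θ, i) v ∂μ) := by
  have hbd : ∀ {f : Ω × ι → V → ℂ}, Sym (fun q v => ρ q.1 * w q.2 v) f →
      BddBy w (fun i v => ∫ θ, ψ θ * f (θ, i) v ∂μ) := by
    intro f hf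
    obtain ⟨C, hC, hb⟩ := hf.bdd
    refine ⟨C * ∫ θ, ρ θ ∂μ, mul_nonneg hC (integral_nonneg hρ0), fun i v => ?_⟩
    calc ‖∫ θ, ψ θ * f (θ, i) v ∂μ‖ ≤ ∫ θ, C * ρ θ * w i v ∂μ := by
          refine norm_integral_le_of_norm_le ((hρ.const_mul C).mul_const _) (.of_forall fun θ => ?_)
          rw [norm_mul]
          calc ‖ψ θ‖ * ‖f (θ, i) v‖ ≤ 1 * (C * (ρ θ * w i v)) :=
                mul_le_mul (hψ1 θ) (hb (θ, i) v) (norm_nonneg _) zero_le_one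
            _ = _ := by ring
      _ = _ := by rw [integral_mul_const, integral_const_mul]
  induction k with
  | zero => exact fun hf _ => hbd hf
  | succ k ih =>
    intro f hf hm
    have hDm : ∀ v i x, AEStronglyMeasurable (fun θ => FIOCalc.D v (f (θ, i)) x) μ := by
      intro v i x
      -- measurability in `θ` passes to derivatives as limits of difference quotients
      refine aestronglyMeasurable_of_tendsto_ae (f := fun (j : ℕ) θ =>
        (j : ℝ) • (f (θ, i) (x + (j : ℝ)⁻¹ • v) - f (θ, i) x))
        atTop (fun j => ?_) (.of_forall fun θ => ?_)
      · exact ((hm i _).sub (hm i _)).const_smul (j : ℝ)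
      · have h1 := (hf.differentiable (θ, i) x).hasFDerivAt
        exact h1.lim v (c := fun j : ℕ => (j : ℝ)) (by
          simpa using tendsto_natCast_atTop_atTop)
    obtain ⟨C, hC, hb⟩ := hf.exists_fderiv_le
    have hfm : ∀ i x, AEStronglyMeasurable (fun θ => fderiv ℝ (f (θ, i)) x) μ := by
      intro i x
      have b := Module.finBasis ℝ V
      let l : Fin (Module.finrank ℝ V) → V →L[ℝ] ℝ := fun s =>
        ⟨b.coord s, LinearMap.continuous_of_finiteDimensional (b.coord s)⟩
      have : (fun θ => fderiv ℝ (f (θ, i)) x) = fun θ =>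
          ∑ s, ContinuousLinearMap.smulRightL ℝ V ℂ (l s) (FIOCalc.D (b s) (f (θ, i)) x) := by
        ext θ v
        have := congrFun (D_eq_sum_basis b v (f (θ, i))) x
        simp only [FIOCalc.D] at this
        rw [this]
        simp [FIOCalc.D, l]
      rw [this]
      refine Finset.aestronglyMeasurable_fun_sum _ fun s _ => ?_
      exact (ContinuousLinearMap.continuous _).comp_aestronglyMeasurable (hDm (b s) i x)
    have hint : ∀ i x, Integrable (fun θ => ψ θ * f (θ, i) x) μ := by
      intro i x
      obtain ⟨C, hC, hb⟩ := hf.bdd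
      refine ((hρ.const_mul C).mul_const (w i x)).mono' (hψ.mul (hm i x)) (.of_forall fun θ => ?_)
      rw [norm_mul]
      calc ‖ψ θ‖ * ‖f (θ, i) x‖ ≤ 1 * (C * (ρ θ * w i x)) :=
            mul_le_mul (hψ1 θ) (hb (θ, i) x) (norm_nonneg _) zero_le_one
        _ = _ := by ring
    have key : ∀ i x, HasFDerivAt (fun x => ∫ θ, ψ θ * f (θ, i) x ∂μ)
        (∫ θ, ψ θ • fderiv ℝ (f (θ, i)) x ∂μ) x ∧
        Integrable (fun θ => ψ θ • fderiv ℝ (f (θ, i)) x) μ := by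
      intro i x
      have hnb : {y | w i y < w i x + 1} ∈ 𝓝 x :=
        ((hw i).isOpen_preimage _ isOpen_Iio).mem_nhds (by simp)
      have hbound : ∀ θ, ∀ y ∈ {y | w i y < w i x + 1},
          ‖ψ θ • fderiv ℝ (f (θ, i)) y‖ ≤ C * ρ θ * (w i x + 1) := by
        intro θ y hy
        rw [norm_smul]
        calc ‖ψ θ‖ * ‖fderiv ℝ (f (θ, i)) y‖ ≤ 1 * (C * (ρ θ * w i y)) :=
              mul_le_mul (hψ1 θ) (hb (θ, i) y) (norm_nonneg _) zero_le_one
          _ = C * ρ θ * w i y := by ring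
          _ ≤ _ := mul_le_mul_of_nonneg_left (le_of_lt hy) (mul_nonneg hC (hρ0 θ))
      have hmm := hψ.smul (hfm i x)
      have hbi : Integrable (fun θ => C * ρ θ * (w i x + 1)) μ := (hρ.const_mul C).mul_const _
      refine ⟨hasFDerivAt_integral_of_dominated_of_fderiv_le hnb
        (.of_forall fun y => hψ.mul (hm i y)) (hint i x) hmm
        (.of_forall hbound) hbi (.of_forall fun θ y _ => ?_), ?_⟩
      · exact ((hf.differentiable (θ, i) y).hasFDerivAt).const_mul (ψ θ)
      · exact hbi.mono' hmm (.of_forall fun θ => hbound θ x (by simp))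
    refine ⟨hbd hf, fun i x => (key i x).1.differentiableAt, fun v => ?_⟩
    convert ih (hf.D v) (hDm v) using 2 with i
    ext x
    rw [FIOCalc.D, (key i x).1.fderiv, ContinuousLinearMap.integral_apply (key i x).2]
    rfl

/-- By induction on the order, since `D_v (1 / g) = -D_v g · (1 / g)²`. -/
theorem SymN.inv {u : ι → V → ℝ} (hu : ∀ i v, 0 < u i v) {g : ι → V → ℂ} (hg : Sym u g)
    (hg0 : ∀ i v, g i v ≠ 0) (hb : BddBy (fun i v => (u i v)⁻¹) (fun i v => (g i v)⁻¹)) (k : ℕ) :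
    SymN k (fun i v => (u i v)⁻¹) (fun i v => (g i v)⁻¹) := by
  induction k with
  | zero => exact hb
  | succ k ih =>
    refine ⟨hb, fun i => (hg.differentiable i).inv (hg0 i), fun v => ?_⟩
    have h := ((ih.mul ih).mul ((hg.D v).neg k)).mono (w' := fun i v => (u i v)⁻¹) zero_le_one
      (fun i v => by
        have := (hu i v).ne'
        rw [one_mul, mul_assoc, inv_mul_cancel₀ this, mul_one])
    convert h using 2 with i
    ext x
    have h1 : HasFDerivAt (fun x => (g i x)⁻¹) (-(g i x ^ 2)⁻¹ • fderiv ℝ (g i) x) x :=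
      ((hasDerivAt_inv (hg0 i x)).hasFDerivAt.restrictScalars ℝ).comp x
        (hg.differentiable i x).hasFDerivAt |>.congr_fderiv (by
          ext v; simp [mul_comm])
    rw [FIOCalc.D, h1.fderiv]
    simp only [_root_.smul_apply, smul_eq_mul, FIOCalc.D]
    ring

theorem Sym.inv {u : ι → V → ℝ} (hu : ∀ i v, 0 < u i v) {g : ι → V → ℂ} (hg : Sym u g)
    (hg0 : ∀ i v, g i v ≠ 0) (hb : BddBy (fun i v => (u i v)⁻¹) (fun i v => (g i v)⁻¹)) :
    Sym (fun i v => (u i v)⁻¹) (fun i v => (g i v)⁻¹) := SymN.inv hu hg hg0 hb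

theorem D_linear (v : V) (l : V →L[ℝ] ℝ) : D v (fun x => (l x : ℂ)) = fun _ => (l v : ℂ) := by
  ext x
  have : HasFDerivAt (fun x => (l x : ℂ)) (Complex.ofRealCLM.comp l) x :=
    (Complex.ofRealCLM.comp l).hasFDerivAt
  simp only [D, this.fderiv]
  rfl

/-- A linear form is a symbol of any weight that dominates it and the constants. -/
theorem Sym.linear (l : V →L[ℝ] ℝ) {w : ι → V → ℝ} (h1 : ∀ i v, 1 ≤ w i v)
    (h2 : ∀ i v, |l v| ≤ w i v) : Sym w (fun _ v => (l v : ℂ)) := by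
  intro k
  have hb : BddBy w (fun _ v => (l v : ℂ)) := ⟨1, zero_le_one, fun i v => by
    rw [one_mul, Complex.norm_real]; exact h2 i v⟩
  cases k with
  | zero => exact hb
  | succ k =>
    refine ⟨hb, fun i => (Complex.ofRealCLM.comp l).differentiable, fun v => ?_⟩
    simp only [D_linear]
    exact ((Sym.const (V := V) (fun _ : ι => (l v : ℂ)) (w := fun _ _ => |l v|)
      (fun i x => by rw [Complex.norm_real]; rfl)).mono (|l v|) (abs_nonneg _) (fun i x => by
        nlinarith [h1 i x, abs_nonneg (l v)])) k

/-- A smooth function with compact support is a symbol of every positive continuous weight. -/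
theorem Sym.of_hasCompactSupport {f : V → ℂ} (hf : ContDiff ℝ ∞ f)
    (hc : HasCompactSupport f) {w : V → ℝ} (hw : Continuous w) (hw0 : ∀ v, 0 < w v) :
    Sym (fun (_ : ι) => w) (fun _ => f) := by
  intro k
  induction k generalizing f with
  | zero =>
    obtain ⟨C, hC⟩ := (hc.smul_left (f := fun v => (w v)⁻¹)).exists_bound_of_continuous
      ((hw.inv₀ (fun v => (hw0 v).ne')).smul hf.continuous)
    refine ⟨|C|, abs_nonneg C, fun _ v => ?_⟩
    have h := (hC v).trans (le_abs_self C)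
    simp only [Pi.smul_apply', norm_smul, norm_inv, Real.norm_eq_abs, abs_of_pos (hw0 v)] at h
    rwa [inv_mul_le_iff₀ (hw0 v), mul_comm] at h
  | succ k ih =>
    refine ⟨(ih hf hc).bdd, fun _ => hf.differentiable (by simp), fun v => ?_⟩
    refine ih ?_ ?_
    · exact (hf.fderiv_right (m := ∞) (by simp)).clm_apply contDiff_const
    · exact hc.fderiv_apply (𝕜 := ℝ) v

/-! ### Weights -/

section Weights
variable {n : ℕ}

instance isAddHaarMeasure_volume_prod :
    (volume : Measure (E n × E n)).IsAddHaarMeasure :=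
  inferInstanceAs ((volume : Measure (E n)).prod (volume : Measure (E n))).IsAddHaarMeasure

theorem one_le_bracket (x : E n) : 1 ≤ bracket x := by
  rw [bracket, Real.one_le_sqrt]
  nlinarith [sq_nonneg ‖x‖]

theorem bracket_pos (x : E n) : 0 < bracket x := one_pos.trans_le (one_le_bracket x)

theorem bracket_sq (x : E n) : bracket x ^ 2 = 1 + ‖x‖ ^ 2 := Real.sq_sqrt (by positivity)

theorem norm_le_bracket (x : E n) : ‖x‖ ≤ bracket x :=
  Real.le_sqrt_of_sq_le (by linarith)

@[fun_prop]
theorem continuous_bracket : Continuous (bracket : E n → ℝ) := by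
  unfold bracket; fun_prop

theorem bracket_rpow_pos (x : E n) (s : ℝ) : 0 < bracket x ^ s :=
  Real.rpow_pos_of_pos (bracket_pos x) s

theorem continuous_bracket_rpow (s : ℝ) : Continuous fun x : E n => bracket x ^ s :=
  continuous_bracket.rpow_const fun x => Or.inl (bracket_pos x).ne'

theorem bracket_add_le (x y : E n) : bracket (x + y) ≤ 2 * bracket x * bracket y := by
  refine Real.sqrt_le_iff.2 ⟨by have := bracket_pos x; have := bracket_pos y; positivity, ?_⟩
  rw [mul_pow, mul_pow, bracket_sq, bracket_sq]
  have := norm_add_le x y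
  have h : ‖x + y‖ ^ 2 ≤ (‖x‖ + ‖y‖) ^ 2 := by gcongr
  nlinarith [sq_nonneg (‖x‖ - ‖y‖), mul_nonneg (sq_nonneg ‖x‖) (sq_nonneg ‖y‖)]

theorem bracket_neg (x : E n) : bracket (-x) = bracket x := by simp [bracket]

/-- Peetre's inequality. -/
theorem bracket_add_rpow_le (x y : E n) (s : ℝ) :
    bracket (x + y) ^ s ≤ 2 ^ |s| * (bracket x ^ s * bracket y ^ |s|) := by
  have hx := bracket_pos x
  have hy := bracket_pos y
  have hxy := bracket_pos (x + y)
  rcases le_or_gt 0 s with hs | hs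
  · rw [abs_of_nonneg hs, ← Real.mul_rpow hx.le hy.le, ← Real.mul_rpow (by norm_num) (by positivity)]
    exact Real.rpow_le_rpow hxy.le (by rw [← mul_assoc]; exact bracket_add_le x y) hs
  · rw [abs_of_neg hs]
    have h : bracket x ≤ 2 * bracket (x + y) * bracket y := by
      have := bracket_add_le (x + y) (-y)
      rwa [add_neg_cancel_right, bracket_neg] at this
    have h2 := Real.rpow_le_rpow hx.le h (neg_nonneg.2 hs.le)
    rw [Real.mul_rpow (by positivity) hy.le, Real.mul_rpow (by norm_num) hxy.le,
      Real.rpow_neg hxy.le, Real.rpow_neg hx.le] at h2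
    have h3 : 0 < bracket x ^ s := bracket_rpow_pos x s
    have h4 : 0 < bracket (x + y) ^ s := bracket_rpow_pos _ s
    have h5 := mul_le_mul_of_nonneg_left h2 (mul_pos h3 h4).le
    have e1 : bracket x ^ s * bracket (x + y) ^ s * (bracket x ^ s)⁻¹ = bracket (x + y) ^ s := by
      field_simp
    have e2 : bracket x ^ s * bracket (x + y) ^ s * (2 ^ (-s) * (bracket (x + y) ^ s)⁻¹ *
        bracket y ^ (-s)) = 2 ^ (-s) * (bracket x ^ s * bracket y ^ (-s)) := by
      field_simp
    rwa [e1, e2] at h5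

theorem bracket_rpow_le_rpow (x : E n) {s t : ℝ} (h : s ≤ t) : bracket x ^ s ≤ bracket x ^ t :=
  Real.rpow_le_rpow_of_exponent_le (one_le_bracket x) h

theorem integrable_bracket : Integrable fun x : E n => bracket x ^ (-(n + 1 : ℝ)) := by
  have h := integrable_rpow_neg_one_add_norm_sq (E := E n) (μ := volume) (r := n + 1) (by simp)
  refine h.congr (.of_forall fun x => ?_)
  simp only [bracket]
  rw [Real.sqrt_eq_rpow, ← Real.rpow_mul (by positivity)]
  congr 1
  ring

/-- The weight `(1 + |y|² + |η|²)^{1/2}` on phase space. -/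
def wt (q : E n × E n) : ℝ := Real.sqrt (1 + ‖q.1‖ ^ 2 + ‖q.2‖ ^ 2)

theorem one_le_wt (q : E n × E n) : 1 ≤ wt q := by
  rw [wt, Real.one_le_sqrt]
  nlinarith [sq_nonneg ‖q.1‖, sq_nonneg ‖q.2‖]

theorem wt_pos (q : E n × E n) : 0 < wt q := one_pos.trans_le (one_le_wt q)

theorem wt_sq (q : E n × E n) : wt q ^ 2 = 1 + ‖q.1‖ ^ 2 + ‖q.2‖ ^ 2 :=
  Real.sq_sqrt (by positivity)

theorem wt_rpow_pos (q : E n × E n) (s : ℝ) : 0 < wt q ^ s := Real.rpow_pos_of_pos (wt_pos q) s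

@[fun_prop]
theorem continuous_wt : Continuous (wt : E n × E n → ℝ) := by
  unfold wt; fun_prop

theorem continuous_wt_rpow (s : ℝ) : Continuous fun x : E n × E n => wt x ^ s :=
  continuous_wt.rpow_const fun x => Or.inl (wt_pos x).ne'

theorem wt_rpow_le_rpow (q : E n × E n) {s t : ℝ} (h : s ≤ t) : wt q ^ s ≤ wt q ^ t :=
  Real.rpow_le_rpow_of_exponent_le (one_le_wt q) h

theorem bracket_fst_le_wt (q : E n × E n) : bracket q.1 ≤ wt q :=
  Real.sqrt_le_sqrt (by nlinarith [sq_nonneg ‖q.2‖])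

theorem bracket_snd_le_wt (q : E n × E n) : bracket q.2 ≤ wt q :=
  Real.sqrt_le_sqrt (by nlinarith [sq_nonneg ‖q.1‖])

theorem wt_le_bracket_mul (q : E n × E n) : wt q ≤ bracket q.1 * bracket q.2 := by
  rw [bracket, bracket, ← Real.sqrt_mul (by positivity)]
  exact Real.sqrt_le_sqrt (by nlinarith [mul_nonneg (sq_nonneg ‖q.1‖) (sq_nonneg ‖q.2‖)])

theorem norm_le_wt (q : E n × E n) : ‖q‖ ≤ wt q :=
  max_le ((norm_le_bracket _).trans (bracket_fst_le_wt q))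
    ((norm_le_bracket _).trans (bracket_snd_le_wt q))

theorem integrable_wt : Integrable fun q : E n × E n => wt q ^ (-(2 * n + 1 : ℝ)) := by
  have h := integrable_rpow_neg_one_add_norm_sq (E := E n × E n) (μ := volume) (r := 2 * n + 1)
    (by simp [two_mul])
  refine h.mono' (continuous_wt_rpow _).aestronglyMeasurable (.of_forall fun q => ?_)
  rw [Real.norm_of_nonneg (wt_rpow_pos q _).le, wt, Real.sqrt_eq_rpow, ← Real.rpow_mul (by positivity)]
  have e : (1 / 2 : ℝ) * -(2 * n + 1) = -(2 * n + 1) / 2 := by ring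
  rw [e]
  refine Real.rpow_le_rpow_of_nonpos (by positivity) ?_ (by
    have : (0 : ℝ) ≤ n := n.cast_nonneg
    linarith)
  rcases max_cases ‖q.1‖ ‖q.2‖ with h | h <;>
  · rw [Prod.norm_def, h.1]
    nlinarith [sq_nonneg ‖q.1‖, sq_nonneg ‖q.2‖]

end Weights

/-! ### The integration by parts operator -/

/-- The first-order operator `F ↦ r₀ F + i ∑ₛ ∂_{bₛ} (rₛ F)`. -/
def oscStep {S : Type*} [Fintype S] (b : S → V) (r₀ : V → ℂ) (r : S → V → ℂ) (F : V → ℂ) : V → ℂ :=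
  fun v => r₀ v * F v + Complex.I * ∑ s, D (b s) (fun v => r s v * F v) v

theorem Sym.oscStep {S : Type*} [Fintype S] (b : S → V) {r₀ : ι → V → ℂ} {r : S → ι → V → ℂ}
    {κ w : ι → V → ℝ} (h₀ : Sym κ r₀) (h : ∀ s, Sym κ (r s)) {F : ι → V → ℂ} (hF : Sym w F) :
    Sym (fun i v => κ i v * w i v) (fun i => oscStep b (r₀ i) (fun s => r s i) (F i)) := by
  have := (h₀.mul hF).add ((Sym.sum Finset.univ (fun s _ => ((h s).mul hF).D (b s))).const_mul
    Complex.I)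
  exact this

/-- If the phase factor `ψ` satisfies `∂_{bₛ} ψ = i ℓₛ ψ` and `r₀ + ∑ₛ ℓₛ rₛ = 1`, integration by
parts moves the operator `oscStep` onto `ψ`, which it fixes. -/
theorem integral_oscStep {S : Type*} [Fintype S] [FiniteDimensional ℝ V] [MeasurableSpace V]
    [BorelSpace V] {μ : Measure V} [μ.IsAddHaarMeasure] (b : S → V) {r₀ : V → ℂ} {r : S → V → ℂ}
    {ℓ : S → V → ℂ} {ψ F : V → ℂ} (hψ : Differentiable ℝ ψ) (hF : Differentiable ℝ F)
    (hr : ∀ s, Differentiable ℝ (r s))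
    (hD : ∀ s, D (b s) ψ = fun v => Complex.I * ℓ s v * ψ v)
    (h1 : ∀ v, r₀ v + ∑ s, ℓ s v * r s v = 1)
    (i0 : Integrable (fun v => ψ v * (r₀ v * F v)) μ)
    (i1 : ∀ s, Integrable (fun v => ψ v * (r s v * F v)) μ)
    (i2 : ∀ s, Integrable (fun v => ψ v * D (b s) (fun v => r s v * F v) v) μ)
    (i3 : ∀ s, Integrable (fun v => ψ v * (ℓ s v * r s v * F v)) μ) :
    ∫ v, ψ v * oscStep b r₀ r F v ∂μ = ∫ v, ψ v * F v ∂μ := by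
  have hs : ∀ s, ∫ v, ψ v * D (b s) (fun v => r s v * F v) v ∂μ =
      -∫ v, Complex.I * (ψ v * (ℓ s v * r s v * F v)) ∂μ := by
    intro s
    have e : ∀ v, fderiv ℝ ψ v (b s) * (r s v * F v) =
        Complex.I * (ψ v * (ℓ s v * r s v * F v)) := by
      intro v
      have := congrFun (hD s) v
      simp only [D] at this
      rw [this]; ring
    have := integral_mul_fderiv_eq_neg_fderiv_mul_of_integrable (μ := μ) (f := ψ)
      (g := fun v => r s v * F v) (v := b s) ?_ (i2 s) (i1 s) (fun x _ => hψ x)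
      (fun x _ => ((hr s).mul hF) x)
    · simp only [D]
      rw [this]
      simp only [e]
    · simp only [e]
      exact (i3 s).const_mul _
  calc ∫ v, ψ v * oscStep b r₀ r F v ∂μ
      = ∫ v, ψ v * (r₀ v * F v) + Complex.I * ∑ s, ψ v * D (b s) (fun v => r s v * F v) v ∂μ := by
        congr 1; ext v
        rw [oscStep, mul_add, ← Finset.mul_sum]; ring
    _ = ∫ v, ψ v * (r₀ v * F v) ∂μ +
          Complex.I * ∑ s, ∫ v, ψ v * D (b s) (fun v => r s v * F v) v ∂μ := by
        rw [integral_add i0 ((integrable_finsetSum _ fun s _ => i2 s).const_mul _),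
          integral_const_mul, integral_finsetSum _ fun s _ => i2 s]
    _ = ∫ v, ψ v * (r₀ v * F v) ∂μ + ∑ s, ∫ v, ψ v * (ℓ s v * r s v * F v) ∂μ := by
        congr 1
        rw [Finset.mul_sum]
        refine Finset.sum_congr rfl fun s _ => ?_
        rw [hs, integral_const_mul, ← neg_mul_eq_mul_neg, ← mul_assoc, Complex.I_mul_I]
        ring
    _ = ∫ v, ψ v * F v ∂μ := by
        rw [← integral_finsetSum _ fun s _ => i3 s, ← integral_add i0
          (integrable_finsetSum _ fun s _ => i3 s)]
        congr 1; ext v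
        rw [← Finset.mul_sum, ← mul_add, ← Finset.sum_mul, ← add_mul, h1, one_mul]

theorem Sym.integrable_mul {w : ι → V → ℝ} {f : ι → V → ℂ} (h : Sym w f) [MeasurableSpace V]
    [BorelSpace V] [SecondCountableTopology V] {μ : Measure V} (i : ι) (hw : Integrable (w i) μ)
    {ψ : V → ℂ} (hψ : Continuous ψ) (h1 : ∀ v, ‖ψ v‖ ≤ 1) :
    Integrable (fun v => ψ v * f i v) μ := by
  obtain ⟨C, hC, hb⟩ := h.bdd
  refine (hw.const_mul C).mono' (hψ.mul (h.continuous i)).aestronglyMeasurable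
    (.of_forall fun v => ?_)
  rw [norm_mul]
  calc ‖ψ v‖ * ‖f i v‖ ≤ 1 * (C * w i v) :=
        mul_le_mul (h1 v) (hb i v) (norm_nonneg _) zero_le_one
    _ = _ := one_mul _

/-! ### Decay of Fourier integrals -/

section Fourier
variable {n : ℕ}

/-- The basis vector `e_j`. -/
abbrev ej (j : Fin n) : E n := EuclideanSpace.single j (1 : ℝ)

theorem hasFDerivAt_cexp_I (f : V → ℝ) (f' : V →L[ℝ] ℝ) (x : V) (h : HasFDerivAt f f' x) :
    HasFDerivAt (fun v => Complex.exp (Complex.I * (f v : ℂ)))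
      ((Complex.I * Complex.exp (Complex.I * (f x : ℂ))) • (Complex.ofRealCLM.comp f')) x := by
  have h1 : HasFDerivAt (fun v => (f v : ℂ)) (Complex.ofRealCLM.comp f') x :=
    Complex.ofRealCLM.hasFDerivAt.comp x h
  have h2 := (h1.const_mul Complex.I).cexp
  convert h2 using 1
  rw [smul_smul, mul_comm]

theorem norm_cexp_I (t : ℝ) : ‖Complex.exp (Complex.I * (t : ℂ))‖ = 1 := by
  rw [mul_comm, Complex.norm_exp_ofReal_mul_I]

/-- Rapid decay of the Fourier integrals `∫ e^{i y·θᵢ} Fᵢ(y) dy` of a family of symbols, in the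
frequency `θᵢ`. -/
theorem fourier_decay (θ : ι → E n) (N : ℕ) : ∀ {m : ι → ℝ} {F : ι → E n → ℂ},
    Sym (fun i y => m i * bracket y ^ (-(n + 1 : ℝ))) F →
    ∃ C : ℝ, 0 ≤ C ∧ ∀ i, ‖∫ y, Complex.exp (Complex.I * (inner ℝ y (θ i) : ℝ)) * F i y‖ ≤
      C * (m i * bracket (θ i) ^ (-(N : ℝ))) := by
  induction N with
  | zero =>
    intro m F hF
    obtain ⟨C, hC, hb⟩ := hF.bdd
    refine ⟨C * ∫ y : E n, bracket y ^ (-(n + 1 : ℝ)),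
      mul_nonneg hC (integral_nonneg fun y => (bracket_rpow_pos y _).le), fun i => ?_⟩
    calc _ ≤ ∫ y : E n, C * (m i * bracket y ^ (-(n + 1 : ℝ))) := by
          refine norm_integral_le_of_norm_le ((integrable_bracket.const_mul _).const_mul _)
            (.of_forall fun y => ?_)
          rw [norm_mul, norm_cexp_I, one_mul]
          exact hb i y
      _ = _ := by
          rw [integral_const_mul, integral_const_mul]
          simp only [Nat.cast_zero, neg_zero, Real.rpow_zero]
          ring
  | succ N ih =>
    intro m F hF
    set r₀ : ι → E n → ℂ := fun i _ => ((bracket (θ i) ^ 2 : ℝ) : ℂ)⁻¹ with hr₀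
    set r : Fin n → ι → E n → ℂ := fun j i _ => (θ i j : ℂ) * ((bracket (θ i) ^ 2 : ℝ) : ℂ)⁻¹
      with hr
    have hin : ∀ i, (bracket (θ i))⁻¹ ≤ 1 := fun i => inv_le_one_of_one_le₀ (one_le_bracket _)
    have hθ : ∀ i j, |θ i j| ≤ bracket (θ i) := fun i j =>
      ((PiLp.norm_apply_le (θ i) j)).trans (norm_le_bracket _)
    have s₀ : Sym (fun i (_ : E n) => (bracket (θ i))⁻¹) r₀ := by
      refine Sym.const _ fun i _ => ?_
      rw [norm_inv, Complex.norm_real, Real.norm_of_nonneg (by positivity), sq, mul_inv]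
      exact mul_le_of_le_one_right (inv_nonneg.2 (bracket_pos _).le) (hin i)
    have sr : ∀ j, Sym (fun i (_ : E n) => (bracket (θ i))⁻¹) (r j) := by
      intro j
      refine Sym.const _ fun i _ => ?_
      rw [norm_mul, norm_inv, Complex.norm_real, Complex.norm_real,
        Real.norm_of_nonneg (r := bracket (θ i) ^ 2) (by positivity), Real.norm_eq_abs]
      have := bracket_pos (θ i)
      rw [← div_eq_mul_inv, div_le_iff₀ (by positivity)]
      refine (hθ i j).trans (le_of_eq ?_)
      field_simp
    have hL := Sym.oscStep (fun j => ej j) s₀ sr hF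
    obtain ⟨C, hC, hb⟩ := ih (m := fun i => (bracket (θ i))⁻¹ * m i)
      (hL.mono_le fun i y => by rw [mul_assoc])
    refine ⟨C, hC, fun i => ?_⟩
    have hpos := bracket_pos (θ i)
    have hψ : ∀ y, HasFDerivAt (fun y => Complex.exp (Complex.I * (inner ℝ y (θ i) : ℝ)))
        ((Complex.I * Complex.exp (Complex.I * (inner ℝ y (θ i) : ℝ))) •
          (Complex.ofRealCLM.comp (innerSL ℝ (θ i)))) y := fun y => by
      refine hasFDerivAt_cexp_I _ _ y ?_
      have h : (fun y : E n => (inner ℝ y (θ i) : ℝ)) = fun y => innerSL ℝ (θ i) y :=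
        funext fun y => real_inner_comm (θ i) y
      rw [h]
      exact (innerSL ℝ (θ i)).hasFDerivAt
    have hcont : Continuous fun y : E n => Complex.exp (Complex.I * (inner ℝ y (θ i) : ℝ)) := by
      fun_prop
    have hn : ∀ y : E n, ‖Complex.exp (Complex.I * (inner ℝ y (θ i) : ℝ))‖ ≤ 1 :=
      fun y => (norm_cexp_I _).le
    have hint : ∀ a, Integrable (fun y : E n => a * (m i * bracket y ^ (-(n + 1 : ℝ)))) :=
      fun a => (integrable_bracket.const_mul _).const_mul _
    have key := integral_oscStep (μ := volume) (fun j => ej j) (r₀ := r₀ i)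
      (r := fun j => r j i) (ℓ := fun j _ => (θ i j : ℂ)) (F := F i)
      (fun y => (hψ y).differentiableAt) (hF.differentiable i) (fun j => (sr j).differentiable i)
      (fun j => ?_) (fun y => ?_) ?_ ?_ ?_ ?_
    · rw [← key]
      refine (hb i).trans (le_of_eq ?_)
      rw [Nat.cast_succ, neg_add, Real.rpow_add hpos, Real.rpow_neg_one]
      ring
    · ext y
      simp only [D, (hψ y).fderiv, _root_.smul_apply, smul_eq_mul,
        ContinuousLinearMap.comp_apply, innerSL_apply_apply, Complex.ofRealCLM_apply,
        EuclideanSpace.inner_single_right]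
      simp
      ring
    · simp only [hr₀, hr]
      have e : (bracket (θ i) ^ 2 : ℝ) = 1 + ∑ j, θ i j * θ i j := by
        rw [bracket_sq, EuclideanSpace.real_norm_sq_eq]
        simp [sq]
      have h0 : ((bracket (θ i) ^ 2 : ℝ) : ℂ) ≠ 0 := by exact_mod_cast (by positivity)
      simp only [← mul_assoc, ← Finset.sum_mul]
      rw [← one_add_mul, mul_inv_eq_one₀ h0, e]
      push_cast
      rfl
    · exact (s₀.mul hF).integrable_mul i (hint _) hcont hn
    · exact fun j => ((sr j).mul hF).integrable_mul i (hint _) hcont hn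
    · exact fun j => (((sr j).mul hF).D (ej j)).integrable_mul i (hint _) hcont hn
    · intro j
      have := (((sr j).mul hF).integrable_mul i (hint _) hcont hn).const_mul (θ i j : ℂ)
      refine this.congr (.of_forall fun y => ?_)
      simp only
      ring

end Fourier

/-! ### Oscillatory integrals on phase space -/

section Osc
variable {n : ℕ}

/-- The phase factor `e^{i y·η}`. -/
def psi (q : E n × E n) : ℂ := Complex.exp (Complex.I * (inner ℝ q.1 q.2 : ℝ))

/-- The coordinate directions of phase space: `inl j` is the direction of `y_j`, `inr j` that of
`η_j`. -/
def dir : Fin n ⊕ Fin n → E n × E n := Sum.elim (fun j => (ej j, 0)) (fun j => (0, ej j))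

/-- The coordinate conjugate to `dir s`: `η_j` for `inl j` and `y_j` for `inr j`. -/
def ell : Fin n ⊕ Fin n → (E n × E n →L[ℝ] ℝ) :=
  Sum.elim (fun j => (EuclideanSpace.proj j).comp (ContinuousLinearMap.snd ℝ (E n) (E n)))
    (fun j => (EuclideanSpace.proj j).comp (ContinuousLinearMap.fst ℝ (E n) (E n)))

/-- The reciprocal `(1 + |y|² + |η|²)⁻¹`. -/
def oscR₀ (q : E n × E n) : ℂ := ((wt q ^ 2 : ℝ) : ℂ)⁻¹

/-- The operator `L` with `∫ e^{i y·η} L F = ∫ e^{i y·η} F` for integrable symbols `F`; it improves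
the decay of a symbol by one order. -/
def oscL (F : E n × E n → ℂ) : E n × E n → ℂ :=
  oscStep dir oscR₀ (fun s q => (ell s q : ℂ) * oscR₀ q) F

theorem continuous_psi : Continuous (psi : E n × E n → ℂ) := by
  unfold psi; fun_prop

theorem norm_psi (q : E n × E n) : ‖psi q‖ = 1 := norm_cexp_I _

theorem hasFDerivAt_psi (q : E n × E n) : HasFDerivAt psi
    ((Complex.I * psi q) • Complex.ofRealCLM.comp (fderivInnerCLM ℝ q)) q :=
  hasFDerivAt_cexp_I (fun q : E n × E n => inner ℝ q.1 q.2) _ q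
    (isBoundedBilinearMap_inner.hasFDerivAt q)

theorem D_psi (s : Fin n ⊕ Fin n) :
    D (dir s) psi = fun q : E n × E n => Complex.I * (ell s q : ℂ) * psi q := by
  ext q
  rw [D, (hasFDerivAt_psi q).fderiv]
  rcases s with j | j
  · simp [dir, ell, fderivInnerCLM_apply, EuclideanSpace.inner_single_left]
    ring
  · simp [dir, ell, fderivInnerCLM_apply, EuclideanSpace.inner_single_right]
    ring

theorem abs_ell_le (s : Fin n ⊕ Fin n) (q : E n × E n) : |ell s q| ≤ wt q := by
  rcases s with j | j
  · exact ((PiLp.norm_apply_le q.2 j)).trans ((norm_le_bracket _).trans (bracket_snd_le_wt q))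
  · exact ((PiLp.norm_apply_le q.1 j)).trans ((norm_le_bracket _).trans (bracket_fst_le_wt q))

theorem sym_ell (s : Fin n ⊕ Fin n) : Sym (fun (_ : ι) (q : E n × E n) => wt q)
    (fun _ q => (ell s q : ℂ)) :=
  Sym.linear (ell s) (fun _ q => one_le_wt q) (fun _ q => abs_ell_le s q)

theorem one_add_sum_ell (q : E n × E n) : 1 + ∑ s, ell s q * ell s q = wt q ^ 2 := by
  rw [wt_sq, Fintype.sum_sum_type, EuclideanSpace.real_norm_sq_eq, EuclideanSpace.real_norm_sq_eq]
  simp only [ell, Sum.elim_inl, Sum.elim_inr, ContinuousLinearMap.comp_apply,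
    ContinuousLinearMap.coe_fst', ContinuousLinearMap.coe_snd', PiLp.proj_apply, sq]
  ring

theorem sym_oscR₀ : Sym (fun (_ : ι) (q : E n × E n) => (wt q ^ 2)⁻¹) (fun _ => oscR₀) := by
  have h : Sym (fun (_ : ι) (q : E n × E n) => wt q ^ 2) (fun _ q => ((wt q ^ 2 : ℝ) : ℂ)) := by
    have h1 : Sym (fun (_ : ι) (q : E n × E n) => wt q ^ 2)
        (fun _ q => 1 + ∑ s, (ell s q : ℂ) * (ell s q : ℂ)) := by
      refine (Sym.one.mono_le fun _ q => one_le_pow₀ (one_le_wt q)).add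
        (Sym.sum _ fun s _ => ((sym_ell s).mul (sym_ell s)).mono_le fun _ q => ?_)
      rw [sq]
    refine h1.congr fun _ q => ?_
    rw [← one_add_sum_ell]
    push_cast
    rfl
  refine Sym.inv (fun _ q => by have := wt_pos q; positivity) h (fun _ q => ?_)
    ⟨1, zero_le_one, fun _ q => ?_⟩
  · have := wt_pos q
    exact_mod_cast (by positivity)
  · have := wt_pos q
    rw [norm_inv, Complex.norm_real, Real.norm_of_nonneg (by positivity), one_mul]

theorem sym_oscR₀' : Sym (fun (_ : ι) (q : E n × E n) => (wt q)⁻¹) (fun _ => oscR₀) :=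
  sym_oscR₀.mono_le fun _ q =>
    inv_anti₀ (wt_pos q) (le_self_pow₀ (one_le_wt q) two_ne_zero)

theorem sym_oscR (s : Fin n ⊕ Fin n) : Sym (fun (_ : ι) (q : E n × E n) => (wt q)⁻¹)
    (fun _ q => (ell s q : ℂ) * oscR₀ q) :=
  ((sym_ell s).mul sym_oscR₀).mono_le fun _ q => by
    have := wt_pos q
    refine le_of_eq ?_
    field_simp

theorem inv_wt_mul_rpow (q : E n × E n) (K : ℝ) : (wt q)⁻¹ * wt q ^ K = wt q ^ (K - 1) := by
  rw [Real.rpow_sub (wt_pos q), Real.rpow_one, div_eq_inv_mul]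

theorem wt_mul_rpow (q : E n × E n) (K : ℝ) : wt q * wt q ^ K = wt q ^ (K + 1) := by
  rw [Real.rpow_add (wt_pos q), Real.rpow_one, mul_comm]

theorem Sym.oscL_iterate {m : ι → ℝ} {K : ℝ} {G : ι → E n × E n → ℂ}
    (h : Sym (fun i q => m i * wt q ^ K) G) (M : ℕ) :
    Sym (fun i q => m i * wt q ^ (K - M)) (fun i => oscL^[M] (G i)) := by
  induction M with
  | zero => simpa using h
  | succ M ih =>
    simp only [Function.iterate_succ_apply']
    refine (Sym.oscStep dir sym_oscR₀' sym_oscR ih).mono_le fun i q => ?_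
    rw [mul_left_comm, inv_wt_mul_rpow]
    push_cast
    rw [sub_sub]

/-- The regularised oscillatory integral `(2π)^{-n} ∫∫ e^{i y·η} L^M G dy dη`. -/
def osReg (M : ℕ) (G : E n × E n → ℂ) : ℂ :=
  ((2 * Real.pi : ℂ) ^ n)⁻¹ * ∫ q, psi q * oscL^[M] G q

/-- The oscillatory integral `(2π)^{-n} ∫∫ e^{i y·η} G(y, η) dy dη` of a symbol, defined as the
value that the regularised integrals take for all large `M`. -/
def Os (G : E n × E n → ℂ) : ℂ := limUnder atTop fun M => osReg M G

/-- Symbols of order `K` on phase space. -/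
def IsOsc (K : ℝ) (G : E n × E n → ℂ) : Prop := Sym (fun (_ : Unit) q => wt q ^ K) (fun _ => G)

theorem Sym.isOsc {m : ι → ℝ} {K : ℝ} {G : ι → E n × E n → ℂ}
    (h : Sym (fun i q => m i * wt q ^ K) G) (i : ι) : IsOsc K (G i) :=
  (h.reindex (fun _ => i)).mono |m i| (abs_nonneg _) fun _ q =>
    mul_le_mul_of_nonneg_right (le_abs_self _) (wt_rpow_pos q K).le

theorem IsOsc.sym_one_mul {K : ℝ} {G : E n × E n → ℂ} (h : IsOsc K G) :
    Sym (fun (_ : Unit) q => 1 * wt q ^ K) (fun _ => G) := by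
  simpa only [one_mul, IsOsc] using h

theorem IsOsc.oscL_iterate {K : ℝ} {G : E n × E n → ℂ} (h : IsOsc K G) (M : ℕ) :
    IsOsc (K - M) (oscL^[M] G) :=
  (h.sym_one_mul.oscL_iterate M).isOsc ()

theorem IsOsc.mono {K K' : ℝ} {G : E n × E n → ℂ} (h : IsOsc K G) (hK : K ≤ K') : IsOsc K' G :=
  Sym.mono_le h fun _ q => wt_rpow_le_rpow q hK

theorem IsOsc.add {K : ℝ} {G H : E n × E n → ℂ} (hG : IsOsc K G) (hH : IsOsc K H) :
    IsOsc K (fun q => G q + H q) := Sym.add hG hH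

theorem IsOsc.const_mul {K : ℝ} {G : E n × E n → ℂ} (hG : IsOsc K G) (c : ℂ) :
    IsOsc K (fun q => c * G q) := Sym.const_mul hG c

theorem IsOsc.D {K : ℝ} {G : E n × E n → ℂ} (hG : IsOsc K G) (v : E n × E n) :
    IsOsc K (D v G) := Sym.D hG v

theorem IsOsc.ell_mul {K : ℝ} {G : E n × E n → ℂ} (hG : IsOsc K G) (s : Fin n ⊕ Fin n) :
    IsOsc (K + 1) (fun q => (ell s q : ℂ) * G q) :=
  ((sym_ell s).mul hG).mono_le fun _ q => (wt_mul_rpow q K).le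

theorem IsOsc.differentiable {K : ℝ} {G : E n × E n → ℂ} (hG : IsOsc K G) :
    Differentiable ℝ G := Sym.differentiable hG ()

theorem integrable_wt_of_le {K : ℝ} (hK : K ≤ -(2 * n + 1)) :
    Integrable fun q : E n × E n => wt q ^ K :=
  integrable_wt.mono' (continuous_wt_rpow K).aestronglyMeasurable (.of_forall fun q => by
    rw [Real.norm_of_nonneg (wt_rpow_pos q K).le]
    exact wt_rpow_le_rpow q hK)

theorem IsOsc.integrable_psi_mul {K : ℝ} {G : E n × E n → ℂ} (hG : IsOsc K G)
    (hK : K ≤ -(2 * n + 1)) : Integrable fun q => psi q * G q :=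
  Sym.integrable_mul hG () (integrable_wt_of_le hK) continuous_psi fun q => (norm_psi q).le

theorem integral_psi_oscL {K : ℝ} {G : E n × E n → ℂ} (hG : IsOsc K G)
    (hK : K ≤ -(2 * n + 1)) : ∫ q, psi q * oscL G q = ∫ q, psi q * G q := by
  have h0 : IsOsc (K - 1) (fun q => oscR₀ q * G q) :=
    (sym_oscR₀'.mul hG).mono_le fun _ q => (inv_wt_mul_rpow q K).le
  have hr : ∀ s, IsOsc (K - 1) (fun q => (ell s q : ℂ) * oscR₀ q * G q) := fun s =>
    ((sym_oscR s).mul hG).mono_le fun _ q => (inv_wt_mul_rpow q K).le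
  refine integral_oscStep (μ := volume) dir (ℓ := fun s q => (ell s q : ℂ))
    (fun q => (hasFDerivAt_psi q).differentiableAt) hG.differentiable
    (fun s => (sym_oscR (ι := Unit) s).differentiable ()) D_psi (fun q => ?_) ?_ ?_ ?_ ?_
  · have h0 : ((wt q ^ 2 : ℝ) : ℂ) ≠ 0 := by
      have := wt_pos q
      exact_mod_cast (by positivity)
    simp only [← mul_assoc, ← Finset.sum_mul]
    rw [oscR₀, ← one_add_mul, mul_inv_eq_one₀ h0, ← one_add_sum_ell]
    push_cast
    rfl
  · exact h0.integrable_psi_mul (by linarith)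
  · exact fun s => (hr s).integrable_psi_mul (by linarith)
  · exact fun s => ((hr s).D (dir s)).integrable_psi_mul (by linarith)
  · intro s
    have := ((hr s).ell_mul s).integrable_psi_mul (by linarith)
    simpa only [mul_assoc] using this

/-- The regularised integrals agree as soon as they converge absolutely. -/
theorem os_eq {K : ℝ} {G : E n × E n → ℂ} (hG : IsOsc K G) {M : ℕ} (hM : K - M ≤ -(2 * n + 1)) :
    Os G = osReg M G := by
  have h : ∀ M' ≥ M, osReg M' G = osReg M G := by
    intro M' hM'
    induction M', hM' using Nat.le_induction with
    | base => rfl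
    | succ M' hM' ih =>
      rw [← ih, osReg, osReg, Function.iterate_succ_apply']
      congr 1
      refine integral_psi_oscL (hG.oscL_iterate M') ?_
      have : (M : ℝ) ≤ M' := by exact_mod_cast hM'
      linarith
  exact (tendsto_const_nhds.congr' (by
    filter_upwards [eventually_ge_atTop M] with M' hM'
    exact (h M' hM').symm)).limUnder_eq

theorem os_eq_integral {K : ℝ} {G : E n × E n → ℂ} (hG : IsOsc K G) (hK : K ≤ -(2 * n + 1)) :
    Os G = ((2 * Real.pi : ℂ) ^ n)⁻¹ * ∫ q, psi q * G q :=
  os_eq (M := 0) hG (by simpa using hK)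

theorem exists_order (K : ℝ) : ∃ M : ℕ, K - M ≤ -(2 * n + 1 : ℝ) := by
  obtain ⟨M, hM⟩ := exists_nat_ge (K + (2 * n + 1))
  exact ⟨M, by linarith⟩

/-- The oscillatory integral is bounded by a symbol seminorm, uniformly over a family. -/
theorem os_bound {m : ι → ℝ} {K : ℝ} {G : ι → E n × E n → ℂ}
    (h : Sym (fun i q => m i * wt q ^ K) G) : ∃ C : ℝ, 0 ≤ C ∧ ∀ i, ‖Os (G i)‖ ≤ C * m i := by
  obtain ⟨M, hM⟩ := exists_order (n := n) K
  obtain ⟨C, hC, hb⟩ := (h.oscL_iterate M).bdd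
  have hint := integrable_wt_of_le (n := n) hM
  refine ⟨‖((2 * Real.pi : ℂ) ^ n)⁻¹‖ * (C * ∫ q : E n × E n, wt q ^ (K - M)), mul_nonneg
    (norm_nonneg _) (mul_nonneg hC (integral_nonneg fun q => (wt_rpow_pos q _).le)), fun i => ?_⟩
  rw [os_eq (h.isOsc i) hM, osReg, norm_mul, mul_assoc]
  refine mul_le_mul_of_nonneg_left ?_ (norm_nonneg _)
  calc _ ≤ ∫ q : E n × E n, C * (m i * wt q ^ (K - M)) := by
        refine norm_integral_le_of_norm_le ((hint.const_mul _).const_mul _)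
          (.of_forall fun q => ?_)
        rw [norm_mul, norm_psi, one_mul]
        exact hb i q
    _ = _ := by
        rw [integral_const_mul, integral_const_mul]
        ring

theorem oscL_add {F G : E n × E n → ℂ} (hF : Differentiable ℝ F) (hG : Differentiable ℝ G) :
    oscL (fun q => F q + G q) = fun q => oscL F q + oscL G q := by
  ext q
  have hd : ∀ s, Differentiable ℝ fun q : E n × E n => (ell s q : ℂ) * oscR₀ q := fun s =>
    (sym_oscR (ι := Unit) s).differentiable ()
  have e : ∀ s, D (dir s) (fun q => (ell s q : ℂ) * oscR₀ q * F q + (ell s q : ℂ) * oscR₀ q * G q) =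
      fun q => D (dir s) (fun q => (ell s q : ℂ) * oscR₀ q * F q) q +
        D (dir s) (fun q => (ell s q : ℂ) * oscR₀ q * G q) q := fun s =>
    D_add _ ((hd s).mul hF) ((hd s).mul hG)
  simp only [oscL, oscStep, mul_add, e, Finset.sum_add_distrib]
  ring

theorem oscL_const_mul (c : ℂ) {F : E n × E n → ℂ} (hF : Differentiable ℝ F) :
    oscL (fun q => c * F q) = fun q => c * oscL F q := by
  ext q
  have hd : ∀ s, Differentiable ℝ fun q : E n × E n => (ell s q : ℂ) * oscR₀ q := fun s =>
    (sym_oscR (ι := Unit) s).differentiable ()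
  have e : ∀ s, D (dir s) (fun q => (ell s q : ℂ) * oscR₀ q * (c * F q)) =
      fun q => c * D (dir s) (fun q => (ell s q : ℂ) * oscR₀ q * F q) q := fun s => by
    simp only [mul_left_comm _ c]
    exact D_const_mul _ c ((hd s).mul hF)
  simp only [oscL, oscStep, e, ← Finset.mul_sum]
  ring

theorem os_add {K : ℝ} {F G : E n × E n → ℂ} (hF : IsOsc K F) (hG : IsOsc K G) :
    Os (fun q => F q + G q) = Os F + Os G := by
  obtain ⟨M, hM⟩ := exists_order (n := n) K
  have e : ∀ M : ℕ, oscL^[M] (fun q => F q + G q) = fun q => oscL^[M] F q + oscL^[M] G q := by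
    intro M
    induction M with
    | zero => rfl
    | succ M ih =>
      simp only [Function.iterate_succ_apply', ih]
      exact oscL_add (hF.oscL_iterate M).differentiable (hG.oscL_iterate M).differentiable
  rw [os_eq (hF.add hG) hM, os_eq hF hM, os_eq hG hM, osReg, osReg, osReg, e, ← mul_add,
    ← integral_add ((hF.oscL_iterate M).integrable_psi_mul hM)
      ((hG.oscL_iterate M).integrable_psi_mul hM)]
  simp only [mul_add]

theorem os_const_mul {K : ℝ} (c : ℂ) {F : E n × E n → ℂ} (hF : IsOsc K F) :
    Os (fun q => c * F q) = c * Os F := by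
  obtain ⟨M, hM⟩ := exists_order (n := n) K
  have e : ∀ M : ℕ, oscL^[M] (fun q => c * F q) = fun q => c * oscL^[M] F q := by
    intro M
    induction M with
    | zero => rfl
    | succ M ih =>
      simp only [Function.iterate_succ_apply', ih]
      exact oscL_const_mul c (hF.oscL_iterate M).differentiable
  rw [os_eq (hF.const_mul c) hM, os_eq hF hM, osReg, osReg, e]
  simp only [mul_left_comm _ c]
  rw [integral_const_mul, mul_left_comm]

theorem os_sub {K : ℝ} {F G : E n × E n → ℂ} (hF : IsOsc K F) (hG : IsOsc K G) :
    Os (fun q => F q - G q) = Os F - Os G := by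
  have := os_add hF (hG.const_mul (-1))
  rw [os_const_mul (-1) hG] at this
  simpa [sub_eq_add_neg] using this

theorem os_zero : Os (fun _ : E n × E n => 0) = 0 := by
  have h : IsOsc (n := n) 0 (fun _ => 1) := by
    simpa [IsOsc] using (Sym.one (ι := Unit) (V := E n × E n))
  simpa using os_const_mul 0 h

theorem os_sum {S : Type*} (s : Finset S) {K : ℝ} {F : S → E n × E n → ℂ}
    (hF : ∀ a ∈ s, IsOsc K (F a)) :
    Os (fun q => ∑ a ∈ s, F a q) = ∑ a ∈ s, Os (F a) := by
  classical
  induction s using Finset.induction_on with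
  | empty => simpa using os_zero
  | insert a s ha ih =>
    have h1 := hF a (Finset.mem_insert_self a s)
    have h2 : ∀ b ∈ s, IsOsc K (F b) := fun b hb => hF b (Finset.mem_insert_of_mem hb)
    simp only [Finset.sum_insert ha]
    rw [os_add h1 (Sym.sum s h2), ih h2]

/-! ### Cut-offs -/

theorem sym_dilate {W : Type*} [NormedAddCommGroup W] [NormedSpace ℝ W] [FiniteDimensional ℝ W]
    {f : W → ℂ} (hf : Sym (fun (_ : Unit) _ => 1) (fun _ => f)) :
    Sym (fun (_ : Set.Ioc (0 : ℝ) 1) _ => 1) (fun ε v => f ((ε : ℝ) • v)) := by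
  have h := hf.comp (V' := W) (ι' := Set.Ioc (0 : ℝ) 1) (fun _ => ())
    (fun ε => (ε : ℝ) • ContinuousLinearMap.id ℝ W) (fun _ => 0) (B := 1) (fun ε => by
      rw [norm_smul, Real.norm_of_nonneg ε.2.1.le]
      exact mul_le_one₀ ε.2.2 (norm_nonneg _) ContinuousLinearMap.norm_id_le)
  simpa using h

theorem cutoff_sym {χ : E n × E n → ℂ} (hχ : IsCutoff χ) {w : E n × E n → ℝ} (hw : Continuous w)
    (hw0 : ∀ q, 0 < w q) {ε : ℝ} (hε : 0 < ε) :
    Sym (fun (_ : ι) => w) (fun _ q => χ (ε • q)) := by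
  refine Sym.of_hasCompactSupport (f := fun q => χ (ε • q)) ?_ ?_ hw hw0
  · exact hχ.1.comp (contDiff_const_smul ε)
  · exact hχ.2.1.comp_smul hε.ne'

/-- The error `1 - χ(ε·)` of a dilated cut-off is of size `ε` in the symbols of order one: it is
bounded, and vanishes unless `ε ⟨q⟩` is bounded from below, while each derivative brings out a factor
`ε`. -/
theorem one_sub_cutoff_sym {χ : E n × E n → ℂ} (hχ : IsCutoff χ) :
    Sym (fun (ε : Set.Ioc (0 : ℝ) 1) q => (ε : ℝ) * wt q) (fun ε q => 1 - χ ((ε : ℝ) • q)) := by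
  obtain ⟨h1, h2, h3⟩ := hχ
  have hs : Sym (fun (_ : Unit) _ => 1) (fun _ => χ) :=
    Sym.of_hasCompactSupport h1 h2 continuous_const fun _ => one_pos
  have hb : BddBy (fun (ε : Set.Ioc (0 : ℝ) 1) q => (ε : ℝ) * wt q)
      (fun ε q => 1 - χ ((ε : ℝ) • q)) := by
    obtain ⟨δ, hδ, hball⟩ := Metric.eventually_nhds_iff.1 h3
    obtain ⟨C, hC, hCb⟩ := hs.bdd
    refine ⟨(1 + C) / δ, by positivity, fun ε q => ?_⟩
    have hε := ε.2.1
    rcases lt_or_ge ‖(ε : ℝ) • q‖ δ with h | h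
    · have := wt_pos q
      simp only
      rw [hball (by simpa using h), sub_self, norm_zero]
      positivity
    · have h5 : ‖1 - χ ((ε : ℝ) • q)‖ ≤ 1 + C :=
        (norm_sub_le _ _).trans (by simpa using hCb () ((ε : ℝ) • q))
      rw [norm_smul, Real.norm_of_nonneg hε.le] at h
      have h6 : δ ≤ ε * wt q := h.trans (mul_le_mul_of_nonneg_left (norm_le_wt q) hε.le)
      rw [div_mul_eq_mul_div, le_div_iff₀ hδ]
      exact mul_le_mul h5 h6 hδ.le (by positivity)
  have hd : ∀ ε : Set.Ioc (0 : ℝ) 1, Differentiable ℝ fun q : E n × E n => χ ((ε : ℝ) • q) :=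
    fun ε => (h1.differentiable (by simp)).comp (differentiable_id.const_smul (ε : ℝ))
  intro k
  cases k with
  | zero => exact hb
  | succ k =>
    refine ⟨hb, fun ε => (hd ε).const_sub 1, fun v => ?_⟩
    have h := (sym_dilate (hs.D v)).mul (Sym.const (V := E n × E n)
      (fun ε : Set.Ioc (0 : ℝ) 1 => -((ε : ℝ) : ℂ)) (w := fun ε _ => (ε : ℝ)) (fun ε _ => by
        rw [norm_neg, Complex.norm_real, Real.norm_of_nonneg ε.2.1.le]))
    have h' := h.mono_le (w' := fun (ε : Set.Ioc (0 : ℝ) 1) q => (ε : ℝ) * wt q) fun ε q => by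
      rw [one_mul]
      exact le_mul_of_one_le_right ε.2.1.le (one_le_wt q)
    convert h' k using 2 with ε
    ext q
    have hh : HasFDerivAt (fun q : E n × E n => χ ((ε : ℝ) • q))
        ((fderiv ℝ χ ((ε : ℝ) • q)).comp ((ε : ℝ) • ContinuousLinearMap.id ℝ (E n × E n))) q :=
      (h1.differentiable (by simp) _).hasFDerivAt.comp q ((hasFDerivAt_id q).const_smul (ε : ℝ))
    rw [FIOCalc.D, (hh.const_sub 1).fderiv]
    simp [FIOCalc.D, mul_comm]

theorem exists_cutoff (n : ℕ) : ∃ χ : E n × E n → ℂ, IsCutoff χ := by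
  let f : ContDiffBump (0 : E n × E n) := ⟨1, 2, one_pos, one_lt_two⟩
  refine ⟨fun q => (f q : ℂ), Complex.ofRealCLM.contDiff.comp f.contDiff,
    f.hasCompactSupport.comp_left (g := fun x : ℝ => (x : ℂ)) Complex.ofReal_zero, ?_⟩
  filter_upwards [f.eventuallyEq_one] with q hq
  simp [hq]

/-- Cutting off a family of symbols at scale `1 / ε` changes the oscillatory integrals by
`O(ε)`. -/
theorem os_cutoff {χ : E n × E n → ℂ} (hχ : IsCutoff χ) {m : ι → ℝ} {K : ℝ}
    {G : ι → E n × E n → ℂ} (h : Sym (fun i q => m i * wt q ^ K) G) :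
    ∃ C : ℝ, 0 ≤ C ∧ ∀ ε : ℝ, 0 < ε → ε ≤ 1 → ∀ i,
      ‖Os (G i) - Os (fun q => χ (ε • q) * G i q)‖ ≤ C * (ε * m i) := by
  have h1 : Sym (fun (j : Set.Ioc (0 : ℝ) 1 × ι) q => ((j.1 : ℝ) * m j.2) * wt q ^ (K + 1))
      (fun j q => (1 - χ ((j.1 : ℝ) • q)) * G j.2 q) :=
    (((one_sub_cutoff_sym hχ).reindex Prod.fst).mul (h.reindex Prod.snd)).mono_le fun j q => by
      rw [← wt_mul_rpow]
      exact le_of_eq (by ring)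
  obtain ⟨C, hC, hb⟩ := os_bound h1
  refine ⟨C, hC, fun ε h0 h1' i => ?_⟩
  have := hb (⟨ε, h0, h1'⟩, i)
  have h2 := cutoff_sym (ι := Unit) hχ continuous_const (fun _ => one_pos) h0
  have h3 : IsOsc K (fun q => χ (ε • q) * G i q) :=
    (Sym.mul h2 (h.isOsc i)).mono_le fun _ q => by rw [one_mul]
  rw [← os_sub (h.isOsc i) h3]
  simpa only [sub_mul, one_mul] using this

theorem eq_of_norm_sub_le {z w : ℂ} {C : ℝ} (h : ∀ ε : ℝ, 0 < ε → ε ≤ 1 → ‖z - w‖ ≤ C * ε) :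
    z = w := by
  have hC : 0 ≤ C := by simpa using (norm_nonneg _).trans (h 1 one_pos le_rfl)
  rw [← sub_eq_zero, ← norm_le_zero_iff]
  refine le_of_forall_pos_le_add fun δ hδ => ?_
  have h1 := h (min 1 (δ / (C + 1))) (by positivity) (min_le_left _ _)
  have h2 : C * min 1 (δ / (C + 1)) ≤ C * (δ / (C + 1)) :=
    mul_le_mul_of_nonneg_left (min_le_right _ _) hC
  have h3 : C * (δ / (C + 1)) ≤ δ := by
    rw [mul_div_assoc', div_le_iff₀ (by positivity)]
    nlinarith
  linarith

/-- Integration by parts in an oscillatory integral. -/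
theorem os_ell_mul {K : ℝ} {G : E n × E n → ℂ} (hG : IsOsc K G) (s : Fin n ⊕ Fin n) :
    Os (fun q => (ell s q : ℂ) * G q) = Complex.I * Os (D (dir s) G) := by
  obtain ⟨χ, hχ⟩ := exists_cutoff n
  obtain ⟨C₁, hC₁, hb₁⟩ := os_cutoff hχ (hG.ell_mul s).sym_one_mul
  have hH : Sym (fun (ε : Set.Ioc (0 : ℝ) 1) q => (ε : ℝ) * wt q ^ (K + 1))
      (fun ε q => (1 - χ ((ε : ℝ) • q)) * G q) :=
    ((one_sub_cutoff_sym hχ).mul (Sym.reindex hG fun _ => ())).mono_le fun ε q => by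
      rw [← wt_mul_rpow]
      exact le_of_eq (by ring)
  obtain ⟨C₂, hC₂, hb₂⟩ := os_bound (hH.D (dir s))
  refine eq_of_norm_sub_le (C := C₁ + C₂) fun ε h0 h1 => ?_
  have e0 := hb₁ ε h0 h1 ()
  have e1 := hb₂ ⟨ε, h0, h1⟩
  simp only at e0 e1
  -- the cut-off symbol decays, so that the classical formula applies to it
  set F : E n × E n → ℂ := fun q => χ (ε • q) * G q with hF
  have hFo : IsOsc (-(2 * n + 1) - 1) F :=
    ((cutoff_sym (ι := Unit) hχ (continuous_wt_rpow (-(2 * n + 1) - 1 - K))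
      (fun q => wt_rpow_pos q _) h0).mul hG).mono_le fun _ q => by
        rw [← Real.rpow_add (wt_pos q)]; simp
  have hFK : IsOsc K F :=
    ((cutoff_sym (ι := Unit) hχ continuous_const (fun _ => one_pos) h0).mul hG).mono_le
      fun _ q => by rw [one_mul]
  have key : Os (fun q => (ell s q : ℂ) * F q) = Complex.I * Os (D (dir s) F) := by
    rw [os_eq_integral (hFo.ell_mul s) (by linarith), os_eq_integral (hFo.D (dir s)) (by linarith),
      mul_left_comm]
    congr 1
    have i1 := (hFo.D (dir s)).integrable_psi_mul (by linarith)
    have i2 := (hFo.ell_mul s).integrable_psi_mul (by linarith)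
    have hD : ∀ q, fderiv ℝ psi q (dir s) * F q = Complex.I * (psi q * ((ell s q : ℂ) * F q)) := by
      intro q
      have := congrFun (D_psi s) q
      simp only [D] at this
      rw [this]; ring
    have := integral_mul_fderiv_eq_neg_fderiv_mul_of_integrable (μ := volume) (f := psi) (g := F)
      (v := dir s) (by simp only [hD]; exact i2.const_mul _) i1
      (hFo.integrable_psi_mul (by linarith)) (fun q _ => (hasFDerivAt_psi q).differentiableAt)
      (fun q _ => hFo.differentiable q)
    simp only [hD] at this
    simp only [D] at this ⊢
    rw [this, integral_const_mul, ← neg_mul_eq_mul_neg, ← mul_assoc, Complex.I_mul_I]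
    ring
  have e2 : D (dir s) (fun q => (1 - χ (ε • q)) * G q) =
      fun q => D (dir s) G q - D (dir s) F q := by
    ext q
    have : (fun q => (1 - χ (ε • q)) * G q) = fun q => G q + (-1) * F q := by
      ext q; simp [hF]; ring
    rw [this, D_add _ hG.differentiable (hFo.differentiable.const_mul _),
      D_const_mul _ _ hFo.differentiable]
    ring
  rw [e2, os_sub (hG.D _) (hFK.D _)] at e1
  have e3 : Os (fun q => (ell s q : ℂ) * G q) - Complex.I * Os (D (dir s) G) =
      (Os (fun q => (ell s q : ℂ) * G q) - Os (fun q => (ell s q : ℂ) * F q)) -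
        Complex.I * (Os (D (dir s) G) - Os (D (dir s) F)) := by
    rw [key]; ring
  rw [e3]
  refine (norm_sub_le _ _).trans ?_
  rw [norm_mul, Complex.norm_I, one_mul, add_mul]
  refine add_le_add ?_ e1
  simp only [mul_left_comm (χ _), mul_one] at e0
  exact e0

/-! ### Dependence on parameters -/

theorem D_slice {v : V} {w : V'} {F : V × V' → ℂ} (hF : Differentiable ℝ F) (b : V') :
    D b (fun w => F (v, w)) w = D ((0 : V), b) F (v, w) := by
  have h : HasFDerivAt (fun w => F (v, w))
      ((fderiv ℝ F (v, w)).comp (ContinuousLinearMap.inr ℝ V V')) w :=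
    (hF (v, w)).hasFDerivAt.comp w (hasFDerivAt_prodMk_right v w)
  rw [D, h.fderiv]
  rfl

/-- The oscillatory integral of a symbol in the joint variables is a symbol in the parameters. -/
theorem Sym.os [FiniteDimensional ℝ V] {w : V → ℝ} (hw : Continuous w) {K : ℝ}
    {G : V × (E n × E n) → ℂ}
    (hG : Sym (fun (_ : Unit) (v : V × (E n × E n)) => w v.1 * wt v.2 ^ K) (fun _ => G)) :
    Sym (fun (_ : Unit) => w) (fun _ v => Os fun q => G (v, q)) := by
  obtain ⟨M, hM⟩ := exists_order (n := n) K
  set T : (V × (E n × E n) → ℂ) → V × (E n × E n) → ℂ :=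
    FIOCalc.oscStep (fun s => (0, dir s)) (fun v => oscR₀ v.2)
      (fun s v => (ell s v.2 : ℂ) * oscR₀ v.2) with hT
  have hr₀ : Sym (fun (_ : Unit) (v : V × (E n × E n)) => (wt v.2)⁻¹) (fun _ v => oscR₀ v.2) := by
    simpa using (sym_oscR₀' (ι := Unit) (n := n)).comp_affine (ι' := Unit) id
      (ContinuousLinearMap.snd ℝ V (E n × E n)) (fun _ => 0)
  have hr : ∀ s, Sym (fun (_ : Unit) (v : V × (E n × E n)) => (wt v.2)⁻¹)
      (fun _ v => (ell s v.2 : ℂ) * oscR₀ v.2) := fun s => by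
    simpa using (sym_oscR (ι := Unit) (n := n) s).comp_affine (ι' := Unit) id
      (ContinuousLinearMap.snd ℝ V (E n × E n)) (fun _ => 0)
  have hTM : ∀ M : ℕ, Sym (fun (_ : Unit) (v : V × (E n × E n)) => w v.1 * wt v.2 ^ (K - M))
      (fun _ => T^[M] G) ∧
      ∀ v, oscL^[M] (fun q => G (v, q)) = fun q => T^[M] G (v, q) := by
    intro M
    induction M with
    | zero => exact ⟨by simpa using hG, fun v => rfl⟩
    | succ M ih =>
      simp only [Function.iterate_succ_apply']
      refine ⟨(Sym.oscStep _ hr₀ hr ih.1).mono_le fun _ v => ?_, fun v => ?_⟩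
      · rw [mul_left_comm, inv_wt_mul_rpow]
        push_cast
        rw [sub_sub]
      · rw [ih.2 v]
        ext q
        simp only [oscL, hT, FIOCalc.oscStep]
        congr 2
        refine Finset.sum_congr rfl fun s _ => ?_
        exact D_slice (F := fun v => (ell s v.2 : ℂ) * oscR₀ v.2 * T^[M] G v)
          (((hr s).mul ih.1).differentiable ()) (dir s)
  have hOs : ∀ v, Os (fun q => G (v, q)) =
      ((2 * Real.pi : ℂ) ^ n)⁻¹ * ∫ q, psi q * T^[M] G (v, q) := by
    intro v
    have : IsOsc K (fun q => G (v, q)) := by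
      refine Sym.isOsc (m := fun _ : Unit => w v) (G := fun _ q => G (v, q)) ?_ ()
      simpa using hG.comp_affine (ι' := Unit) id (ContinuousLinearMap.inr ℝ V (E n × E n))
        (fun _ => (v, 0))
    rw [os_eq this hM, osReg, (hTM M).2 v]
  simp only [hOs]
  refine Sym.const_mul (fun k => ?_) _
  have hH := (hTM M).1
  refine SymN.integral (integrable_wt_of_le (n := n) hM) (fun q => (wt_rpow_pos q _).le)
    (fun _ => hw) continuous_psi.aestronglyMeasurable (fun q => (norm_psi q).le) k
    (f := fun j v => T^[M] G (v, j.1)) ?_ fun _ v => ?_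
  · refine Sym.mono_le (w := fun (j : (E n × E n) × Unit) v => w v * wt j.1 ^ (K - M)) ?_
      fun j v => (mul_comm _ _).le
    simpa using hH.comp_affine (ι' := (E n × E n) × Unit) (fun _ => ())
      (ContinuousLinearMap.inl ℝ V (E n × E n)) (fun j => (0, j.1))
  · exact ((hH.continuous ()).comp (by fun_prop : Continuous fun q : E n × E n =>
      (v, q))).aestronglyMeasurable

end Osc

/-! ### Iterated integrals -/

section Iterated
variable {n : ℕ}

/-- The inner integral `∫ e^{i y·θ(η)} G(y, η) dy`. -/
def innerInt (θ : E n → E n) (G : E n × E n → ℂ) (η : E n) : ℂ :=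
  ∫ y, Complex.exp (Complex.I * (inner ℝ y (θ η) : ℝ)) * G (y, η)

/-- In applications `θ(η) = ± η`; the rapid decay in `θ(η)` then beats the growth of order `l` in
`η`, and the inner integral is integrable in `η`. -/
theorem innerInt_bound {θ : E n → E n} (hθ : ∀ η, bracket (θ η) = bracket η) {m : ι → ℝ}
    (hm : ∀ i, 0 ≤ m i) {l : ℝ} {G : ι → E n × E n → ℂ}
    (hG : Sym (fun i q => m i * (bracket q.1 ^ (-(n + 1 : ℝ)) * bracket q.2 ^ l)) G) :
    ∃ C : ℝ, 0 ≤ C ∧ ∀ i η, ‖innerInt θ (G i) η‖ ≤ C * (m i * bracket η ^ (-(n + 1 : ℝ))) := by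
  obtain ⟨N, hN⟩ := exists_nat_ge (l + (n + 1))
  have h : Sym (fun (j : ι × E n) y => (m j.1 * bracket j.2 ^ l) * bracket y ^ (-(n + 1 : ℝ)))
      (fun j y => G j.1 (y, j.2)) := by
    have := hG.comp_affine (ι' := ι × E n) Prod.fst (ContinuousLinearMap.inl ℝ (E n) (E n))
      (fun j => (0, j.2))
    simp only [ContinuousLinearMap.inl_apply, Prod.mk_add_mk, add_zero, zero_add] at this
    exact this.mono_le fun j y => le_of_eq (by ring)
  obtain ⟨C, hC, hb⟩ := fourier_decay (fun j : ι × E n => θ j.2) N h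
  refine ⟨C, hC, fun i η => (hb (i, η)).trans (mul_le_mul_of_nonneg_left ?_ hC)⟩
  simp only
  rw [hθ, mul_assoc, ← Real.rpow_add (bracket_pos η)]
  exact mul_le_mul_of_nonneg_left (bracket_rpow_le_rpow η (by linarith)) (hm i)

theorem innerInt_measurable {θ : E n → E n} (hθ : Continuous θ) {G : E n × E n → ℂ}
    (hG : Continuous G) : AEStronglyMeasurable (innerInt θ G) := by
  have hc : Continuous (Function.uncurry fun η y : E n =>
      Complex.exp (Complex.I * (inner ℝ y (θ η) : ℝ)) * G (y, η)) := by
    unfold Function.uncurry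
    fun_prop
  exact (StronglyMeasurable.integral_prod_right (ν := volume) hc.stronglyMeasurable).aestronglyMeasurable

/-- Symbols that decay in `y` and are of order `l` in `η`. -/
def IsDec (s l : ℝ) (G : E n × E n → ℂ) : Prop :=
  Sym (fun (_ : Unit) q => bracket q.1 ^ s * bracket q.2 ^ l) (fun _ => G)

theorem IsDec.mono {s s' l l' : ℝ} {G : E n × E n → ℂ} (h : IsDec s l G) (hs : s ≤ s')
    (hl : l ≤ l') : IsDec s' l' G :=
  Sym.mono_le h fun _ _ => mul_le_mul (bracket_rpow_le_rpow _ hs) (bracket_rpow_le_rpow _ hl)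
    (bracket_rpow_pos _ _).le (bracket_rpow_pos _ _).le

theorem IsDec.isOsc {s l : ℝ} {G : E n × E n → ℂ} (h : IsDec s l G) (hs : s ≤ 0) :
    IsOsc |l| G :=
  Sym.mono_le h fun _ q => by
    calc bracket q.1 ^ s * bracket q.2 ^ l ≤ 1 * bracket q.2 ^ |l| :=
          mul_le_mul (Real.rpow_le_one_of_one_le_of_nonpos (one_le_bracket _) hs)
            (bracket_rpow_le_rpow _ (le_abs_self l)) (bracket_rpow_pos _ _).le zero_le_one
      _ ≤ wt q ^ |l| := by
          rw [one_mul]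
          exact Real.rpow_le_rpow (bracket_pos _).le (bracket_snd_le_wt q) (abs_nonneg l)

theorem IsDec.continuous {s l : ℝ} {G : E n × E n → ℂ} (h : IsDec s l G) : Continuous G :=
  Sym.continuous h ()

theorem IsDec.integrable_slice {l : ℝ} {G : E n × E n → ℂ} (h : IsDec (-(n + 1)) l G)
    (θ η : E n) :
    Integrable fun y => Complex.exp (Complex.I * (inner ℝ y θ : ℝ)) * G (y, η) := by
  obtain ⟨C, hC, hb⟩ := Sym.bdd h
  have := h.continuous
  refine ((integrable_bracket (n := n)).const_mul (C * bracket η ^ l)).mono'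
    (by fun_prop) (.of_forall fun y => ?_)
  rw [norm_mul, norm_cexp_I, one_mul]
  exact (hb () (y, η)).trans (le_of_eq (by ring))

theorem IsDec.integrable_innerInt {l : ℝ} {G : E n × E n → ℂ} (hG : IsDec (-(n + 1)) l G)
    {θ : E n → E n} (hθc : Continuous θ) (hθ : ∀ η, bracket (θ η) = bracket η) {h : E n → ℂ}
    (hm : AEStronglyMeasurable h) (h1 : ∀ η, ‖h η‖ ≤ 1) :
    Integrable fun η => h η * innerInt θ G η := by
  obtain ⟨C, hC, hb⟩ := innerInt_bound (ι := Unit) hθ (m := fun _ => 1) (fun _ => zero_le_one)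
    (G := fun _ => G) (l := l) (by simpa only [one_mul, IsDec] using hG)
  refine ((integrable_bracket (n := n)).const_mul C).mono'
    (hm.mul (innerInt_measurable hθc hG.continuous)) (.of_forall fun η => ?_)
  rw [norm_mul]
  calc ‖h η‖ * ‖innerInt θ G η‖ ≤ 1 * (C * (1 * bracket η ^ (-(n + 1 : ℝ)))) :=
        mul_le_mul (h1 η) (hb () η) (norm_nonneg _) zero_le_one
    _ = _ := by ring

theorem IsDec.cutoff_mul {χ : E n × E n → ℂ} (hχ : IsCutoff χ) {s l : ℝ} {G : E n × E n → ℂ}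
    (hG : IsDec s l G) {ε : ℝ} (hε : 0 < ε) : IsDec s l (fun q => χ (ε • q) * G q) :=
  ((cutoff_sym (ι := Unit) hχ continuous_const (fun _ => one_pos) hε).mul hG).mono_le
    fun _ q => by rw [one_mul]

/-- Cutting off changes an iterated integral by `O(ε)`. -/
theorem iterated_cutoff {χ : E n × E n → ℂ} (hχ : IsCutoff χ) {l : ℝ} {G : E n × E n → ℂ}
    (hG : IsDec (-(n + 2)) l G) {θ : E n → E n} (hθc : Continuous θ)
    (hθ : ∀ η, bracket (θ η) = bracket η) {h : E n → ℂ}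
    (hm : AEStronglyMeasurable h) (h1 : ∀ η, ‖h η‖ ≤ 1) :
    ∃ C : ℝ, 0 ≤ C ∧ ∀ ε : ℝ, 0 < ε → ε ≤ 1 →
      ‖(∫ η, h η * innerInt θ G η) - ∫ η, h η * innerInt θ (fun q => χ (ε • q) * G q) η‖ ≤
        C * ε := by
  have hG' : IsDec (-(n + 1)) l G := hG.mono (by linarith) le_rfl
  have hs : Sym (fun (ε : Set.Ioc (0 : ℝ) 1) (q : E n × E n) =>
      (ε : ℝ) * (bracket q.1 ^ (-(n + 1 : ℝ)) * bracket q.2 ^ (l + 1)))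
      (fun ε q => (1 - χ ((ε : ℝ) • q)) * G q) :=
    ((one_sub_cutoff_sym hχ).mul (Sym.reindex hG fun _ => ())).mono_le fun ε q => by
      have e1 : bracket q.1 ^ (-(n + 1 : ℝ)) = bracket q.1 * bracket q.1 ^ (-(n + 2 : ℝ)) := by
        rw [← Real.rpow_one_add' (bracket_pos _).le (by have : (0 : ℝ) ≤ n := n.cast_nonneg
                                                        linarith)]
        congr 1; ring
      rw [e1, Real.rpow_add_one (bracket_pos _).ne']
      have p1 := bracket_rpow_pos q.1 (-(n + 2 : ℝ))
      have p2 := bracket_rpow_pos q.2 l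
      have := mul_le_mul_of_nonneg_left (wt_le_bracket_mul q)
        (mul_nonneg ε.2.1.le (mul_pos p1 p2).le)
      linarith
  obtain ⟨C, hC, hb⟩ := innerInt_bound hθ (fun ε : Set.Ioc (0 : ℝ) 1 => ε.2.1.le) hs
  refine ⟨C * ∫ η : E n, bracket η ^ (-(n + 1 : ℝ)),
    mul_nonneg hC (integral_nonneg fun η => (bracket_rpow_pos η _).le), fun ε h0 h1' => ?_⟩
  have hcut := hG'.cutoff_mul hχ h0
  rw [← integral_sub (hG'.integrable_innerInt hθc hθ hm h1) (hcut.integrable_innerInt hθc hθ hm h1)]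
  calc _ ≤ ∫ η : E n, C * (ε * bracket η ^ (-(n + 1 : ℝ))) := by
        refine norm_integral_le_of_norm_le ((integrable_bracket.const_mul _).const_mul _)
          (.of_forall fun η => ?_)
        have e : innerInt θ G η - innerInt θ (fun q => χ (ε • q) * G q) η =
            innerInt θ (fun q => (1 - χ (ε • q)) * G q) η := by
          rw [innerInt, innerInt, innerInt, ← integral_sub (hG'.integrable_slice _ _)
            (hcut.integrable_slice _ _)]
          congr 1; ext y; ring
        rw [← mul_sub, e, norm_mul]
        calc _ ≤ 1 * (C * (ε * bracket η ^ (-(n + 1 : ℝ)))) :=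
              mul_le_mul (h1 η) (hb ⟨ε, h0, h1'⟩ η) (norm_nonneg _) zero_le_one
          _ = _ := one_mul _
    _ = _ := by
        rw [integral_const_mul, integral_const_mul]; ring

/-- For symbols that decay in `y`, the oscillatory integral is an iterated integral. -/
theorem os_eq_iterated {l : ℝ} {G : E n × E n → ℂ} (hG : IsDec (-(n + 2)) l G) :
    Os G = ((2 * Real.pi : ℂ) ^ n)⁻¹ * ∫ η, innerInt id G η := by
  obtain ⟨χ, hχ⟩ := exists_cutoff n
  have hO := hG.isOsc (by have : (0 : ℝ) ≤ n := n.cast_nonneg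
                          linarith)
  obtain ⟨C₁, hC₁, hb₁⟩ := os_cutoff hχ hO.sym_one_mul
  obtain ⟨C₂, hC₂, hb₂⟩ := iterated_cutoff hχ hG continuous_id (fun _ => rfl) (h := fun _ => 1)
    aestronglyMeasurable_const (by simp)
  refine eq_of_norm_sub_le (C := C₁ + ‖((2 * Real.pi : ℂ) ^ n)⁻¹‖ * C₂) fun ε h0 h1 => ?_
  have e1 := hb₁ ε h0 h1 ()
  have e2 := hb₂ ε h0 h1
  simp only [mul_one, one_mul] at e1 e2
  have hF : IsOsc (-(2 * n + 1)) (fun q => χ (ε • q) * G q) :=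
    ((cutoff_sym (ι := Unit) hχ (continuous_wt_rpow (-(2 * n + 1) - |l|))
      (fun q => wt_rpow_pos q _) h0).mul hO).mono_le fun _ q => by
        rw [← Real.rpow_add (wt_pos q)]; simp
  have key : Os (fun q => χ (ε • q) * G q) =
      ((2 * Real.pi : ℂ) ^ n)⁻¹ * ∫ η, innerInt id (fun q => χ (ε • q) * G q) η := by
    rw [os_eq_integral hF le_rfl]
    congr 1
    exact integral_prod_symm _ (hF.integrable_psi_mul le_rfl)
  have e3 : Os G - ((2 * Real.pi : ℂ) ^ n)⁻¹ * ∫ η, innerInt id G η =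
      (Os G - Os (fun q => χ (ε • q) * G q)) - ((2 * Real.pi : ℂ) ^ n)⁻¹ *
        ((∫ η, innerInt id G η) - ∫ η, innerInt id (fun q => χ (ε • q) * G q) η) := by
    rw [key]; ring
  rw [e3]
  refine (norm_sub_le _ _).trans ?_
  rw [norm_mul, add_mul, mul_assoc]
  exact add_le_add e1 (mul_le_mul_of_nonneg_left e2 (norm_nonneg _))

end Iterated

/-! ### Multi-index derivatives -/

section Multi
variable {n : ℕ}

/-- The multi-index derivative `∂^α` along the vectors `b j`. -/
def mD (b : Fin n → V) (α : Fin n → ℕ) (f : V → ℂ) : V → ℂ :=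
  (List.finRange n).foldr (fun j g => (D (b j))^[α j] g) f

theorem multiD_eq_mD (α : Fin n → ℕ) (f : E n → ℂ) : multiD α f = mD ej α f := rfl

theorem contDiff_D {f : V → ℂ} (hf : ContDiff ℝ ∞ f) (v : V) : ContDiff ℝ ∞ (D v f) :=
  (hf.fderiv_right (m := ∞) (by simp)).clm_apply contDiff_const

theorem contDiff_D_iterate {f : V → ℂ} (hf : ContDiff ℝ ∞ f) (v : V) (k : ℕ) :
    ContDiff ℝ ∞ ((D v)^[k] f) := by
  induction k with
  | zero => exact hf
  | succ k ih => rw [Function.iterate_succ_apply']; exact contDiff_D ih v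

theorem contDiff_foldr (l : List (Fin n)) (b : Fin n → V) (α : Fin n → ℕ) {f : V → ℂ}
    (hf : ContDiff ℝ ∞ f) : ContDiff ℝ ∞ (l.foldr (fun j g => (D (b j))^[α j] g) f) := by
  induction l with
  | nil => exact hf
  | cons i l ih => exact contDiff_D_iterate ih _ _

theorem contDiff_mD (b : Fin n → V) (α : Fin n → ℕ) {f : V → ℂ} (hf : ContDiff ℝ ∞ f) :
    ContDiff ℝ ∞ (mD b α f) := contDiff_foldr _ b α hf

theorem D_comm {f : V → ℂ} (hf : ContDiff ℝ ∞ f) (v w : V) : D v (D w f) = D w (D v f) := by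
  have hd : Differentiable ℝ (fderiv ℝ f) :=
    (hf.fderiv_right (m := ∞) (by simp)).differentiable (by simp)
  have h : ∀ v w x, D v (D w f) x = fderiv ℝ (fderiv ℝ f) x v w := by
    intro v w x
    have := ((hd x).hasFDerivAt.clm_apply (hasFDerivAt_const w x)).fderiv
    change fderiv ℝ (fun y => fderiv ℝ f y w) x v = _
    rw [this]
    simp
  ext x
  rw [h, h]
  exact (hf.contDiffAt.isSymmSndFDerivAt (by
    rw [minSmoothness_of_isRCLikeNormedField]; exact WithTop.coe_le_coe.2 le_top)) v w

theorem D_iterate_comm {f : V → ℂ} (hf : ContDiff ℝ ∞ f) (v w : V) (k : ℕ) :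
    D v ((D w)^[k] f) = (D w)^[k] (D v f) := by
  induction k with
  | zero => rfl
  | succ k ih =>
    rw [Function.iterate_succ_apply', Function.iterate_succ_apply', ← ih,
      D_comm (contDiff_D_iterate hf w k)]

theorem D_foldr_comm (l : List (Fin n)) (b : Fin n → V) (α : Fin n → ℕ) {f : V → ℂ}
    (hf : ContDiff ℝ ∞ f) (v : V) : D v (l.foldr (fun j g => (D (b j))^[α j] g) f) =
      l.foldr (fun j g => (D (b j))^[α j] g) (D v f) := by
  induction l with
  | nil => rfl
  | cons i l ih =>
    simp only [List.foldr_cons]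
    rw [D_iterate_comm (contDiff_foldr l b α hf), ih]

theorem D_mD_comm (b : Fin n → V) (α : Fin n → ℕ) {f : V → ℂ} (hf : ContDiff ℝ ∞ f) (v : V) :
    D v (mD b α f) = mD b α (D v f) := D_foldr_comm _ b α hf v

theorem D_foldr_self (l : List (Fin n)) (hl : l.Nodup) (b : Fin n → V) (α : Fin n → ℕ) {f : V → ℂ}
    (hf : ContDiff ℝ ∞ f) (j : Fin n) (hj : j ∈ l) :
    D (b j) (l.foldr (fun j g => (D (b j))^[α j] g) f) =
      l.foldr (fun i g => (D (b i))^[(α + Pi.single j 1 : Fin n → ℕ) i] g) f := by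
  induction l with
  | nil => simp at hj
  | cons i l ih =>
    simp only [List.foldr_cons]
    rw [List.nodup_cons] at hl
    by_cases h : j = i
    · subst h
      have : l.foldr (fun i g => (D (b i))^[(α + Pi.single j 1 : Fin n → ℕ) i] g) f =
          l.foldr (fun i g => (D (b i))^[α i] g) f := by
        refine List.foldr_ext _ _ _ fun i hi g => ?_
        have : i ≠ j := fun h => hl.1 (h ▸ hi)
        simp [Pi.single_eq_of_ne this]
      rw [this, Pi.add_apply, Pi.single_eq_same, Function.iterate_succ_apply']
    · rw [D_iterate_comm (contDiff_foldr l b α hf), ih hl.2 (by simpa [h] using hj)]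
      simp [Pi.single_eq_of_ne (Ne.symm h)]

theorem D_mD (b : Fin n → V) (α : Fin n → ℕ) {f : V → ℂ} (hf : ContDiff ℝ ∞ f) (j : Fin n) :
    D (b j) (mD b α f) = mD b (α + Pi.single j 1) f :=
  D_foldr_self _ (List.nodup_finRange n) b α hf j (List.mem_finRange j)

theorem mD_zero (b : Fin n → V) (f : V → ℂ) : mD b 0 f = f := by
  have : ∀ l : List (Fin n), l.foldr (fun j g => (D (b j))^[(0 : Fin n → ℕ) j] g) f = f := by
    intro l
    induction l with
    | nil => rfl
    | cons i l ih => exact ih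
  exact this _

theorem mD_mono {w : ι → V → ℝ} {f : ι → V → ℂ} (h : Sym w f) (b : Fin n → V) (α : Fin n → ℕ) :
    Sym w (fun i => mD b α (f i)) := by
  have h1 : ∀ (k : ℕ) (v : V) {f : ι → V → ℂ}, Sym w f → Sym w (fun i => (D v)^[k] (f i)) := by
    intro k v
    induction k with
    | zero => exact fun h => h
    | succ k ih =>
      intro f h
      simp only [Function.iterate_succ_apply']
      exact (ih h).D v
  have h2 : ∀ l : List (Fin n),
      Sym w (fun i => l.foldr (fun j g => (D (b j))^[α j] g) (f i)) := by
    intro l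
    induction l with
    | nil => exact h
    | cons i l ih => exact h1 _ _ ih
  exact h2 _

theorem D_comp_affine {f : V → ℂ} (hf : Differentiable ℝ f) (A : V' →L[ℝ] V) (c : V) (v : V') :
    D v (fun x => f (A x + c)) = fun x => D (A v) f (A x + c) := by
  ext x
  have h1 : HasFDerivAt (fun v => f (A v + c)) ((fderiv ℝ f (A x + c)).comp A) x :=
    (hf (A x + c)).hasFDerivAt.comp x (A.hasFDerivAt.add_const c)
  simp only [D, h1.fderiv]
  rfl

theorem mD_comp_affine {f : V → ℂ} (hf : ContDiff ℝ ∞ f) (A : V' →L[ℝ] V) (c : V)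
    (b : Fin n → V') (α : Fin n → ℕ) :
    mD b α (fun x => f (A x + c)) = fun x => mD (fun j => A (b j)) α f (A x + c) := by
  have h1 : ∀ (k : ℕ) (v : V') {f : V → ℂ}, ContDiff ℝ ∞ f →
      (D v)^[k] (fun x => f (A x + c)) = fun x => (D (A v))^[k] f (A x + c) := by
    intro k v f hf
    induction k with
    | zero => rfl
    | succ k ih =>
      simp only [Function.iterate_succ_apply', ih]
      exact D_comp_affine ((contDiff_D_iterate hf _ k).differentiable (by simp)) A c v
  have h2 : ∀ l : List (Fin n),
      l.foldr (fun j g => (D (b j))^[α j] g) (fun x => f (A x + c)) =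
        fun x => l.foldr (fun j g => (D (A (b j)))^[α j] g) f (A x + c) := by
    intro l
    induction l with
    | nil => rfl
    | cons i l ih =>
      simp only [List.foldr_cons, ih]
      exact h1 _ _ (contDiff_foldr l _ α hf)
  exact h2 _

/-- A set of smooth functions that is closed under differentiation along a basis consists of
symbols of any weight that bounds all its elements. -/
theorem sym_of_closed [FiniteDimensional ℝ V] {S I : Type*} [Fintype S] (b : Module.Basis S ℝ V)
    {w : V → ℝ} {Φ : I → V → ℂ} (hd : ∀ i, Differentiable ℝ (Φ i))
    (hb : ∀ i, BddBy (fun (_ : Unit) => w) (fun _ => Φ i))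
    (hc : ∀ i s, ∃ i', D (b s) (Φ i) = Φ i') (i : I) : Sym (fun (_ : Unit) => w) (fun _ => Φ i) := by
  intro k
  induction k generalizing i with
  | zero => exact hb i
  | succ k ih =>
    refine SymN.succ_of_basis b (hb i) (fun _ => hd i) fun s => ?_
    obtain ⟨i', hi'⟩ := hc i s
    rw [hi']
    exact ih i'

/-! ### Amplitudes and symbols as members of weighted classes -/

/-- The coordinate basis of `ℝⁿ`. -/
def stdBasis (n : ℕ) : Module.Basis (Fin n) ℝ (E n) := (EuclideanSpace.basisFun (Fin n) ℝ).toBasis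

theorem stdBasis_apply (j : Fin n) : stdBasis n j = ej j := by
  simp [stdBasis]

/-- The directions of `x` in `ℝⁿ × ℝⁿ × ℝⁿ`. -/
def dir₁ (j : Fin n) : E n × E n × E n := (ej j, 0, 0)

/-- The directions of `y` in `ℝⁿ × ℝⁿ × ℝⁿ`. -/
def dir₂ (j : Fin n) : E n × E n × E n := (0, ej j, 0)

/-- The directions of `ξ` in `ℝⁿ × ℝⁿ × ℝⁿ`. -/
def dir₃ (j : Fin n) : E n × E n × E n := (0, 0, ej j)

theorem mixedD₃_eq {a : E n → E n → E n → ℂ}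
    (ha : ContDiff ℝ ∞ (fun q : E n × E n × E n => a q.1 q.2.1 q.2.2)) (α β γ : Fin n → ℕ)
    (x y ξ : E n) : mixedD₃ α β γ a x y ξ =
      mD dir₁ α (mD dir₂ β (mD dir₃ γ (fun q : E n × E n × E n => a q.1 q.2.1 q.2.2))) (x, y, ξ) := by
  set F : E n × E n × E n → ℂ := fun q => a q.1 q.2.1 q.2.2 with hF
  have h3 : ∀ x y ξ, multiD γ (fun ξ' => a x y ξ') ξ = mD dir₃ γ F (x, y, ξ) := by
    intro x y ξ
    have := congrFun (mD_comp_affine ha ((ContinuousLinearMap.inr ℝ (E n) (E n × E n)).comp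
      (ContinuousLinearMap.inr ℝ (E n) (E n))) (x, y, 0) ej γ) ξ
    rw [show (dir₃ : Fin n → E n × E n × E n) = fun j => (0, 0, ej j) from rfl]
    simpa [hF, multiD_eq_mD] using this
  have h2 : ∀ x y ξ, multiD β (fun y' => mD dir₃ γ F (x, y', ξ)) y =
      mD dir₂ β (mD dir₃ γ F) (x, y, ξ) := by
    intro x y ξ
    have := congrFun (mD_comp_affine (contDiff_mD dir₃ γ ha)
      ((ContinuousLinearMap.inr ℝ (E n) (E n × E n)).comp
      (ContinuousLinearMap.inl ℝ (E n) (E n))) (x, 0, ξ) ej β) y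
    rw [show (dir₂ : Fin n → E n × E n × E n) = fun j => (0, ej j, 0) from rfl]
    simpa [multiD_eq_mD] using this
  have h1 : ∀ x y ξ, multiD α (fun x' => mD dir₂ β (mD dir₃ γ F) (x', y, ξ)) x =
      mD dir₁ α (mD dir₂ β (mD dir₃ γ F)) (x, y, ξ) := by
    intro x y ξ
    have := congrFun (mD_comp_affine (contDiff_mD dir₂ β (contDiff_mD dir₃ γ ha))
      (ContinuousLinearMap.inl ℝ (E n) (E n × E n)) (0, y, ξ) ej α) x
    rw [show (dir₁ : Fin n → E n × E n × E n) = fun j => (ej j, 0) from rfl]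
    simpa [multiD_eq_mD] using this
  simp only [mixedD₃, h3, h2, h1]

theorem mixedD₂_eq {p : E n → E n → ℂ} (hp : ContDiff ℝ ∞ (fun q : E n × E n => p q.1 q.2))
    (α β : Fin n → ℕ) (y η : E n) : mixedD₂ α β p y η =
      mD (fun j => dir (Sum.inl j)) α (mD (fun j => dir (Sum.inr j)) β
        (fun q : E n × E n => p q.1 q.2)) (y, η) := by
  set F : E n × E n → ℂ := fun q => p q.1 q.2 with hF
  have h2 : ∀ y η, multiD β (fun η' => p y η') η = mD (fun j => dir (Sum.inr j)) β F (y, η) := by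
    intro y η
    have := congrFun (mD_comp_affine hp (ContinuousLinearMap.inr ℝ (E n) (E n)) (y, 0) ej β) η
    simpa [hF, multiD_eq_mD, dir] using this
  have h1 : ∀ y η, multiD α (fun y' => mD (fun j => dir (Sum.inr j)) β F (y', η)) y =
      mD (fun j => dir (Sum.inl j)) α (mD (fun j => dir (Sum.inr j)) β F) (y, η) := by
    intro y η
    have := congrFun (mD_comp_affine (contDiff_mD (fun j => dir (Sum.inr j)) β hp)
      (ContinuousLinearMap.inl ℝ (E n) (E n)) (0, η) ej α) y
    simpa [multiD_eq_mD, dir] using this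
  simp only [mixedD₂, h2, h1]

/-- The weight of an amplitude. -/
def ampWt (m₁ m₂ m₃ : ℝ) (q : E n × E n × E n) : ℝ :=
  bracket q.1 ^ m₁ * bracket q.2.1 ^ m₂ * bracket q.2.2 ^ m₃

theorem ampWt_pos (m₁ m₂ m₃ : ℝ) (q : E n × E n × E n) : 0 < ampWt m₁ m₂ m₃ q :=
  mul_pos (mul_pos (bracket_rpow_pos _ _) (bracket_rpow_pos _ _)) (bracket_rpow_pos _ _)

theorem continuous_ampWt (m₁ m₂ m₃ : ℝ) : Continuous (ampWt m₁ m₂ m₃ : E n × E n × E n → ℝ) :=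
  (((continuous_bracket_rpow m₁).comp (by fun_prop)).mul
    ((continuous_bracket_rpow m₂).comp (by fun_prop))).mul
    ((continuous_bracket_rpow m₃).comp (by fun_prop))

theorem IsAmplitude.sym {m₁ m₂ m₃ : ℝ} {a : E n → E n → E n → ℂ} (ha : IsAmplitude m₁ m₂ m₃ a) :
    Sym (fun (_ : Unit) => ampWt m₁ m₂ m₃)
      (fun _ (q : E n × E n × E n) => a q.1 q.2.1 q.2.2) := by
  obtain ⟨hs, hb⟩ := ha
  have hS := fun i : (Fin n → ℕ) × (Fin n → ℕ) × (Fin n → ℕ) =>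
    contDiff_mD dir₁ i.1 (contDiff_mD dir₂ i.2.1 (contDiff_mD dir₃ i.2.2 hs))
  have := sym_of_closed (I := (Fin n → ℕ) × (Fin n → ℕ) × (Fin n → ℕ))
    ((stdBasis n).prod ((stdBasis n).prod (stdBasis n))) (w := ampWt m₁ m₂ m₃)
    (Φ := fun i => mD dir₁ i.1 (mD dir₂ i.2.1 (mD dir₃ i.2.2
      (fun q : E n × E n × E n => a q.1 q.2.1 q.2.2))))
    (fun i => (hS i).differentiable (by simp)) (fun i => ?_) (fun i s => ?_) (0, 0, 0)
  · simpa only [mD_zero] using this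
  · obtain ⟨C, hC⟩ := hb i.1 i.2.1 i.2.2
    refine ⟨|C|, abs_nonneg C, fun _ q => ?_⟩
    simp only
    have h := hC q.1 q.2.1 q.2.2
    rw [mixedD₃_eq hs, mul_assoc, mul_assoc, ← mul_assoc (bracket q.1 ^ m₁)] at h
    exact h.trans (mul_le_mul_of_nonneg_right (le_abs_self C) (ampWt_pos m₁ m₂ m₃ q).le)
  · obtain ⟨α, β, γ⟩ := i
    rcases s with j | j | j
    · refine ⟨(α + Pi.single j 1, β, γ), ?_⟩
      rw [← D_mD dir₁ α (contDiff_mD dir₂ β (contDiff_mD dir₃ γ hs))]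
      congr 1
      ext <;> simp [dir₁, stdBasis_apply]
    · refine ⟨(α, β + Pi.single j 1, γ), ?_⟩
      simp only
      rw [← D_mD dir₂ β (contDiff_mD dir₃ γ hs), ← D_mD_comm dir₁ α
        (contDiff_mD dir₂ β (contDiff_mD dir₃ γ hs))]
      congr 1
      ext <;> simp [dir₂, stdBasis_apply]
    · refine ⟨(α, β, γ + Pi.single j 1), ?_⟩
      simp only
      rw [← D_mD dir₃ γ hs, ← D_mD_comm dir₂ β (contDiff_mD dir₃ γ hs), ← D_mD_comm dir₁ α
        (contDiff_mD dir₂ β (contDiff_mD dir₃ γ hs))]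
      congr 1
      ext <;> simp [dir₃, stdBasis_apply]

theorem Sym.mixedD₃_le {m₁ m₂ m₃ : ℝ} {a : E n → E n → E n → ℂ}
    (h : Sym (fun (_ : Unit) => ampWt m₁ m₂ m₃)
      (fun _ (q : E n × E n × E n) => a q.1 q.2.1 q.2.2)) (α β γ : Fin n → ℕ) :
    ∃ C : ℝ, ∀ x y ξ : E n,
      ‖mixedD₃ α β γ a x y ξ‖ ≤ C * bracket x ^ m₁ * bracket y ^ m₂ * bracket ξ ^ m₃ := by
  obtain ⟨C, -, hb⟩ := (mD_mono (mD_mono (mD_mono h dir₃ γ) dir₂ β) dir₁ α).bdd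
  refine ⟨C, fun x y ξ => ?_⟩
  rw [mixedD₃_eq (h.contDiff ()), mul_assoc, mul_assoc, ← mul_assoc (bracket x ^ m₁)]
  exact hb () (x, y, ξ)

theorem Sym.isAmplitude {m₁ m₂ m₃ : ℝ} {a : E n → E n → E n → ℂ}
    (h : Sym (fun (_ : Unit) => ampWt m₁ m₂ m₃)
      (fun _ (q : E n × E n × E n) => a q.1 q.2.1 q.2.2)) : IsAmplitude m₁ m₂ m₃ a :=
  ⟨h.contDiff (), fun α β γ => h.mixedD₃_le α β γ⟩

/-- Each derivative in `η` lowers the order of a symbol by one. -/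
theorem IsSymbol.sym {t₁ t₂ : ℝ} {p : E n → E n → ℂ} (hp : IsSymbol t₁ t₂ p) (δ : Fin n → ℕ) :
    Sym (fun (_ : Unit) (q : E n × E n) =>
        bracket q.1 ^ t₁ * bracket q.2 ^ (t₂ - ((∑ j, δ j : ℕ) : ℝ)))
      (fun _ => mD (fun j => dir (Sum.inr j)) δ (fun q : E n × E n => p q.1 q.2)) := by
  obtain ⟨hs, hb⟩ := hp
  have hS := fun i : (Fin n → ℕ) × {β : Fin n → ℕ // ∑ j, δ j ≤ ∑ j, β j} =>
    contDiff_mD (fun j => dir (n := n) (Sum.inl j)) i.1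
      (contDiff_mD (fun j => dir (Sum.inr j)) i.2.1 hs)
  have := sym_of_closed (I := (Fin n → ℕ) × {β : Fin n → ℕ // ∑ j, δ j ≤ ∑ j, β j})
    ((stdBasis n).prod (stdBasis n)) (w := fun q : E n × E n =>
        bracket q.1 ^ t₁ * bracket q.2 ^ (t₂ - ((∑ j, δ j : ℕ) : ℝ)))
    (Φ := fun i => mD (fun j => dir (Sum.inl j)) i.1 (mD (fun j => dir (Sum.inr j)) i.2.1
      (fun q : E n × E n => p q.1 q.2)))
    (fun i => (hS i).differentiable (by simp)) (fun i => ?_) (fun i s => ?_) (0, ⟨δ, le_rfl⟩)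
  · simpa only [mD_zero] using this
  · obtain ⟨C, hC⟩ := hb i.1 i.2.1
    refine ⟨|C|, abs_nonneg C, fun _ q => ?_⟩
    have h := hC q.1 q.2
    rw [mixedD₂_eq hs, mul_assoc] at h
    have h1 := bracket_rpow_pos q.1 t₁
    refine h.trans (mul_le_mul (le_abs_self C) (mul_le_mul_of_nonneg_left
      (bracket_rpow_le_rpow _ ?_) h1.le) (mul_pos h1 (bracket_rpow_pos _ _)).le (abs_nonneg C))
    have : ((∑ j, δ j : ℕ) : ℝ) ≤ ((∑ j, i.2.1 j : ℕ) : ℝ) := by exact_mod_cast i.2.2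
    linarith
  · obtain ⟨α, β, hβ⟩ := i
    rcases s with j | j
    · refine ⟨(α + Pi.single j 1, ⟨β, hβ⟩), ?_⟩
      simp only
      rw [← D_mD _ α (contDiff_mD _ β hs)]
      congr 1
      ext <;> simp [dir, stdBasis_apply]
    · refine ⟨(α, ⟨β + Pi.single j 1, hβ.trans (Finset.sum_le_sum fun i _ => by simp)⟩), ?_⟩
      simp only
      rw [← D_mD _ β hs, ← D_mD_comm _ α (contDiff_mD _ β hs)]
      congr 1
      ext <;> simp [dir, stdBasis_apply]

/-! ### Schwartz functions -/

theorem sym_schwartz (u : SchwartzMap (E n) ℂ) (N : ℕ) :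
    Sym (fun (_ : Unit) x => bracket x ^ (-(N : ℝ))) (fun _ => ⇑u) := by
  intro k
  induction k generalizing u with
  | zero =>
    refine ⟨2 ^ N * ((Finset.Iic (N, 0)).sup fun m => SchwartzMap.seminorm ℝ m.1 m.2) u,
      mul_nonneg (by positivity) (apply_nonneg _ _), fun _ x => ?_⟩
    · have h := SchwartzMap.one_add_le_sup_seminorm_apply (𝕜 := ℝ) (m := (N, 0)) (k := N) (n := 0)
        le_rfl le_rfl u x
      rw [norm_iteratedFDeriv_zero] at h
      have h1 : bracket x ≤ 1 + ‖x‖ := Real.sqrt_le_iff.2 ⟨by positivity, by nlinarith [norm_nonneg x]⟩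
      have h2 : bracket x ^ N * ‖u x‖ ≤ _ :=
        (mul_le_mul_of_nonneg_right (pow_le_pow_left₀ (bracket_pos x).le h1 N)
          (norm_nonneg _)).trans h
      simp only
      rw [Real.rpow_neg (bracket_pos x).le, Real.rpow_natCast, ← div_eq_mul_inv,
        le_div_iff₀ (pow_pos (bracket_pos x) N), mul_comm]
      exact h2
  | succ k ih =>
    refine ⟨(ih u).bdd, fun _ => u.differentiable, fun v => ?_⟩
    have := ih (LineDeriv.lineDerivOp v u)
    convert this using 2 with i
    ext x
    rw [SchwartzMap.lineDerivOp_apply_eq_fderiv]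
    rfl

theorem Sym.norm_iteratedFDeriv_le [FiniteDimensional ℝ V] (k : ℕ) {w : V → ℝ} :
    ∀ {f : V → ℂ}, Sym (fun (_ : Unit) => w) (fun _ => f) →
      ∃ C : ℝ, 0 ≤ C ∧ ∀ x, ‖iteratedFDeriv ℝ k f x‖ ≤ C * w x := by
  induction k with
  | zero =>
    intro f hf
    obtain ⟨C, hC, hb⟩ := hf.bdd
    exact ⟨C, hC, fun x => by rw [norm_iteratedFDeriv_zero]; exact hb () x⟩
  | succ k ih =>
    intro f hf
    let b := Module.finBasis ℝ V
    let l : Fin (Module.finrank ℝ V) → V →L[ℝ] ℝ := fun s =>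
      ⟨b.coord s, LinearMap.continuous_of_finiteDimensional (b.coord s)⟩
    let A := fun s => ContinuousLinearMap.smulRightL ℝ V ℂ (l s)
    have e : fderiv ℝ f = fun x => ∑ s, A s (FIOCalc.D (b s) f x) := by
      ext x v
      have := congrFun (D_eq_sum_basis b v f) x
      simp only [FIOCalc.D] at this
      rw [this]
      simp [FIOCalc.D, l, A]
    choose C hC hb using fun s => ih (hf.D (b s))
    refine ⟨∑ s, ‖A s‖ * C s, Finset.sum_nonneg fun s _ => mul_nonneg (norm_nonneg (A s)) (hC s),
      fun x => ?_⟩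
    have hcd : ∀ s, ContDiff ℝ k (FIOCalc.D (b s) f) := fun s => (hf.D (b s)).contDiff_nat k ()
    rw [← norm_iteratedFDeriv_fderiv, e,
      iteratedFDeriv_fun_sum_apply (f := fun s x => A s (FIOCalc.D (b s) f x)) fun s _ =>
      ((A s).contDiff.comp (hcd s)).contDiffAt, Finset.sum_mul]
    refine (norm_sum_le _ _).trans (Finset.sum_le_sum fun s _ => ?_)
    have := (A s).iteratedFDeriv_comp_left (f := FIOCalc.D (b s) f) (x := x) (hcd s).contDiffAt
      (i := k) le_rfl
    have e2 : (fun x => A s (FIOCalc.D (b s) f x)) = A s ∘ FIOCalc.D (b s) f := rfl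
    rw [e2, this, mul_assoc]
    exact ((A s).norm_compContinuousMultilinearMap_le _).trans
      (mul_le_mul_of_nonneg_left (hb s x) (norm_nonneg _))

/-- A function in all the symbol classes of negative order is a Schwartz function. -/
def schwartzOfSym {f : E n → ℂ}
    (h : ∀ N : ℕ, Sym (fun (_ : Unit) x => bracket x ^ (-(N : ℝ))) (fun _ => f)) :
    SchwartzMap (E n) ℂ where
  toFun := f
  smooth' := (h 0).contDiff ()
  decay' k m := by
    obtain ⟨C, hC, hb⟩ := (h k).norm_iteratedFDeriv_le m
    refine ⟨C, fun x => ?_⟩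
    have h1 := hb x
    rw [Real.rpow_neg (bracket_pos x).le, Real.rpow_natCast, ← div_eq_mul_inv,
      le_div_iff₀ (pow_pos (bracket_pos x) k), mul_comm] at h1
    exact (mul_le_mul_of_nonneg_right (pow_le_pow_left₀ (norm_nonneg x) (norm_le_bracket x) k)
      (norm_nonneg _)).trans h1

end Multi

/-! ### Fourier integral operators on Schwartz functions -/

section FourierIntegral
variable {n : ℕ}

theorem exists_bracket_order (m s : ℝ) : ∃ N : ℕ, ∀ x : E n,
    bracket x ^ m * bracket x ^ (-(N : ℝ)) ≤ bracket x ^ s := by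
  obtain ⟨N, hN⟩ := exists_nat_ge (m - s)
  refine ⟨N, fun x => ?_⟩
  rw [← Real.rpow_add (bracket_pos x)]
  exact bracket_rpow_le_rpow x (by linarith)

theorem isDec_amplitude_mul {m₁ m₂ m₃ : ℝ} {a : E n → E n → E n → ℂ}
    (ha : IsAmplitude m₁ m₂ m₃ a) (u : SchwartzMap (E n) ℂ) (x : E n) (s : ℝ) :
    IsDec s m₃ (fun q => a x q.1 q.2 * u q.1) := by
  obtain ⟨N, hN⟩ := exists_bracket_order (n := n) m₂ s
  have h1 := ha.sym.comp_affine (ι' := Unit) id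
    (ContinuousLinearMap.inr ℝ (E n) (E n × E n)) (fun _ => (x, 0))
  have h2 := (sym_schwartz u N).comp_affine (ι' := Unit) id
    (ContinuousLinearMap.fst ℝ (E n) (E n)) (fun _ => 0)
  simp only [ContinuousLinearMap.inr_apply, Prod.mk_add_mk, add_zero, zero_add,
    ContinuousLinearMap.coe_fst'] at h1 h2
  refine (h1.mul h2).mono (bracket x ^ m₁) (bracket_rpow_pos x m₁).le fun _ q => ?_
  have := hN q.1
  have p1 := bracket_rpow_pos x m₁
  have p3 := bracket_rpow_pos q.2 m₃
  simp only [ampWt]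
  calc _ = bracket x ^ m₁ * ((bracket q.1 ^ m₂ * bracket q.1 ^ (-(N : ℝ))) * bracket q.2 ^ m₃) := by
        ring
    _ ≤ _ := by gcongr

/-- The operator `(2π)^{-n} ∫ e^{iφ(x,ξ)} (∫ e^{-i y·ξ} a(x, y, ξ) u(y) dy) dξ`, in which both
integrals converge absolutely. -/
def fioOp (φ : E n → E n → ℝ) (a : E n → E n → E n → ℂ) (u : E n → ℂ) (x : E n) : ℂ :=
  ((2 * Real.pi : ℂ) ^ n)⁻¹ * ∫ ξ, Complex.exp (Complex.I * (φ x ξ : ℝ)) *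
    innerInt (fun ξ => -ξ) (fun q => a x q.1 q.2 * u q.1) ξ

theorem phase_measurable {φ : E n → ℝ} (hφ : AEMeasurable φ) :
    AEStronglyMeasurable (fun ξ => Complex.exp (Complex.I * (φ ξ : ℝ))) :=
  (Complex.measurable_exp.comp_aemeasurable
    ((Complex.measurable_ofReal.comp_aemeasurable hφ).const_mul _)).aestronglyMeasurable

/-- The regularised operators converge to `fioOp φ a`, at rate `ε`, for every cut-off. -/
theorem isFIO_fioOp {m₁ m₂ m₃ : ℝ} {a : E n → E n → E n → ℂ} (ha : IsAmplitude m₁ m₂ m₃ a)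
    {φ : E n → E n → ℝ} (hφ : ∀ x, AEMeasurable (φ x) (volume : Measure (E n))) :
    IsFIO φ a (fun u => fioOp φ a u) := by
  intro χ hχ u x
  obtain ⟨C, hC, hb⟩ := iterated_cutoff hχ (isDec_amplitude_mul ha u x (-(n + 2)))
    (θ := fun ξ => -ξ) continuous_neg bracket_neg (phase_measurable (hφ x))
    (fun ξ => (norm_cexp_I _).le)
  have hreg : ∀ ε : ℝ, regularizedFIO φ a χ ε u x = ((2 * Real.pi : ℂ) ^ n)⁻¹ *
      ∫ ξ, Complex.exp (Complex.I * (φ x ξ : ℝ)) *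
        innerInt (fun ξ => -ξ) (fun q => χ (ε • q) * (a x q.1 q.2 * u q.1)) ξ := by
    intro ε
    rw [regularizedFIO]
    congr 2
    ext ξ
    rw [innerInt, ← integral_const_mul]
    congr 1
    ext y
    rw [inner_neg_right, Complex.ofReal_sub, mul_sub, sub_eq_add_neg, Complex.exp_add,
      Complex.ofReal_neg, mul_neg, Prod.smul_mk]
    ring
  rw [tendsto_iff_norm_sub_tendsto_zero]
  have hlim : Tendsto (fun ε : ℝ => ‖((2 * Real.pi : ℂ) ^ n)⁻¹‖ * (C * ε)) (𝓝[>] 0) (𝓝 0) := by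
    have : Tendsto (fun ε : ℝ => ‖((2 * Real.pi : ℂ) ^ n)⁻¹‖ * (C * ε)) (𝓝 0)
        (𝓝 (‖((2 * Real.pi : ℂ) ^ n)⁻¹‖ * (C * 0))) := by
      exact (continuous_const.mul (continuous_const.mul continuous_id)).tendsto 0
    rw [mul_zero, mul_zero] at this
    exact this.mono_left nhdsWithin_le_nhds
  refine squeeze_zero' (.of_forall fun _ => norm_nonneg _) ?_ hlim
  filter_upwards [Ioc_mem_nhdsGT (zero_lt_one (α := ℝ))] with ε hε
  rw [hreg, fioOp, ← mul_sub, norm_mul, norm_sub_rev]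
  exact mul_le_mul_of_nonneg_left (hb ε hε.1 hε.2) (norm_nonneg _)

theorem fioOp_add {m₁ m₂ m₃ : ℝ} {a : E n → E n → E n → ℂ} (ha : IsAmplitude m₁ m₂ m₃ a)
    {φ : E n → E n → ℝ} (hφ : ∀ x, AEMeasurable (φ x) (volume : Measure (E n)))
    (u v : SchwartzMap (E n) ℂ) (x : E n) :
    fioOp φ a (u + v : SchwartzMap (E n) ℂ) x = fioOp φ a u x + fioOp φ a v x := by
  have hu := isDec_amplitude_mul ha u x (-(n + 1))
  have hv := isDec_amplitude_mul ha v x (-(n + 1))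
  have iu := hu.integrable_innerInt (θ := fun ξ => -ξ) continuous_neg bracket_neg
    (phase_measurable (hφ x)) (fun ξ => (norm_cexp_I _).le)
  have iv := hv.integrable_innerInt (θ := fun ξ => -ξ) continuous_neg bracket_neg
    (phase_measurable (hφ x)) (fun ξ => (norm_cexp_I _).le)
  rw [fioOp, fioOp, fioOp, ← mul_add, ← integral_add iu iv]
  congr 2
  ext ξ
  rw [← mul_add]
  congr 1
  rw [innerInt, innerInt, innerInt, ← integral_add (hu.integrable_slice _ _)
    (hv.integrable_slice _ _)]
  congr 1
  ext y
  simp only [_root_.add_apply]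
  ring

theorem fioOp_smul (φ : E n → E n → ℝ) (a : E n → E n → E n → ℂ) (c : ℂ)
    (u : SchwartzMap (E n) ℂ) (x : E n) :
    fioOp φ a (c • u : SchwartzMap (E n) ℂ) x = c * fioOp φ a u x := by
  rw [fioOp, fioOp, mul_left_comm, ← integral_const_mul c]
  congr 2
  ext ξ
  rw [mul_left_comm]
  congr 1
  rw [innerInt, innerInt, ← integral_const_mul]
  congr 1
  ext y
  simp only [_root_.smul_apply, smul_eq_mul]
  ring

/-- The operator `fioOp φ a` on Schwartz functions, as a linear map. -/
def fioLin {m₁ m₂ m₃ : ℝ} {a : E n → E n → E n → ℂ} (ha : IsAmplitude m₁ m₂ m₃ a)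
    {φ : E n → E n → ℝ} (hφ : ∀ x, AEMeasurable (φ x) (volume : Measure (E n))) :
    SchwartzMap (E n) ℂ →ₗ[ℂ] (E n → ℂ) where
  toFun u := fioOp φ a u
  map_add' u v := funext fun x => fioOp_add ha hφ u v x
  map_smul' c u := funext fun x => fioOp_smul φ a c u x

/-! ### Pseudodifferential operators -/

theorem sym_exp_inner (ξ : E n) : Sym (fun (_ : ι) (_ : E n) => (1 : ℝ))
    (fun _ y => Complex.exp (Complex.I * (inner ℝ y ξ : ℝ))) := by
  have hb : BddBy (fun (_ : ι) (_ : E n) => (1 : ℝ))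
      (fun _ y => Complex.exp (Complex.I * (inner ℝ y ξ : ℝ))) :=
    ⟨1, zero_le_one, fun _ y => by rw [norm_cexp_I, one_mul]⟩
  have hd : ∀ y, HasFDerivAt (fun y => Complex.exp (Complex.I * (inner ℝ y ξ : ℝ)))
      ((Complex.I * Complex.exp (Complex.I * (inner ℝ y ξ : ℝ))) •
        (Complex.ofRealCLM.comp (innerSL ℝ ξ))) y := fun y => by
    refine hasFDerivAt_cexp_I _ _ y ?_
    have h : (fun y : E n => (inner ℝ y ξ : ℝ)) = fun y => innerSL ℝ ξ y :=
      funext fun y => real_inner_comm ξ y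
    rw [h]
    exact (innerSL ℝ ξ).hasFDerivAt
  intro k
  induction k with
  | zero => exact hb
  | succ k ih =>
    refine ⟨hb, fun _ y => (hd y).differentiableAt, fun v => ?_⟩
    have := ih.const_mul (fun _ => Complex.I * (inner ℝ ξ v : ℝ)) (norm_nonneg _)
      (fun _ => le_rfl)
    convert this using 2 with i
    ext y
    rw [FIOCalc.D, (hd y).fderiv]
    simp
    ring

theorem IsSymbol.sym_zero {t₁ t₂ : ℝ} {p : E n → E n → ℂ} (hp : IsSymbol t₁ t₂ p) :
    Sym (fun (_ : Unit) (q : E n × E n) => bracket q.1 ^ t₁ * bracket q.2 ^ t₂)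
      (fun _ q => p q.1 q.2) := by
  have := hp.sym 0
  simpa only [mD_zero, Pi.zero_apply, Finset.sum_const_zero, Nat.cast_zero, sub_zero] using this

theorem IsSymbol.isAmplitude {t₁ t₂ : ℝ} {p : E n → E n → ℂ} (hp : IsSymbol t₁ t₂ p) :
    IsAmplitude t₁ 0 t₂ (fun x _ ξ => p x ξ) := by
  refine Sym.isAmplitude ?_
  have := hp.sym_zero.comp_affine (ι' := Unit) id
    ((ContinuousLinearMap.fst ℝ (E n) (E n × E n)).prod ((ContinuousLinearMap.snd ℝ (E n) (E n)).comp
      (ContinuousLinearMap.snd ℝ (E n) (E n × E n)))) (fun _ => 0)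
  simp only [add_zero] at this
  exact this.mono_le fun _ q => by simp [ampWt]

/-- The amplitude `u(x - y) e^{i y·ξ} p(x, ξ + η)`, whose oscillatory integral in `(y, η)` is
`p(x, D)u(x)`, whatever `ξ` is. -/
def pdoAmp (p : E n → E n → ℂ) (u : E n → ℂ) (ξ x : E n) (q : E n × E n) : ℂ :=
  u (x - q.1) * Complex.exp (Complex.I * (inner ℝ q.1 ξ : ℝ)) * p x (ξ + q.2)

theorem sym_pdoAmp {t₁ t₂ : ℝ} {p : E n → E n → ℂ} (hp : IsSymbol t₁ t₂ p)
    (u : SchwartzMap (E n) ℂ) (ξ : E n) (M : ℕ) :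
    Sym (fun (_ : Unit) (v : E n × (E n × E n)) => bracket (v.1 - v.2.1) ^ (-(M : ℝ)) *
        (bracket v.1 ^ t₁ * bracket (ξ + v.2.2) ^ t₂)) (fun _ v => pdoAmp p u ξ v.1 v.2) := by
  have h1 := (sym_schwartz u M).comp_affine (ι' := Unit) id
    (ContinuousLinearMap.fst ℝ (E n) (E n × E n) - (ContinuousLinearMap.fst ℝ (E n) (E n)).comp
      (ContinuousLinearMap.snd ℝ (E n) (E n × E n))) (fun _ => 0)
  have h2 := (sym_exp_inner (ι := Unit) ξ).comp_affine (ι' := Unit) id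
    ((ContinuousLinearMap.fst ℝ (E n) (E n)).comp
      (ContinuousLinearMap.snd ℝ (E n) (E n × E n))) (fun _ => 0)
  have h3 := hp.sym_zero.comp_affine (ι' := Unit) id
    ((ContinuousLinearMap.fst ℝ (E n) (E n × E n)).prod ((ContinuousLinearMap.snd ℝ (E n) (E n)).comp
      (ContinuousLinearMap.snd ℝ (E n) (E n × E n)))) (fun _ => (0, ξ))
  simp only [add_zero] at h1 h2
  refine (((h1.mul h2).mul h3).mono_le fun _ v => ?_).congr fun _ v => ?_
  · simp [add_comm v.2.2 ξ]
  · simp [pdoAmp, add_comm v.2.2 ξ]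

/-- The amplitude of `p(x, D)u(x)` decays rapidly in `x`. -/
theorem sym_pdoAmp_decay {t₁ t₂ : ℝ} {p : E n → E n → ℂ} (hp : IsSymbol t₁ t₂ p)
    (u : SchwartzMap (E n) ℂ) (ξ : E n) (s : ℝ) : ∃ K : ℝ,
    Sym (fun (_ : Unit) (v : E n × (E n × E n)) => bracket v.1 ^ s * wt v.2 ^ K)
      (fun _ v => pdoAmp p u ξ v.1 v.2) := by
  obtain ⟨M, hM⟩ := exists_bracket_order (n := n) t₁ s
  refine ⟨M + |t₂|, (sym_pdoAmp hp u ξ M).mono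
    (2 ^ (M : ℝ) * (2 ^ |t₂| * bracket ξ ^ t₂)) (by have := bracket_rpow_pos ξ t₂; positivity)
    fun _ v => ?_⟩
  have h1 := bracket_add_rpow_le v.1 (-v.2.1) (-(M : ℝ))
  rw [← sub_eq_add_neg, bracket_neg, abs_neg, abs_of_nonneg (Nat.cast_nonneg M)] at h1
  have h2 := bracket_add_rpow_le ξ v.2.2 t₂
  have h3 : bracket v.2.1 ^ (M : ℝ) ≤ wt v.2 ^ (M : ℝ) :=
    Real.rpow_le_rpow (bracket_pos _).le (bracket_fst_le_wt _) (Nat.cast_nonneg M)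
  have h4 : bracket v.2.2 ^ |t₂| ≤ wt v.2 ^ |t₂| :=
    Real.rpow_le_rpow (bracket_pos _).le (bracket_snd_le_wt _) (abs_nonneg _)
  have h5 := hM v.1
  have p1 := bracket_rpow_pos v.1 t₁
  have p2 := bracket_rpow_pos ξ t₂
  have p3 := bracket_rpow_pos v.1 (-(M : ℝ))
  have p4 := bracket_rpow_pos (ξ + v.2.2) t₂
  have p5 := wt_rpow_pos v.2 (M : ℝ)
  have p6 := wt_rpow_pos v.2 |t₂|
  have p7 := bracket_rpow_pos v.2.2 |t₂|
  rw [Real.rpow_add (wt_pos v.2)]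
  calc _ ≤ (2 ^ (M : ℝ) * (bracket v.1 ^ (-(M : ℝ)) * wt v.2 ^ (M : ℝ))) *
        (bracket v.1 ^ t₁ * (2 ^ |t₂| * (bracket ξ ^ t₂ * wt v.2 ^ |t₂|))) := by
        refine mul_le_mul (h1.trans (by gcongr)) (mul_le_mul_of_nonneg_left (h2.trans (by gcongr)) p1.le)
          (mul_pos p1 p4).le (by positivity)
    _ = 2 ^ (M : ℝ) * (2 ^ |t₂| * bracket ξ ^ t₂) * ((bracket v.1 ^ t₁ * bracket v.1 ^ (-(M : ℝ))) *
        (wt v.2 ^ (M : ℝ) * wt v.2 ^ |t₂|)) := by ring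
    _ ≤ _ := by gcongr

theorem isDec_pdoAmp {t₁ t₂ : ℝ} {p : E n → E n → ℂ} (hp : IsSymbol t₁ t₂ p)
    (u : SchwartzMap (E n) ℂ) (ξ x : E n) : IsDec (-(n + 2)) t₂ (pdoAmp p u ξ x) := by
  have h := (sym_pdoAmp hp u ξ (n + 2)).comp_affine (ι' := Unit) id
    (ContinuousLinearMap.inr ℝ (E n) (E n × E n)) (fun _ => (x, 0))
  simp only [ContinuousLinearMap.inr_apply, Prod.mk_add_mk, add_zero, zero_add] at h
  refine h.mono (2 ^ |(-(n + 2) : ℝ)| * bracket x ^ |(-(n + 2) : ℝ)| *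
    (bracket x ^ t₁ * (2 ^ |t₂| * bracket ξ ^ |t₂|))) ?_ fun _ q => ?_
  · have := bracket_pos x
    have := bracket_pos ξ
    positivity
  have h1 := bracket_add_rpow_le (-q.1) x (-(n + 2))
  rw [bracket_neg, add_comm, ← sub_eq_add_neg] at h1
  have h2 := bracket_add_rpow_le q.2 ξ t₂
  rw [add_comm] at h2
  have p1 := bracket_rpow_pos x t₁
  push_cast
  refine (mul_le_mul h1 (mul_le_mul_of_nonneg_left h2 p1.le)
    (mul_pos p1 (bracket_rpow_pos _ _)).le ?_).trans (le_of_eq (by ring))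
  have := bracket_pos x
  have := bracket_pos q.1
  positivity

/-- `p(x, D)u(x)` as an oscillatory integral, by the substitutions `y ↦ x - y` and `η ↦ ξ + η`. -/
theorem fioOp_pdo_eq_os {t₁ t₂ : ℝ} {p : E n → E n → ℂ} (hp : IsSymbol t₁ t₂ p)
    (u : SchwartzMap (E n) ℂ) (ξ x : E n) :
    fioOp (fun x ξ => inner ℝ x ξ) (fun x _ ξ => p x ξ) u x = Os (pdoAmp p u ξ x) := by
  rw [os_eq_iterated (isDec_pdoAmp hp u ξ x), fioOp]
  congr 1
  set Φ : E n → ℂ := fun η => ∫ y, Complex.exp (Complex.I * (inner ℝ (x - y) η : ℝ)) * p x η * u y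
    with hΦ
  have e1 : ∀ η, innerInt id (pdoAmp p u ξ x) η = Φ (ξ + η) := by
    intro η
    rw [innerInt, hΦ, ← integral_sub_left_eq_self _ volume x]
    congr 1
    ext y
    simp only [pdoAmp, id, sub_sub_cancel]
    rw [inner_add_right, Complex.ofReal_add, mul_add, Complex.exp_add]
    ring
  simp only [e1]
  rw [integral_add_left_eq_self Φ ξ]
  congr 1
  ext η
  rw [innerInt, hΦ, ← integral_const_mul]
  congr 1
  ext y
  rw [inner_sub_left, inner_neg_right, Complex.ofReal_sub, mul_sub, sub_eq_add_neg,
    Complex.exp_add, Complex.ofReal_neg, mul_neg]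
  ring

theorem inner_aemeasurable (x : E n) :
    AEMeasurable (fun ξ => (inner ℝ x ξ : ℝ)) (volume : Measure (E n)) :=
  (by fun_prop : Continuous fun ξ : E n => (inner ℝ x ξ : ℝ)).measurable.aemeasurable

theorem sym_pdo {t₁ t₂ : ℝ} {p : E n → E n → ℂ} (hp : IsSymbol t₁ t₂ p)
    (u : SchwartzMap (E n) ℂ) (N : ℕ) : Sym (fun (_ : Unit) x => bracket x ^ (-(N : ℝ)))
      (fun _ => fioOp (fun x ξ => inner ℝ x ξ) (fun x _ ξ => p x ξ) u) := by
  obtain ⟨K, hK⟩ := sym_pdoAmp_decay hp u 0 (-(N : ℝ))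
  refine (Sym.os (continuous_bracket_rpow _) (K := K)
    (G := fun v => pdoAmp p u 0 v.1 v.2) hK).congr fun _ x => ?_
  exact fioOp_pdo_eq_os hp u 0 x

/-- The operator `p(x, D)` on the Schwartz space. -/
def pdo {t₁ t₂ : ℝ} {p : E n → E n → ℂ} (hp : IsSymbol t₁ t₂ p) :
    SchwartzMap (E n) ℂ →ₗ[ℂ] SchwartzMap (E n) ℂ where
  toFun u := schwartzOfSym (sym_pdo hp u)
  map_add' u v := by
    ext x
    have h := fioOp_add (φ := fun x ξ => inner ℝ x ξ) hp.isAmplitude inner_aemeasurable u v x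
    rw [_root_.add_apply]
    exact h
  map_smul' c u := by
    ext x
    have h := fioOp_smul (fun x ξ => inner ℝ x ξ) (fun x _ ξ => p x ξ) c u x
    rw [_root_.smul_apply]
    exact h

theorem pdo_apply_eq_os {t₁ t₂ : ℝ} {p : E n → E n → ℂ} (hp : IsSymbol t₁ t₂ p)
    (u : SchwartzMap (E n) ℂ) (ξ x : E n) : pdo hp u x = Os (pdoAmp p u ξ x) :=
  fioOp_pdo_eq_os hp u ξ x

theorem isPDO_pdo {t₁ t₂ : ℝ} {p : E n → E n → ℂ} (hp : IsSymbol t₁ t₂ p) :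
    IsPDO p (fun u => ⇑(pdo hp u)) :=
  isFIO_fioOp hp.isAmplitude inner_aemeasurable

end FourierIntegral

/-! ### The amplitude of the composition -/

section Composition
variable {n : ℕ}

/-- Products `a(x, z + y, ξ) r(z + y, ξ, η)` as symbols in all the variables. -/
theorem sym_amp_mul {m₁ m₂ m₃ t₁ τ l : ℝ} (hl : 0 ≤ l) {A R : E n × E n × E n → ℂ}
    (hA : Sym (fun (_ : Unit) => ampWt m₁ m₂ m₃) (fun _ => A))
    (hR : Sym (fun (_ : Unit) => ampWt t₁ τ l) (fun _ => R)) :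
    Sym (fun (_ : Unit) (v : (E n × E n × E n) × (E n × E n)) =>
        ampWt m₁ (m₂ + t₁) (m₃ + τ) v.1 * wt v.2 ^ (|m₂ + t₁| + l))
      (fun _ v => A (v.1.1, v.1.2.1 + v.2.1, v.1.2.2) * R (v.1.2.1 + v.2.1, v.1.2.2, v.2.2)) := by
  let V := E n × E n × E n
  let W := E n × E n
  let px : V × W →L[ℝ] E n := (ContinuousLinearMap.fst ℝ _ _).comp (ContinuousLinearMap.fst ℝ V W)
  let pz : V × W →L[ℝ] E n := (ContinuousLinearMap.fst ℝ _ _).comp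
    ((ContinuousLinearMap.snd ℝ _ _).comp (ContinuousLinearMap.fst ℝ V W))
  let pξ : V × W →L[ℝ] E n := (ContinuousLinearMap.snd ℝ _ _).comp
    ((ContinuousLinearMap.snd ℝ _ _).comp (ContinuousLinearMap.fst ℝ V W))
  let py : V × W →L[ℝ] E n := (ContinuousLinearMap.fst ℝ _ _).comp (ContinuousLinearMap.snd ℝ V W)
  let pη : V × W →L[ℝ] E n := (ContinuousLinearMap.snd ℝ _ _).comp (ContinuousLinearMap.snd ℝ V W)
  have h1 := hA.comp_affine (ι' := Unit) id (px.prod ((pz + py).prod pξ)) (fun _ => 0)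
  have h2 := hR.comp_affine (ι' := Unit) id ((pz + py).prod (pξ.prod pη)) (fun _ => 0)
  simp only [add_zero] at h1 h2
  refine (h1.mul h2).mono (2 ^ |m₂ + t₁|) (by positivity) fun _ v => ?_
  obtain ⟨⟨x, z, ξ⟩, y, η⟩ := v
  change bracket x ^ m₁ * bracket (z + y) ^ m₂ * bracket ξ ^ m₃ *
    (bracket (z + y) ^ t₁ * bracket ξ ^ τ * bracket η ^ l) ≤ 2 ^ |m₂ + t₁| *
    (bracket x ^ m₁ * bracket z ^ (m₂ + t₁) * bracket ξ ^ (m₃ + τ) * wt (y, η) ^ (|m₂ + t₁| + l))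
  have e1 := bracket_add_rpow_le z y (m₂ + t₁)
  have e2 : bracket y ^ |m₂ + t₁| ≤ wt (y, η) ^ |m₂ + t₁| :=
    Real.rpow_le_rpow (bracket_pos _).le (bracket_fst_le_wt (y, η)) (abs_nonneg _)
  have e3 : bracket η ^ l ≤ wt (y, η) ^ l :=
    Real.rpow_le_rpow (bracket_pos _).le (bracket_snd_le_wt (y, η)) hl
  have p1 := bracket_rpow_pos x m₁
  have p2 := bracket_rpow_pos ξ (m₃ + τ)
  have p3 := bracket_rpow_pos z (m₂ + t₁)
  have p4 := bracket_rpow_pos η l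
  have p5 := wt_rpow_pos (y, η) |m₂ + t₁|
  rw [Real.rpow_add (wt_pos _)]
  calc _ = bracket x ^ m₁ * bracket ξ ^ (m₃ + τ) * bracket (z + y) ^ (m₂ + t₁) * bracket η ^ l := by
        rw [Real.rpow_add (bracket_pos ξ), Real.rpow_add (bracket_pos (z + y))]; ring
    _ ≤ bracket x ^ m₁ * bracket ξ ^ (m₃ + τ) *
        (2 ^ |m₂ + t₁| * (bracket z ^ (m₂ + t₁) * wt (y, η) ^ |m₂ + t₁|)) * wt (y, η) ^ l := by
        refine mul_le_mul (mul_le_mul_of_nonneg_left (e1.trans ?_) (by positivity)) e3 p4.le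
          (by positivity)
        gcongr
    _ = _ := by ring

/-- The amplitude `c(x, z, ξ) = (2π)^{-n} ∫∫ e^{i y·η} a(x, z + y, ξ) p(z + y, ξ + η) dy dη` of the
composition. -/
def compAmp (a : E n → E n → E n → ℂ) (p : E n → E n → ℂ) (x z ξ : E n) : ℂ :=
  Os fun q => a x (z + q.1) ξ * p (z + q.1) (ξ + q.2)

/-- The translates `p(y, ξ + η)`, with the growth in `η` separated. -/
theorem sym_translate {t₁ t₂ : ℝ} {P : E n × E n → ℂ}
    (hP : Sym (fun (_ : Unit) (q : E n × E n) => bracket q.1 ^ t₁ * bracket q.2 ^ t₂) (fun _ => P)) :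
    Sym (fun (_ : Set.Icc (0 : ℝ) 1) => ampWt t₁ t₂ |t₂|)
      (fun t (q : E n × E n × E n) => P (q.1, q.2.1 + (t : ℝ) • q.2.2)) := by
  let p₂ : E n × E n × E n →L[ℝ] E n :=
    (ContinuousLinearMap.fst ℝ _ _).comp (ContinuousLinearMap.snd ℝ (E n) (E n × E n))
  let p₃ : E n × E n × E n →L[ℝ] E n :=
    (ContinuousLinearMap.snd ℝ _ _).comp (ContinuousLinearMap.snd ℝ (E n) (E n × E n))
  have h := hP.comp (ι' := Set.Icc (0 : ℝ) 1) (fun _ => ())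
    (fun t => (ContinuousLinearMap.fst ℝ (E n) (E n × E n)).prod (p₂ + (t : ℝ) • p₃))
    (fun _ => 0) (B := 2) (fun t => by
      refine ContinuousLinearMap.opNorm_le_bound _ (by norm_num) fun q => ?_
      obtain ⟨y, ξ, η⟩ := q
      refine max_le ?_ ?_
      · exact (norm_fst_le (y, ξ, η)).trans (by linarith [norm_nonneg (y, ξ, η)])
      · change ‖ξ + (t : ℝ) • η‖ ≤ _
        have h1 : ‖ξ‖ ≤ ‖(y, ξ, η)‖ := (norm_fst_le (ξ, η)).trans (norm_snd_le (y, ξ, η))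
        have h2 : ‖η‖ ≤ ‖(y, ξ, η)‖ := (norm_snd_le (ξ, η)).trans (norm_snd_le (y, ξ, η))
        have h3 : ‖(t : ℝ) • η‖ ≤ ‖η‖ := by
          rw [norm_smul, Real.norm_of_nonneg t.2.1]
          exact mul_le_of_le_one_left (norm_nonneg _) t.2.2
        linarith [norm_add_le ξ ((t : ℝ) • η)])
  simp only [add_zero] at h
  refine h.mono (2 ^ |t₂|) (by positivity) fun t q => ?_
  obtain ⟨y, ξ, η⟩ := q
  change bracket y ^ t₁ * bracket (ξ + (t : ℝ) • η) ^ t₂ ≤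
    2 ^ |t₂| * (bracket y ^ t₁ * bracket ξ ^ t₂ * bracket η ^ |t₂|)
  have e1 := bracket_add_rpow_le ξ ((t : ℝ) • η) t₂
  have e2 : bracket ((t : ℝ) • η) ≤ bracket η := by
    refine Real.sqrt_le_sqrt ?_
    rw [norm_smul, Real.norm_of_nonneg t.2.1]
    have : (t : ℝ) * ‖η‖ ≤ ‖η‖ := mul_le_of_le_one_left (norm_nonneg _) t.2.2
    have : ((t : ℝ) * ‖η‖) ^ 2 ≤ ‖η‖ ^ 2 := pow_le_pow_left₀ (mul_nonneg t.2.1 (norm_nonneg _)) this 2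
    linarith
  have e3 : bracket ((t : ℝ) • η) ^ |t₂| ≤ bracket η ^ |t₂| :=
    Real.rpow_le_rpow (bracket_pos _).le e2 (abs_nonneg _)
  have p1 := bracket_rpow_pos y t₁
  have p2 := bracket_rpow_pos ξ t₂
  calc _ ≤ bracket y ^ t₁ * (2 ^ |t₂| * (bracket ξ ^ t₂ * bracket η ^ |t₂|)) := by
        refine mul_le_mul_of_nonneg_left (e1.trans ?_) p1.le
        gcongr
    _ = _ := by ring

theorem sym_compAmp_integrand {m₁ m₂ m₃ t₁ t₂ : ℝ} {a : E n → E n → E n → ℂ}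
    (ha : IsAmplitude m₁ m₂ m₃ a) {p : E n → E n → ℂ} (hp : IsSymbol t₁ t₂ p) :
    Sym (fun (_ : Unit) (v : (E n × E n × E n) × (E n × E n)) =>
        ampWt m₁ (m₂ + t₁) (m₃ + t₂) v.1 * wt v.2 ^ (|m₂ + t₁| + |t₂|))
      (fun _ v => a v.1.1 (v.1.2.1 + v.2.1) v.1.2.2 * p (v.1.2.1 + v.2.1) (v.1.2.2 + v.2.2)) := by
  have h := (sym_translate hp.sym_zero).reindex (ι' := Unit) fun _ => ⟨1, by simp⟩
  simp only [one_smul] at h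
  exact sym_amp_mul (abs_nonneg _) ha.sym h

theorem sym_compAmp {m₁ m₂ m₃ t₁ t₂ : ℝ} {a : E n → E n → E n → ℂ}
    (ha : IsAmplitude m₁ m₂ m₃ a) {p : E n → E n → ℂ} (hp : IsSymbol t₁ t₂ p) :
    Sym (fun (_ : Unit) => ampWt m₁ (m₂ + t₁) (m₃ + t₂))
      (fun _ (q : E n × E n × E n) => compAmp a p q.1 q.2.1 q.2.2) :=
  (Sym.os (continuous_ampWt m₁ (m₂ + t₁) (m₃ + t₂)) (K := |m₂ + t₁| + |t₂|)
    (G := fun v : (E n × E n × E n) × (E n × E n) =>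
      a v.1.1 (v.1.2.1 + v.2.1) v.1.2.2 * p (v.1.2.1 + v.2.1) (v.1.2.2 + v.2.2))
    (sym_compAmp_integrand ha hp)).congr fun _ _ => rfl

theorem isAmplitude_compAmp {m₁ m₂ m₃ t₁ t₂ : ℝ} {a : E n → E n → E n → ℂ}
    (ha : IsAmplitude m₁ m₂ m₃ a) {p : E n → E n → ℂ} (hp : IsSymbol t₁ t₂ p) :
    IsAmplitude m₁ (m₂ + t₁) (m₃ + t₂) (compAmp a p) := (sym_compAmp ha hp).isAmplitude

theorem Sym.slice_snd {V W : Type*} [NormedAddCommGroup V] [NormedSpace ℝ V]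
    [FiniteDimensional ℝ V] [NormedAddCommGroup W] [NormedSpace ℝ W] [FiniteDimensional ℝ W]
    {w : V × W → ℝ} {F : V × W → ℂ} (h : Sym (fun (_ : Unit) => w) (fun _ => F)) :
    Sym (fun (v : V) q => w (v, q)) (fun v q => F (v, q)) := by
  simpa using h.comp_affine (ι' := V) (fun _ => ()) (ContinuousLinearMap.inr ℝ V W)
    (fun v => (v, 0))

/-- The oscillatory integrals of the cut-off symbols are absolutely convergent integrals. -/
theorem os_cutoff_eq_integral {χ : E n × E n → ℂ} (hχ : IsCutoff χ) {K : ℝ}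
    {G : E n × E n → ℂ} (hG : IsOsc K G) {ε : ℝ} (hε : 0 < ε) :
    Os (fun q => χ (ε • q) * G q) =
      ((2 * Real.pi : ℂ) ^ n)⁻¹ * ∫ q, psi q * (χ (ε • q) * G q) := by
  refine os_eq_integral (K := -(2 * n + 1)) (Sym.mono_le ((cutoff_sym (ι := Unit) hχ
    (continuous_wt_rpow (-(2 * n + 1) - K)) (fun q => wt_rpow_pos q _) hε).mul hG)
    fun _ q => ?_) le_rfl
  rw [← Real.rpow_add (wt_pos q)]; simp

/-- The identity `∫ e^{-i z·ξ} c(x, z, ξ) u(z) dz = ∫ e^{-i y·ξ} a(x, y, ξ) p(x, D)u(y) dy`. With the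
cut-off in place it is Fubini's theorem and the substitution `y ↦ z + y`. -/
theorem innerInt_compAmp {m₁ m₂ m₃ t₁ t₂ : ℝ} {a : E n → E n → E n → ℂ}
    (ha : IsAmplitude m₁ m₂ m₃ a) {p : E n → E n → ℂ} (hp : IsSymbol t₁ t₂ p)
    (u : SchwartzMap (E n) ℂ) (x ξ : E n) :
    innerInt (fun ξ => -ξ) (fun q => compAmp a p x q.1 q.2 * u q.1) ξ =
      innerInt (fun ξ => -ξ) (fun q => a x q.1 q.2 * pdo hp u q.1) ξ := by
  obtain ⟨χ, hχ⟩ := exists_cutoff n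
  set e : E n → ℂ := fun y => Complex.exp (Complex.I * (inner ℝ y (-ξ) : ℝ)) with he
  have hec : Continuous e := by fun_prop
  have he1 : ∀ y, ‖e y‖ = 1 := fun y => norm_cexp_I _
  -- the family of symbols defining `c`, and its growth in `z`
  set g : E n → E n × E n → ℂ := fun z q => a x (z + q.1) ξ * p (z + q.1) (ξ + q.2) with hg
  set κ : ℝ := |m₂ + t₁| + |t₂| with hκ
  have hG := sym_compAmp_integrand ha hp
  have hgs : Sym (fun z q => ampWt m₁ (m₂ + t₁) (m₃ + t₂) (x, z, ξ) * wt q ^ κ) g :=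
    hG.slice_snd.reindex fun z => (x, z, ξ)
  have hgc : Continuous (fun v : E n × (E n × E n) => g v.1 v.2) :=
    (hG.continuous ()).comp (by fun_prop :
      Continuous fun v : E n × (E n × E n) => ((x, v.1, ξ), v.2))
  -- the family of symbols defining `p(x, D)u`, and its decay in `y`
  obtain ⟨N, hN⟩ := exists_bracket_order (n := n) m₂ (-(n + 1))
  obtain ⟨K, hK⟩ := sym_pdoAmp_decay hp u ξ (-(N : ℝ))
  have hH : Sym (fun y q => bracket y ^ (-(N : ℝ)) * wt q ^ K) (fun y => pdoAmp p u ξ y) :=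
    hK.slice_snd
  obtain ⟨C₁, hC₁, hb₁⟩ := os_cutoff hχ hgs
  obtain ⟨C₂, hC₂, hb₂⟩ := os_cutoff hχ hH
  obtain ⟨C₃, hC₃, hb₃⟩ := ha.sym.bdd
  obtain ⟨M, hM⟩ := exists_bracket_order (n := n) (m₂ + t₁) (-(n + 1))
  obtain ⟨C₄, hC₄, hb₄⟩ := (sym_schwartz u M).bdd
  simp only at hb₃ hb₄
  have hbnd₁ : ∀ z, ampWt m₁ (m₂ + t₁) (m₃ + t₂) (x, z, ξ) * ‖u z‖ ≤
      C₄ * (bracket x ^ m₁ * bracket ξ ^ (m₃ + t₂)) * bracket z ^ (-(n + 1 : ℝ)) := by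
    intro z
    have p1 := bracket_rpow_pos x m₁
    have p2 := bracket_rpow_pos ξ (m₃ + t₂)
    have p3 := bracket_rpow_pos z (m₂ + t₁)
    calc _ ≤ (bracket x ^ m₁ * bracket z ^ (m₂ + t₁) * bracket ξ ^ (m₃ + t₂)) *
          (C₄ * bracket z ^ (-(M : ℝ))) :=
          mul_le_mul_of_nonneg_left (hb₄ () z) (by positivity)
      _ = C₄ * (bracket x ^ m₁ * bracket ξ ^ (m₃ + t₂)) *
          (bracket z ^ (m₂ + t₁) * bracket z ^ (-(M : ℝ))) := by ring
      _ ≤ _ := mul_le_mul_of_nonneg_left (hM z) (by positivity)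
  have hbnd₂ : ∀ y, ‖a x y ξ‖ * bracket y ^ (-(N : ℝ)) ≤
      C₃ * (bracket x ^ m₁ * bracket ξ ^ m₃) * bracket y ^ (-(n + 1 : ℝ)) := by
    intro y
    have p1 := bracket_rpow_pos x m₁
    have p2 := bracket_rpow_pos ξ m₃
    have p3 := bracket_rpow_pos y (-(N : ℝ))
    calc _ ≤ (C₃ * (bracket x ^ m₁ * bracket y ^ m₂ * bracket ξ ^ m₃)) * bracket y ^ (-(N : ℝ)) :=
          mul_le_mul_of_nonneg_right (hb₃ () (x, y, ξ)) p3.le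
      _ = C₃ * (bracket x ^ m₁ * bracket ξ ^ m₃) *
          (bracket y ^ m₂ * bracket y ^ (-(N : ℝ))) := by ring
      _ ≤ _ := mul_le_mul_of_nonneg_left (hN y) (by positivity)
  have hI₁ : Integrable fun z => e z * (compAmp a p x z ξ * u z) :=
    (isDec_amplitude_mul (isAmplitude_compAmp ha hp) u x (-(n + 1))).integrable_slice (-ξ) ξ
  have hI₂ : Integrable fun y => e y * (a x y ξ * pdo hp u y) :=
    (isDec_amplitude_mul ha (pdo hp u) x (-(n + 1))).integrable_slice (-ξ) ξ
  have hint := integrable_bracket (n := n)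
  refine eq_of_norm_sub_le (C := (C₁ * (C₄ * (bracket x ^ m₁ * bracket ξ ^ (m₃ + t₂))) +
    C₂ * (C₃ * (bracket x ^ m₁ * bracket ξ ^ m₃))) * ∫ y : E n, bracket y ^ (-(n + 1 : ℝ)))
    fun ε h0 h1 => ?_
  -- the integrand of the cut-off double integral
  set Φ : E n → E n × E n → ℂ := fun z q => e z * u z * (psi q * (χ (ε • q) * g z q)) with hΦ
  have hΦc : Continuous (fun v : E n × (E n × E n) => Φ v.1 v.2) := by
    have := continuous_psi (n := n)
    have := hχ.1.continuous
    have := u.continuous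
    fun_prop
  -- the cut-off provides `-(2n + 1)` for integrability in `q`, another `-(n + 1)` to make up for the
  -- shift `z = y - q.1` in Peetre's inequality, and `-κ` against the growth of the symbol
  obtain ⟨C₅, hC₅, hb₅⟩ := (cutoff_sym (ι := Unit) hχ
    (continuous_wt_rpow (-(2 * n + 1) - (n + 1) - κ)) (fun q => wt_rpow_pos q _) h0).bdd
  obtain ⟨C₆, hC₆, hb₆⟩ := hgs.bdd
  have hΦb : ∀ z q, ‖Φ z q‖ ≤ C₆ * C₅ * (C₄ * (bracket x ^ m₁ * bracket ξ ^ (m₃ + t₂))) *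
      (bracket z ^ (-(n + 1 : ℝ)) * wt q ^ (-(2 * n + 1) - (n + 1) : ℝ)) := by
    intro z q
    have p5 := wt_rpow_pos q (-(2 * n + 1) - (n + 1) - κ)
    have p6 := wt_rpow_pos q κ
    have p7 := wt_rpow_pos q (-(2 * n + 1) - (n + 1))
    have p8 := bracket_rpow_pos x m₁
    have p9 := bracket_rpow_pos ξ (m₃ + t₂)
    have p10 : 0 < ampWt m₁ (m₂ + t₁) (m₃ + t₂) (x, z, ξ) := ampWt_pos _ _ _ _
    have e1 : wt q ^ (-(2 * n + 1) - (n + 1) - κ) * wt q ^ κ =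
        wt q ^ (-(2 * n + 1) - (n + 1) : ℝ) := by
      rw [← Real.rpow_add (wt_pos q)]; ring_nf
    simp only [hΦ, norm_mul, he1, norm_psi, one_mul]
    calc _ ≤ ‖u z‖ * ((C₅ * wt q ^ (-(2 * n + 1) - (n + 1) - κ)) *
          (C₆ * (ampWt m₁ (m₂ + t₁) (m₃ + t₂) (x, z, ξ) * wt q ^ κ))) := by
          refine mul_le_mul_of_nonneg_left (mul_le_mul (hb₅ () q) (hb₆ z q) (norm_nonneg _) ?_)
            (norm_nonneg _)
          positivity
      _ = C₆ * C₅ * (ampWt m₁ (m₂ + t₁) (m₃ + t₂) (x, z, ξ) * ‖u z‖) *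
          (wt q ^ (-(2 * n + 1) - (n + 1) - κ) * wt q ^ κ) := by ring
      _ ≤ C₆ * C₅ * (C₄ * (bracket x ^ m₁ * bracket ξ ^ (m₃ + t₂)) * bracket z ^ (-(n + 1 : ℝ))) *
          wt q ^ (-(2 * n + 1) - (n + 1) : ℝ) := by
          rw [e1]
          exact mul_le_mul_of_nonneg_right (mul_le_mul_of_nonneg_left (hbnd₁ z) (by positivity))
            p7.le
      _ = _ := by ring
  set B : ℝ := C₆ * C₅ * (C₄ * (bracket x ^ m₁ * bracket ξ ^ (m₃ + t₂))) with hB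
  have hB0 : 0 ≤ B := by
    have := bracket_rpow_pos x m₁
    have := bracket_rpow_pos ξ (m₃ + t₂)
    positivity
  have hn0 : (0 : ℝ) ≤ n := n.cast_nonneg
  have hΦi : Integrable (fun v : E n × (E n × E n) => Φ v.1 v.2) (volume.prod volume) := by
    refine ((hint.mul_prod (integrable_wt_of_le (n := n) (K := -(2 * n + 1) - (n + 1))
      (by linarith))).const_mul B).mono' hΦc.aestronglyMeasurable (.of_forall fun v => hΦb _ _)
  have hΨi : Integrable (fun v : E n × (E n × E n) => Φ (v.1 - v.2.1) v.2)
      (volume.prod volume) := by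
    refine ((hint.mul_prod (integrable_wt (n := n))).const_mul
      (B * 2 ^ |(-(n + 1) : ℝ)|)).mono' ?_ (.of_forall fun v => (hΦb _ _).trans ?_)
    · exact (hΦc.comp (by fun_prop : Continuous fun v : E n × (E n × E n) =>
        (v.1 - v.2.1, v.2))).aestronglyMeasurable
    · have e1 := bracket_add_rpow_le v.1 (-v.2.1) (-(n + 1 : ℝ))
      rw [← sub_eq_add_neg, bracket_neg, abs_neg, abs_of_nonneg (by positivity : (0 : ℝ) ≤ n + 1)]
        at e1
      rw [abs_neg, abs_of_nonneg (by positivity : (0 : ℝ) ≤ n + 1)]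
      have e2 : bracket v.2.1 ^ (n + 1 : ℝ) ≤ wt v.2 ^ (n + 1 : ℝ) :=
        Real.rpow_le_rpow (bracket_pos _).le (bracket_fst_le_wt _) (by positivity)
      have e3 : wt v.2 ^ (n + 1 : ℝ) * wt v.2 ^ (-(2 * n + 1) - (n + 1) : ℝ) =
          wt v.2 ^ (-(2 * n + 1) : ℝ) := by
        rw [← Real.rpow_add (wt_pos _)]; ring_nf
      have p1 := bracket_rpow_pos v.1 (-(n + 1 : ℝ))
      have p2 := wt_rpow_pos v.2 (-(2 * n + 1) - (n + 1) : ℝ)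
      rw [mul_assoc B]
      refine mul_le_mul_of_nonneg_left ?_ hB0
      calc _ ≤ (2 ^ (n + 1 : ℝ) * (bracket v.1 ^ (-(n + 1 : ℝ)) * wt v.2 ^ (n + 1 : ℝ))) *
            wt v.2 ^ (-(2 * n + 1) - (n + 1) : ℝ) := by
            refine mul_le_mul_of_nonneg_right (e1.trans ?_) p2.le
            gcongr
        _ = 2 ^ (n + 1 : ℝ) * (bracket v.1 ^ (-(n + 1 : ℝ)) * (wt v.2 ^ (n + 1 : ℝ) *
            wt v.2 ^ (-(2 * n + 1) - (n + 1) : ℝ))) := by ring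
        _ = _ := by rw [e3]
  -- Fubini's theorem and the substitution `z = y - q.1`
  have hswap : ∫ z, ∫ q, Φ z q = ∫ y, ∫ q, Φ (y - q.1) q := by
    rw [integral_integral_swap hΦi, integral_integral_swap (f := fun y (q : E n × E n) =>
      Φ (y - q.1) q) hΨi]
    congr 1
    ext q
    exact (integral_sub_right_eq_self (fun z => Φ z q) q.1).symm
  set k : ℂ := ((2 * Real.pi : ℂ) ^ n)⁻¹ with hk
  have hc : ∀ z, e z * (Os (fun q => χ (ε • q) * g z q) * u z) = k * ∫ q, Φ z q := by
    intro z
    rw [os_cutoff_eq_integral hχ (hgs.isOsc z) h0, hΦ]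
    simp only
    rw [integral_const_mul]
    ring
  have hpd : ∀ y, e y * (a x y ξ * Os (fun q => χ (ε • q) * pdoAmp p u ξ y q)) =
      k * ∫ q, Φ (y - q.1) q := by
    intro y
    rw [os_cutoff_eq_integral hχ (hH.isOsc y) h0]
    have e1 : ∀ q : E n × E n, Φ (y - q.1) q =
        e y * a x y ξ * (psi q * (χ (ε • q) * pdoAmp p u ξ y q)) := by
      intro q
      simp only [hΦ, hg, he, pdoAmp, sub_add_cancel]
      rw [inner_sub_left, Complex.ofReal_sub, mul_sub, Complex.exp_sub, inner_neg_right q.1,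
        Complex.ofReal_neg, mul_neg, Complex.exp_neg, div_inv_eq_mul]
      ring
    simp only [e1]
    rw [integral_const_mul]
    ring
  have hci : Integrable fun z => e z * (Os (fun q => χ (ε • q) * g z q) * u z) := by
    simp only [hc]
    exact hΦi.integral_prod_left.const_mul k
  have hpi : Integrable fun y => e y * (a x y ξ * Os (fun q => χ (ε • q) * pdoAmp p u ξ y q)) := by
    simp only [hpd]
    exact hΨi.integral_prod_left.const_mul k
  have key : ∫ z, e z * (Os (fun q => χ (ε • q) * g z q) * u z) =
      ∫ y, e y * (a x y ξ * Os (fun q => χ (ε • q) * pdoAmp p u ξ y q)) := by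
    simp only [hc, hpd]
    rw [integral_const_mul, integral_const_mul, hswap]
  -- on either side, the cut-off changes the integral by `O(ε)`
  have d₁ : ‖(∫ z, e z * (compAmp a p x z ξ * u z)) -
      ∫ z, e z * (Os (fun q => χ (ε • q) * g z q) * u z)‖ ≤
      ∫ z : E n, C₁ * ε * (C₄ * (bracket x ^ m₁ * bracket ξ ^ (m₃ + t₂))) *
        bracket z ^ (-(n + 1 : ℝ)) := by
    rw [← integral_sub hI₁ hci]
    refine norm_integral_le_of_norm_le (hint.const_mul _) (.of_forall fun z => ?_)
    rw [← mul_sub, ← sub_mul, norm_mul, he1, one_mul, norm_mul]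
    calc _ ≤ C₁ * (ε * ampWt m₁ (m₂ + t₁) (m₃ + t₂) (x, z, ξ)) * ‖u z‖ :=
          mul_le_mul_of_nonneg_right (hb₁ ε h0 h1 z) (norm_nonneg _)
      _ = C₁ * ε * (ampWt m₁ (m₂ + t₁) (m₃ + t₂) (x, z, ξ) * ‖u z‖) := by ring
      _ ≤ C₁ * ε * (C₄ * (bracket x ^ m₁ * bracket ξ ^ (m₃ + t₂)) * bracket z ^ (-(n + 1 : ℝ))) :=
          mul_le_mul_of_nonneg_left (hbnd₁ z) (by positivity)
      _ = _ := by ring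
  have d₂ : ‖(∫ y, e y * (a x y ξ * pdo hp u y)) -
      ∫ y, e y * (a x y ξ * Os (fun q => χ (ε • q) * pdoAmp p u ξ y q))‖ ≤
      ∫ y : E n, C₂ * ε * (C₃ * (bracket x ^ m₁ * bracket ξ ^ m₃)) * bracket y ^ (-(n + 1 : ℝ)) := by
    rw [← integral_sub hI₂ hpi]
    refine norm_integral_le_of_norm_le (hint.const_mul _) (.of_forall fun y => ?_)
    rw [← mul_sub, ← mul_sub, norm_mul, he1, one_mul, norm_mul, pdo_apply_eq_os hp u ξ y]
    calc _ ≤ ‖a x y ξ‖ * (C₂ * (ε * bracket y ^ (-(N : ℝ)))) :=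
          mul_le_mul_of_nonneg_left (hb₂ ε h0 h1 y) (norm_nonneg _)
      _ = C₂ * ε * (‖a x y ξ‖ * bracket y ^ (-(N : ℝ))) := by ring
      _ ≤ C₂ * ε * (C₃ * (bracket x ^ m₁ * bracket ξ ^ m₃) * bracket y ^ (-(n + 1 : ℝ))) :=
          mul_le_mul_of_nonneg_left (hbnd₂ y) (by positivity)
      _ = _ := by ring
  rw [integral_const_mul] at d₁ d₂
  rw [key] at d₁
  have d₃ := (norm_sub_le_norm_sub_add_norm_sub (∫ z, e z * (compAmp a p x z ξ * u z))
    (∫ y, e y * (a x y ξ * Os (fun q => χ (ε • q) * pdoAmp p u ξ y q)))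
    (∫ y, e y * (a x y ξ * pdo hp u y))).trans (add_le_add d₁ ((norm_sub_rev _ _).trans_le d₂))
  exact d₃.trans (le_of_eq (by ring))

/-- The composition formula: a phase does not enter the inner integrals, and these agree. -/
theorem fioOp_compAmp {m₁ m₂ m₃ t₁ t₂ : ℝ} {a : E n → E n → E n → ℂ}
    (ha : IsAmplitude m₁ m₂ m₃ a) {p : E n → E n → ℂ} (hp : IsSymbol t₁ t₂ p)
    (φ : E n → E n → ℝ) (u : SchwartzMap (E n) ℂ) (x : E n) :
    fioOp φ (compAmp a p) u x = fioOp φ a (pdo hp u) x := by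
  simp only [fioOp, innerInt_compAmp ha hp u x]

end Composition

/-! ### Taylor's formula in multi-indices -/

section Taylor
variable {n : ℕ}

theorem prod_factorial_add_single (α : Fin n → ℕ) (j : Fin n) :
    ∏ i, ((α + Pi.single j 1 : Fin n → ℕ) i).factorial = (α j + 1) * ∏ i, (α i).factorial := by
  rw [← Finset.mul_prod_erase _ _ (Finset.mem_univ j), ← Finset.mul_prod_erase _ (fun i =>
    (α i).factorial) (Finset.mem_univ j), ← mul_assoc]
  congr 1
  · simp [Nat.factorial_succ]
  · refine Finset.prod_congr rfl fun i hi => ?_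
    simp [Pi.single_eq_of_ne (Finset.ne_of_mem_erase hi)]

/-- Euler's relation for sums over multi-indices, weighted by the reciprocal factorials: each
multi-index `β` of length `N + 1` arises as `α + e_j` for the `j` with `β_j ≠ 0`, and
`∑_j β_j = N + 1` accounts for the factorials. -/
theorem sum_piAntidiag_succ (N : ℕ) (F : (Fin n → ℕ) → ℂ) :
    ∑ α ∈ Finset.piAntidiag (Finset.univ : Finset (Fin n)) N,
      ((∏ j, (α j).factorial : ℕ) : ℂ)⁻¹ * ∑ j, F (α + Pi.single j 1) =
    (N + 1) * ∑ β ∈ Finset.piAntidiag (Finset.univ : Finset (Fin n)) (N + 1),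
      ((∏ j, (β j).factorial : ℕ) : ℂ)⁻¹ * F β := by
  have h1 : ∀ j : Fin n, ∑ α ∈ Finset.piAntidiag (Finset.univ : Finset (Fin n)) N,
      ((∏ j, (α j).factorial : ℕ) : ℂ)⁻¹ * F (α + Pi.single j 1) =
      ∑ β ∈ Finset.piAntidiag (Finset.univ : Finset (Fin n)) (N + 1),
        (β j : ℂ) * (((∏ j, (β j).factorial : ℕ) : ℂ)⁻¹ * F β) := by
    intro j
    refine Finset.sum_of_injOn (fun α => α + Pi.single j 1) ?_ ?_ ?_ ?_
    · intro α _ β _ h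
      exact add_right_cancel h
    · intro α hα
      simp only [Finset.mem_univ, implies_true, and_true,
        Pi.add_apply, Finset.sum_add_distrib, Finset.mem_coe, Finset.mem_piAntidiag] at hα ⊢
      simp [hα]
    · intro β hβ hn
      have : β j = 0 := by
        by_contra h
        refine hn ⟨β - Pi.single j 1, ?_, ?_⟩
        · have e : β = (β - Pi.single j 1) + Pi.single j 1 := by
            ext i
            by_cases hi : i = j
            · subst hi; simp; omega
            · simp [Pi.single_eq_of_ne hi]
          simp only [Finset.mem_piAntidiag, Finset.mem_univ, implies_true, and_true,
            Finset.mem_coe] at hβ ⊢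
          rw [e] at hβ
          simp only [Pi.add_apply, Finset.sum_add_distrib] at hβ
          simpa using hβ
        · ext i
          by_cases hi : i = j
          · subst hi; simp; omega
          · simp [Pi.single_eq_of_ne hi]
      simp [this]
    · intro α _
      rw [prod_factorial_add_single]
      have : ((∏ i, (α i).factorial : ℕ) : ℂ) ≠ 0 := by
        exact_mod_cast Finset.prod_ne_zero_iff.2 fun i _ => Nat.factorial_ne_zero _
      have h2 : ((α j : ℂ) + 1) ≠ 0 := Nat.cast_add_one_ne_zero (α j)
      rw [Nat.cast_mul, mul_inv, ← mul_assoc, ← mul_assoc]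
      simp only [Pi.add_apply, Pi.single_eq_same, Nat.cast_add, Nat.cast_one]
      rw [mul_inv_cancel₀ h2, one_mul]
  simp only [Finset.mul_sum]
  rw [Finset.sum_comm]
  simp only [h1]
  rw [Finset.sum_comm]
  refine Finset.sum_congr rfl fun β hβ => ?_
  rw [← Finset.sum_mul]
  congr 1
  simp only [Finset.mem_piAntidiag, Finset.mem_univ, implies_true, and_true] at hβ
  exact_mod_cast hβ

/-- The directions of `η` in the space of the variables `(y, η)`. -/
def dirη (j : Fin n) : E n × E n := dir (Sum.inr j)

/-- The average `∫₀¹ (1 - t)^k P(y, ξ + tη) dt`. -/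
def segAvg (k : ℕ) (P : E n × E n → ℂ) (q : E n × E n × E n) : ℂ :=
  ∫ t in (0 : ℝ)..1, ((1 - t : ℝ) : ℂ) ^ k * P (q.1, q.2.1 + t • q.2.2)

/-- The factor `P(y, ξ + η)` or `N ∫₀¹ (1 - t)^{N-1} P(y, ξ + tη) dt` of the `N`-th Taylor
remainder. -/
def taylorRem : ℕ → (E n × E n → ℂ) → E n × E n × E n → ℂ
  | 0, P => fun q => P (q.1, q.2.1 + q.2.2)
  | k + 1, P => fun q => (k + 1 : ℂ) * segAvg k P q

theorem sym_segAvg {t₁ t₂ : ℝ} {P : E n × E n → ℂ}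
    (hP : Sym (fun (_ : Unit) (q : E n × E n) => bracket q.1 ^ t₁ * bracket q.2 ^ t₂)
      (fun _ => P)) (k : ℕ) :
    Sym (fun (_ : Unit) => ampWt t₁ t₂ |t₂|) (fun _ => segAvg k P) := by
  let pr : ℝ → Set.Icc (0 : ℝ) 1 := Set.projIcc 0 1 zero_le_one
  have hpr : Continuous pr := continuous_projIcc
  have e : ∀ q : E n × E n × E n, segAvg k P q = ∫ t in Set.Ioc (0 : ℝ) 1,
      ((1 - (pr t : ℝ) : ℝ) : ℂ) ^ k * P (q.1, q.2.1 + (pr t : ℝ) • q.2.2) := by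
    intro q
    rw [segAvg, intervalIntegral.integral_of_le zero_le_one]
    refine setIntegral_congr_fun measurableSet_Ioc fun t ht => ?_
    simp only [pr, Set.projIcc_of_mem zero_le_one (Set.Ioc_subset_Icc_self ht)]
  refine Sym.congr (f := fun (_ : Unit) q => ∫ t in Set.Ioc (0 : ℝ) 1,
      ((1 - (pr t : ℝ) : ℝ) : ℂ) ^ k * P (q.1, q.2.1 + (pr t : ℝ) • q.2.2)) (fun m => ?_)
    fun _ q => e q
  refine SymN.integral (ρ := fun _ => 1) (μ := volume.restrict (Set.Ioc (0 : ℝ) 1))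
    (by simp) (fun _ => zero_le_one)
    (fun _ => continuous_ampWt t₁ t₂ |t₂|) (ψ := fun t => ((1 - (pr t : ℝ) : ℝ) : ℂ) ^ k) ?_ ?_ m
    (f := fun (j : ℝ × Unit) q => P (q.1, q.2.1 + (pr j.1 : ℝ) • q.2.2)) ?_ ?_
  · exact (by fun_prop : Continuous fun t => ((1 - (pr t : ℝ) : ℝ) : ℂ) ^ k).aestronglyMeasurable
  · intro t
    rw [norm_pow, Complex.norm_real, Real.norm_of_nonneg (by linarith [(pr t).2.2])]
    exact pow_le_one₀ (by linarith [(pr t).2.2]) (by linarith [(pr t).2.1])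
  · exact ((sym_translate hP).reindex fun j : ℝ × Unit => pr j.1).mono_le fun _ _ => by
      rw [one_mul]
  · intro _ q
    exact ((hP.continuous ()).comp (by fun_prop : Continuous fun t =>
      (q.1, q.2.1 + (pr t : ℝ) • q.2.2))).aestronglyMeasurable

theorem sym_taylorRem {t₁ t₂ : ℝ} {P : E n × E n → ℂ}
    (hP : Sym (fun (_ : Unit) (q : E n × E n) => bracket q.1 ^ t₁ * bracket q.2 ^ t₂)
      (fun _ => P)) (N : ℕ) :
    Sym (fun (_ : Unit) => ampWt t₁ t₂ |t₂|) (fun _ => taylorRem N P) := by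
  cases N with
  | zero =>
    have h := (sym_translate hP).reindex (ι' := Unit) fun _ => ⟨1, by simp⟩
    simp only [one_smul] at h
    exact h
  | succ k => exact (sym_segAvg hP k).const_mul _

theorem hasDerivAt_line {P : E n × E n → ℂ} (hP : Differentiable ℝ P) (y ξ η : E n) (t : ℝ) :
    HasDerivAt (fun t : ℝ => P (y, ξ + t • η)) (∑ j, (η j : ℂ) * D (dirη j) P (y, ξ + t • η)) t := by
  have h1 : HasDerivAt (fun t : ℝ => (y, ξ + t • η)) ((0 : E n), η) t := by
    refine (hasDerivAt_const t y).prodMk ?_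
    simpa using ((hasDerivAt_id t).smul_const η).const_add ξ
  have h2 := (hP (y, ξ + t • η)).hasFDerivAt.comp_hasDerivAt t h1
  have e : ((0 : E n), η) = ∑ j, η j • (dirη j : E n × E n) := by
    have : ∑ j, η j • ej j = η := by
      have := (EuclideanSpace.basisFun (Fin n) ℝ).sum_repr η
      simpa only [EuclideanSpace.basisFun_repr, EuclideanSpace.basisFun_apply] using this
    have h3 : ∀ s : Finset (Fin n), ∑ j ∈ s, η j • (dirη j : E n × E n) =
        (0, ∑ j ∈ s, η j • ej j) := by
      intro s
      rw [Prod.ext_iff, Prod.fst_sum, Prod.snd_sum]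
      simp [dirη, dir]
    rw [h3]
    congr 1
    exact this.symm
  have e2 : fderiv ℝ P (y, ξ + t • η) ((0 : E n), η) =
      ∑ j, (η j : ℂ) * D (dirη j) P (y, ξ + t • η) := by
    rw [e, map_sum]
    refine Finset.sum_congr rfl fun j _ => ?_
    rw [map_smul, Complex.real_smul]
    rfl
  rw [e2] at h2
  exact h2

/-- The recursion behind Taylor's formula, by integration by parts in `t`; for `N = 0` it is the
fundamental theorem of calculus. -/
theorem taylorRem_eq {P : E n × E n → ℂ} (hP : ContDiff ℝ ∞ P) (N : ℕ) (y ξ η : E n) :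
    taylorRem N P (y, ξ, η) = P (y, ξ) +
      (N + 1 : ℂ)⁻¹ * ∑ j, (η j : ℂ) * taylorRem (N + 1) (D (dirη j) P) (y, ξ, η) := by
  have hd : Differentiable ℝ P := hP.differentiable (by simp)
  have hc : ∀ j, Continuous fun t : ℝ => D (dirη j) P (y, ξ + t • η) := fun j =>
    (contDiff_D hP _).continuous.comp (by fun_prop)
  have hPc : Continuous fun t : ℝ => P (y, ξ + t • η) := hP.continuous.comp (by fun_prop)
  have e1 : (N + 1 : ℂ)⁻¹ * ∑ j, (η j : ℂ) * taylorRem (N + 1) (D (dirη j) P) (y, ξ, η) =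
      ∫ t in (0 : ℝ)..1, ((1 - t : ℝ) : ℂ) ^ N * ∑ j, (η j : ℂ) * D (dirη j) P (y, ξ + t • η) := by
    have hN : (N + 1 : ℂ) ≠ 0 := by exact_mod_cast Nat.succ_ne_zero N
    simp only [taylorRem, segAvg, Finset.mul_sum]
    rw [intervalIntegral.integral_finsetSum fun j _ =>
      (by have := hc j; fun_prop : Continuous _).intervalIntegrable _ _]
    refine Finset.sum_congr rfl fun j _ => ?_
    rw [mul_left_comm, inv_mul_cancel_left₀ hN, ← intervalIntegral.integral_const_mul]
    congr 1; ext t; ring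
  rw [e1]
  have hc' : Continuous fun t : ℝ => ∑ j, (η j : ℂ) * D (dirη j) P (y, ξ + t • η) :=
    continuous_finsetSum _ fun j _ => continuous_const.mul (hc j)
  cases N with
  | zero =>
    have := intervalIntegral.integral_eq_sub_of_hasDerivAt (a := 0) (b := 1)
      (fun t _ => hasDerivAt_line hd y ξ η t) (hc'.intervalIntegrable _ _)
    simp only [pow_zero, one_mul, this, taylorRem]
    simp
  | succ k =>
    have hder : ∀ t : ℝ, HasDerivAt (fun t : ℝ => ((1 - t : ℝ) : ℂ) ^ (k + 1) * P (y, ξ + t • η))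
        (((k + 1 : ℕ) : ℂ) * ((1 - t : ℝ) : ℂ) ^ k * (-1) * P (y, ξ + t • η) +
          ((1 - t : ℝ) : ℂ) ^ (k + 1) * ∑ j, (η j : ℂ) * D (dirη j) P (y, ξ + t • η)) t := by
      intro t
      have h1 : HasDerivAt (fun t : ℝ => ((1 - t : ℝ) : ℂ)) (-1) t := by
        have := ((hasDerivAt_id t).const_sub 1).ofReal_comp
        simpa using this
      exact (h1.pow (k + 1)).mul (hasDerivAt_line hd y ξ η t)
    have i1 : Continuous fun t : ℝ =>
        ((k + 1 : ℕ) : ℂ) * ((1 - t : ℝ) : ℂ) ^ k * (-1) * P (y, ξ + t • η) := by fun_prop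
    have i2 : Continuous fun t : ℝ => ((1 - t : ℝ) : ℂ) ^ (k + 1) *
        ∑ j, (η j : ℂ) * D (dirη j) P (y, ξ + t • η) := by fun_prop
    have := intervalIntegral.integral_eq_sub_of_hasDerivAt (a := 0) (b := 1)
      (fun t _ => hder t) ((i1.add i2).intervalIntegrable _ _)
    rw [intervalIntegral.integral_add (i1.intervalIntegrable _ _) (i2.intervalIntegrable _ _)] at this
    have e2 : ∫ t in (0 : ℝ)..1, ((k + 1 : ℕ) : ℂ) * ((1 - t : ℝ) : ℂ) ^ k * (-1) *
        P (y, ξ + t • η) = -taylorRem (k + 1) P (y, ξ, η) := by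
      simp only [taylorRem, segAvg]
      rw [← intervalIntegral.integral_const_mul, ← intervalIntegral.integral_neg]
      congr 1; ext t; push_cast; ring
    rw [e2] at this
    simp only [sub_self, Complex.ofReal_zero, zero_smul, add_zero, sub_zero, Complex.ofReal_one,
      one_pow, one_mul, ne_eq, Nat.succ_ne_zero, not_false_eq_true, zero_pow, zero_mul, zero_sub]
      at this
    linear_combination -this

/-- The monomial `η^α`. -/
def monom (α : Fin n → ℕ) (η : E n) : ℂ := ∏ j, (η j : ℂ) ^ α j

theorem monom_add_single (α : Fin n → ℕ) (j : Fin n) (η : E n) :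
    monom (α + Pi.single j 1) η = monom α η * (η j : ℂ) := by
  simp only [monom, Pi.add_apply, pow_add, Finset.prod_mul_distrib]
  congr 1
  rw [Finset.prod_eq_single j]
  · simp
  · intro i _ hi
    simp [Pi.single_eq_of_ne hi]
  · simp

/-- Taylor's formula. -/
theorem taylor {P : E n × E n → ℂ} (hP : ContDiff ℝ ∞ P) (N : ℕ) (y ξ η : E n) :
    P (y, ξ + η) = (∑ k ∈ Finset.range N, ∑ α ∈ Finset.piAntidiag (Finset.univ : Finset (Fin n)) k,
        ((∏ j, (α j).factorial : ℕ) : ℂ)⁻¹ * (monom α η * mD dirη α P (y, ξ))) +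
      ∑ α ∈ Finset.piAntidiag (Finset.univ : Finset (Fin n)) N,
        ((∏ j, (α j).factorial : ℕ) : ℂ)⁻¹ * (monom α η * taylorRem N (mD dirη α P) (y, ξ, η)) := by
  induction N with
  | zero => simp [mD_zero, monom, taylorRem]
  | succ N ih =>
    rw [ih, Finset.sum_range_succ, add_assoc]
    congr 1
    have hN : (N + 1 : ℂ) ≠ 0 := by exact_mod_cast Nat.succ_ne_zero N
    have h := sum_piAntidiag_succ N (fun β => monom β η * taylorRem (N + 1) (mD dirη β P) (y, ξ, η))
    rw [← inv_mul_eq_iff_eq_mul₀ hN] at h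
    rw [← h, Finset.mul_sum, ← Finset.sum_add_distrib]
    refine Finset.sum_congr rfl fun α _ => ?_
    rw [taylorRem_eq (contDiff_mD dirη α hP)]
    simp only [D_mD dirη α hP, monom_add_single, mul_assoc, ← Finset.mul_sum]
    ring

end Taylor

/-! ### Integration by parts with monomials -/

section Expansion
variable {n : ℕ}

theorem dir_ell_inl (i j : Fin n) : ell (Sum.inl j) (dir (Sum.inl i) : E n × E n) = 0 := by
  simp [ell, dir]

theorem IsOsc.ell_pow_mul {K : ℝ} {G : E n × E n → ℂ} (hG : IsOsc K G) (s : Fin n ⊕ Fin n)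
    (k : ℕ) : IsOsc (K + k) (fun q => (ell s q : ℂ) ^ k * G q) := by
  induction k with
  | zero => simpa using hG
  | succ k ih =>
    have := ih.ell_mul s
    simp only [← mul_assoc, ← pow_succ'] at this
    push_cast
    rwa [← add_assoc]

theorem D_ell_mul {f : E n × E n → ℂ} (hf : Differentiable ℝ f) (i j : Fin n) (k : ℕ) :
    D (dir (Sum.inl i)) (fun q => (ell (Sum.inl j) q : ℂ) ^ k * f q) =
      fun q => (ell (Sum.inl j) q : ℂ) ^ k * D (dir (Sum.inl i)) f q := by
  induction k generalizing f with
  | zero => simp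
  | succ k ih =>
    have hd : Differentiable ℝ fun q : E n × E n => (ell (Sum.inl j) q : ℂ) :=
      (sym_ell (ι := Unit) (Sum.inl j)).differentiable ()
    simp only [pow_succ, mul_assoc]
    have h := ih (f := fun q => (ell (Sum.inl j) q : ℂ) * f q) (hd.mul hf)
    rw [h, D_mul _ hd hf, D_linear, dir_ell_inl]
    simp

/-- The directions of `y` in the space of the variables `(y, η)`. -/
def dirY (j : Fin n) : E n × E n := dir (Sum.inl j)

theorem foldr_ell_mul (l : List (Fin n)) (α : Fin n → ℕ) {f : E n × E n → ℂ}
    (hf : ContDiff ℝ ∞ f) (j : Fin n) (k : ℕ) :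
    l.foldr (fun j g => (D (dirY j))^[α j] g) (fun q => (ell (Sum.inl j) q : ℂ) ^ k * f q) =
      fun q => (ell (Sum.inl j) q : ℂ) ^ k * l.foldr (fun j g => (D (dirY j))^[α j] g) f q := by
  have h1 : ∀ (m : ℕ) (i : Fin n) {f : E n × E n → ℂ}, ContDiff ℝ ∞ f →
      (D (dirY i))^[m] (fun q => (ell (Sum.inl j) q : ℂ) ^ k * f q) =
        fun q => (ell (Sum.inl j) q : ℂ) ^ k * (D (dirY i))^[m] f q := by
    intro m i f hf
    induction m with
    | zero => rfl
    | succ m ih =>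
      simp only [Function.iterate_succ_apply', ih]
      exact D_ell_mul ((contDiff_D_iterate hf _ m).differentiable (by simp)) i j k
  induction l with
  | nil => rfl
  | cons i l ih =>
    simp only [List.foldr_cons, ih]
    exact h1 _ _ (contDiff_foldr l dirY α hf)

theorem IsOsc.contDiff {K : ℝ} {G : E n × E n → ℂ} (hG : IsOsc K G) : ContDiff ℝ ∞ G :=
  Sym.contDiff hG ()

theorem IsOsc.D_iterate {K : ℝ} {G : E n × E n → ℂ} (hG : IsOsc K G) (v : E n × E n) (k : ℕ) :
    IsOsc K ((FIOCalc.D v)^[k] G) := by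
  induction k with
  | zero => exact hG
  | succ k ih => rw [Function.iterate_succ_apply']; exact ih.D v

theorem IsOsc.foldr {K : ℝ} {G : E n × E n → ℂ} (hG : IsOsc K G) (l : List (Fin n))
    (b : Fin n → E n × E n) (α : Fin n → ℕ) :
    IsOsc K (l.foldr (fun j g => (FIOCalc.D (b j))^[α j] g) G) := by
  induction l with
  | nil => exact hG
  | cons i l ih => exact ih.D_iterate _ _

theorem os_ell_pow_mul {K : ℝ} {G : E n × E n → ℂ} (hG : IsOsc K G) (s : Fin n ⊕ Fin n) (k : ℕ)
    (hs : D (dir s) (fun q : E n × E n => (ell s q : ℂ)) = fun _ => 0) :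
    Os (fun q => (ell s q : ℂ) ^ k * G q) = Complex.I ^ k * Os ((D (dir s))^[k] G) := by
  induction k generalizing K G with
  | zero => simp
  | succ k ih =>
    have hd : Differentiable ℝ fun q : E n × E n => (ell s q : ℂ) :=
      (sym_ell (ι := Unit) s).differentiable ()
    have hcomm : ∀ k : ℕ, (D (dir s))^[k] (fun q => (ell s q : ℂ) * G q) =
        fun q => (ell s q : ℂ) * (D (dir s))^[k] G q := by
      intro k
      induction k with
      | zero => rfl
      | succ k ih =>
        simp only [Function.iterate_succ_apply', ih]
        rw [D_mul _ hd (hG.D_iterate _ k).differentiable, hs]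
        simp
    have h1 := ih (hG.ell_mul s)
    simp only [pow_succ, mul_assoc]
    rw [h1, hcomm, os_ell_mul (hG.D_iterate _ k) s, Function.iterate_succ_apply']

theorem os_prod_ell_mul (l : List (Fin n)) (α : Fin n → ℕ) {K : ℝ} {G : E n × E n → ℂ}
    (hG : IsOsc K G) :
    Os (fun q => (l.map fun j => (ell (Sum.inl j) q : ℂ) ^ α j).prod * G q) =
      Complex.I ^ (l.map α).sum * Os (l.foldr (fun j g => (D (dirY j))^[α j] g) G) := by
  induction l generalizing K G with
  | nil => simp
  | cons j l ih =>
    have h1 := ih (hG.ell_pow_mul (Sum.inl j) (α j))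
    have e : (fun q => ((j :: l).map fun j => (ell (Sum.inl j) q : ℂ) ^ α j).prod * G q) =
        fun q => (l.map fun j => (ell (Sum.inl j) q : ℂ) ^ α j).prod *
          ((ell (Sum.inl j) q : ℂ) ^ α j * G q) := by
      ext q
      simp only [List.map_cons, List.prod_cons]
      ring
    rw [e, h1, foldr_ell_mul l α hG.contDiff, os_ell_pow_mul (hG.foldr l dirY α)]
    · simp only [List.map_cons, List.sum_cons, List.foldr_cons, pow_add]
      rw [← mul_assoc, mul_comm (Complex.I ^ (l.map α).sum)]
      rfl
    · rw [D_linear, dir_ell_inl]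
      simp

theorem monom_eq_list_prod (α : Fin n → ℕ) (q : E n × E n) :
    monom α q.2 = ((List.finRange n).map fun j => (ell (Sum.inl j) q : ℂ) ^ α j).prod := by
  rw [monom, ← List.ofFn_eq_map, List.prod_ofFn]
  rfl

/-- Integration by parts with monomials in `η`. -/
theorem os_monom_mul (α : Fin n → ℕ) {K : ℝ} {G : E n × E n → ℂ} (hG : IsOsc K G) :
    Os (fun q => monom α q.2 * G q) = Complex.I ^ (∑ j, α j) * Os (mD dirY α G) := by
  simp only [monom_eq_list_prod]
  rw [os_prod_ell_mul _ _ hG, ← List.ofFn_eq_map, List.sum_ofFn]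
  rfl

theorem IsOsc.monom_mul {K : ℝ} {G : E n × E n → ℂ} (hG : IsOsc K G) (α : Fin n → ℕ) :
    IsOsc (K + (∑ j, α j : ℕ)) (fun q => FIOCalc.monom α q.2 * G q) := by
  have h : ∀ l : List (Fin n), IsOsc (K + ((l.map α).sum : ℕ))
      (fun q => (l.map fun j => (ell (Sum.inl j) q : ℂ) ^ α j).prod * G q) := by
    intro l
    induction l with
    | nil => simpa using hG
    | cons j l ih =>
      have := ih.ell_pow_mul (Sum.inl j) (α j)
      simp only [List.map_cons, List.prod_cons, List.sum_cons, mul_assoc]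
      push_cast at this ⊢
      rw [add_assoc] at this
      rwa [add_comm (α j : ℝ)]
  have := h (List.finRange n)
  rw [← List.ofFn_eq_map, List.sum_ofFn] at this
  simpa only [monom_eq_list_prod, List.ofFn_eq_map] using this

/-! ### Fourier inversion for oscillatory integrals -/

theorem exists_schwartz_one (n : ℕ) : ∃ u : SchwartzMap (E n) ℂ, u 0 = 1 := by
  let f : ContDiffBump (0 : E n) := ⟨1, 2, one_pos, one_lt_two⟩
  have h1 : ContDiff ℝ ∞ (fun q => (f q : ℂ)) := Complex.ofRealCLM.contDiff.comp f.contDiff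
  have h2 : HasCompactSupport (fun q => (f q : ℂ)) :=
    f.hasCompactSupport.comp_left (g := fun x : ℝ => (x : ℂ)) Complex.ofReal_zero
  refine ⟨h2.toSchwartzMap h1, ?_⟩
  change ((f 0 : ℝ) : ℂ) = 1
  rw [f.one_of_mem_closedBall (by simp [f.rIn_pos.le])]
  simp

theorem isOsc_comp_fst {K : ℝ} (hK : 0 ≤ K) {g : E n → ℂ}
    (hg : Sym (fun (_ : Unit) y => bracket y ^ K) (fun _ => g)) : IsOsc K (fun q => g q.1) := by
  have h := hg.comp_affine (ι' := Unit) id (ContinuousLinearMap.fst ℝ (E n) (E n)) (fun _ => 0)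
  simp only [add_zero] at h
  exact h.mono_le fun _ q => Real.rpow_le_rpow (bracket_pos _).le (bracket_fst_le_wt q) hK

theorem os_comp_fst_schwartz (u : SchwartzMap (E n) ℂ) : Os (fun q : E n × E n => u q.1) = u 0 := by
  have h : IsDec (-(n + 2)) 0 (fun q : E n × E n => u q.1) := by
    have h := (sym_schwartz u (n + 2)).comp_affine (ι' := Unit) id
      (ContinuousLinearMap.fst ℝ (E n) (E n)) (fun _ => 0)
    simp only [add_zero] at h
    exact h.mono_le fun _ q => by simp
  rw [os_eq_iterated h]
  have hinv := (MeasureTheory.Integrable.fourierInv_fourier_eq (f := u) u.integrable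
    (by rw [← SchwartzMap.fourier_coe]; exact (FourierTransform.fourier u).integrable)
    (v := 0) u.continuous.continuousAt)
  rw [Real.fourierInv_eq'] at hinv
  simp only [inner_zero_right, mul_zero, Complex.ofReal_zero, zero_mul, Complex.exp_zero,
    one_smul] at hinv
  rw [← hinv]
  have e : ∀ v : E n, FourierTransform.fourier (u : E n → ℂ) v =
      innerInt id (fun q : E n × E n => u q.1) ((-(2 * Real.pi)) • v) := by
    intro v
    rw [Real.fourier_eq', innerInt]
    congr 1
    ext y
    rw [id, inner_smul_right, smul_eq_mul]
    congr 2
    push_cast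
    ring
  simp only [e]
  rw [Measure.integral_comp_smul volume (innerInt id fun q : E n × E n => u q.1),
    finrank_euclideanSpace_fin, abs_inv, abs_pow, abs_neg,
    abs_of_pos (by positivity : (0 : ℝ) < 2 * Real.pi), Complex.real_smul]
  push_cast
  rfl

/-- By Hadamard's lemma `g(y) - g(0)` is a sum of products `y_j g_j(y)`, and integration by parts
in `η` turns each of them into a derivative of `g_j` in `η`, which vanishes. -/
theorem os_comp_fst_eq_mul {K : ℝ} (hK : 0 ≤ K) {g : E n → ℂ}
    (hg : Sym (fun (_ : Unit) y => bracket y ^ K) (fun _ => g)) :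
    Os (fun q : E n × E n => g q.1) = g 0 * Os (fun _ : E n × E n => 1) := by
  let P : E n × E n → ℂ := fun q => g q.2
  have hP : Sym (fun (_ : Unit) (q : E n × E n) => bracket q.1 ^ (0 : ℝ) * bracket q.2 ^ K)
      (fun _ => P) := by
    have h := hg.comp_affine (ι' := Unit) id (ContinuousLinearMap.snd ℝ (E n) (E n)) (fun _ => 0)
    simp only [add_zero] at h
    exact h.mono_le fun _ q => by simp
  let G : Fin n → E n → ℂ := fun j y => taylorRem 1 (D (dirη j) P) (0, 0, y)
  have hG : ∀ j, Sym (fun (_ : Unit) y => bracket y ^ K) (fun _ => G j) := by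
    intro j
    have h := (sym_taylorRem (hP.D (dirη j)) 1).comp_affine (ι' := Unit) id
      ((ContinuousLinearMap.inr ℝ (E n) (E n × E n)).comp
        (ContinuousLinearMap.inr ℝ (E n) (E n))) (fun _ => 0)
    simp only [add_zero] at h
    exact h.mono_le fun _ y => by simp [ampWt, bracket, abs_of_nonneg hK]
  have e : (fun q : E n × E n => g q.1) =
      fun q => g 0 * 1 + ∑ j, (ell (Sum.inr j) q : ℂ) * G j q.1 := by
    ext q
    have h := taylorRem_eq (hP.contDiff ()) 0 0 0 q.1
    simp only [taylorRem, P, zero_add, Nat.cast_zero, inv_one, one_mul] at h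
    rw [h, mul_one]
    simp only [G, taylorRem, P, Nat.cast_zero, zero_add, one_mul]
    rfl
  have h1 : IsOsc (K + 1) (fun _ : E n × E n => 1) :=
    Sym.mono_le Sym.one fun _ q => Real.one_le_rpow (one_le_wt q) (by linarith)
  have h2 : ∀ j, IsOsc K (fun q : E n × E n => G j q.1) := fun j => isOsc_comp_fst hK (hG j)
  have h3 : IsOsc (K + 1) fun q : E n × E n => ∑ j, (ell (Sum.inr j) q : ℂ) * G j q.1 :=
    Sym.sum _ fun j _ => (h2 j).ell_mul (Sum.inr j)
  rw [e, os_add (h1.const_mul (g 0)) h3, os_const_mul _ h1,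
    os_sum _ fun j _ => (h2 j).ell_mul (Sum.inr j), add_eq_left]
  refine Finset.sum_eq_zero fun j _ => ?_
  have h4 := D_comp_affine ((hG j).differentiable ()) (ContinuousLinearMap.fst ℝ (E n) (E n)) 0
    (dir (Sum.inr j))
  simp only [add_zero, ContinuousLinearMap.coe_fst'] at h4
  rw [os_ell_mul (h2 j), h4]
  simp [dir, D, os_zero]

theorem os_one : Os (fun _ : E n × E n => 1) = 1 := by
  obtain ⟨u, hu⟩ := exists_schwartz_one n
  have h := sym_schwartz u 0
  simp only [Nat.cast_zero, neg_zero] at h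
  have := os_comp_fst_eq_mul le_rfl h
  rwa [os_comp_fst_schwartz, hu, one_mul, eq_comm] at this

/-- Fourier inversion for symbols. -/
theorem os_comp_fst {K : ℝ} (hK : 0 ≤ K) {g : E n → ℂ}
    (hg : Sym (fun (_ : Unit) y => bracket y ^ K) (fun _ => g)) :
    Os (fun q : E n × E n => g q.1) = g 0 := by
  rw [os_comp_fst_eq_mul hK hg, os_one, mul_one]

/-! ### The asymptotic expansion -/

/-- The symbols `∂_η^α p(y, η)` frozen at `η = ξ`. -/
theorem sym_frozen {t₁ τ : ℝ} {Q : E n × E n → ℂ}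
    (hQ : Sym (fun (_ : Unit) (q : E n × E n) => bracket q.1 ^ t₁ * bracket q.2 ^ τ)
      (fun _ => Q)) :
    Sym (fun (_ : Unit) => ampWt t₁ τ 0) (fun _ (q : E n × E n × E n) => Q (q.1, q.2.1)) := by
  have h := hQ.comp_affine (ι' := Unit) id ((ContinuousLinearMap.fst ℝ (E n) (E n × E n)).prod
    ((ContinuousLinearMap.fst ℝ (E n) (E n)).comp
      (ContinuousLinearMap.snd ℝ (E n) (E n × E n)))) (fun _ => 0)
  simp only [add_zero] at h
  exact h.mono_le fun _ q => by simp [ampWt]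

/-- Products `a(x, z + y, ξ) r(z + y, ξ, η)` as symbols in `(y, η)` alone. -/
theorem isOsc_amp_mul {m₁ m₂ m₃ t₁ τ l : ℝ} (hl : 0 ≤ l) {A R : E n × E n × E n → ℂ}
    (hA : Sym (fun (_ : Unit) => ampWt m₁ m₂ m₃) (fun _ => A))
    (hR : Sym (fun (_ : Unit) => ampWt t₁ τ l) (fun _ => R)) (x z ξ : E n) :
    IsOsc (|m₂ + t₁| + l) (fun q => A (x, z + q.1, ξ) * R (z + q.1, ξ, q.2)) :=
  Sym.isOsc (ι := E n × E n × E n) (m := ampWt m₁ (m₂ + t₁) (m₃ + τ))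
    (G := fun v q => A (v.1, v.2.1 + q.1, v.2.2) * R (v.2.1 + q.1, v.2.2, q.2))
    (sym_amp_mul hl hA hR).slice_snd (x, z, ξ)

/-- A term of the Taylor expansion in `η`: integration by parts and Fourier inversion turn it into a
term of the asymptotic expansion. -/
theorem os_compositionTerm {m₁ m₂ m₃ t₁ t₂ : ℝ} {a : E n → E n → E n → ℂ}
    (ha : IsAmplitude m₁ m₂ m₃ a) {p : E n → E n → ℂ} (hp : IsSymbol t₁ t₂ p) (α : Fin n → ℕ)
    (x z ξ : E n) :
    Os (fun q : E n × E n => monom α q.2 *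
        (a x (z + q.1) ξ * mD dirη α (fun q : E n × E n => p q.1 q.2) (z + q.1, ξ))) =
      Complex.I ^ (∑ j, α j) *
        multiD α (fun y => a x y ξ * multiD α (fun ξ' => p y ξ') ξ) z := by
  set F : E n → ℂ := fun y => a x y ξ * mD dirη α (fun q : E n × E n => p q.1 q.2) (y, ξ) with hF
  have h1 : IsOsc (|m₂ + t₁| + 0) fun q : E n × E n => F (z + q.1) :=
    isOsc_amp_mul le_rfl ha.sym (sym_frozen (hp.sym α)) x z ξ
  have h2 : Sym (fun (_ : Unit) y => bracket y ^ (|m₂ + t₁| + 0)) (fun _ y => F (z + y)) := by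
    have h := Sym.comp_affine (ι' := Unit) h1 id (ContinuousLinearMap.inl ℝ (E n) (E n))
      (fun _ => 0)
    simp only [add_zero] at h ⊢
    exact h.mono_le fun _ y => by simp [wt, bracket]
  have h3 := mD_comp_affine (h2.contDiff ()) (ContinuousLinearMap.fst ℝ (E n) (E n)) 0 dirY α
  simp only [add_zero, ContinuousLinearMap.coe_fst'] at h3
  have h4 : ContDiff ℝ ∞ F := by
    have := (h2.contDiff ()).comp (contDiff_id.sub (contDiff_const (c := z)))
    convert this using 1
    ext y
    simp
  have h5 := congrFun (mD_comp_affine h4 (ContinuousLinearMap.id ℝ (E n)) z ej α) 0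
  simp only [ContinuousLinearMap.id_apply, zero_add] at h5
  have h6 : ∀ y, multiD α (fun ξ' => p y ξ') ξ =
      mD dirη α (fun q : E n × E n => p q.1 q.2) (y, ξ) := by
    intro y
    have := congrFun (mD_comp_affine hp.1 (ContinuousLinearMap.inr ℝ (E n) (E n)) (y, 0) ej α) ξ
    simp only [ContinuousLinearMap.inr_apply, Prod.mk_add_mk, zero_add, add_zero] at this
    exact this
  simp only [h6]
  rw [os_monom_mul α h1, h3]
  congr 1
  have h7 : (fun j => (dirY j).1) = (ej : Fin n → E n) := rfl
  rw [h7, os_comp_fst (by positivity) (mD_mono h2 ej α)]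
  simp only [add_comm z]
  exact h5

/-- The Taylor expansion of `p(z + y, ξ + η)` in `η`, integrated. -/
theorem compAmp_eq {m₁ m₂ m₃ t₁ t₂ : ℝ} {a : E n → E n → E n → ℂ}
    (ha : IsAmplitude m₁ m₂ m₃ a) {p : E n → E n → ℂ} (hp : IsSymbol t₁ t₂ p) (N : ℕ)
    (x z ξ : E n) :
    compAmp a p x z ξ = ∑ k ∈ Finset.range N, compositionTerm a p k x z ξ +
      ∑ α ∈ Finset.piAntidiag (Finset.univ : Finset (Fin n)) N,
        ((∏ j, (α j).factorial : ℕ) : ℂ)⁻¹ * (Complex.I ^ (∑ j, α j) *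
          Os (mD dirY α fun q : E n × E n => a x (z + q.1) ξ *
            taylorRem N (mD dirη α fun q : E n × E n => p q.1 q.2) (z + q.1, ξ, q.2))) := by
  set P : E n × E n → ℂ := fun q => p q.1 q.2 with hP
  set f : (Fin n → ℕ) → E n × E n → ℂ := fun α q =>
    ((∏ j, (α j).factorial : ℕ) : ℂ)⁻¹ *
      (monom α q.2 * (a x (z + q.1) ξ * mD dirη α P (z + q.1, ξ))) with hf
  set r : (Fin n → ℕ) → E n × E n → ℂ := fun α q => ((∏ j, (α j).factorial : ℕ) : ℂ)⁻¹ *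
    (monom α q.2 * (a x (z + q.1) ξ * taylorRem N (mD dirη α P) (z + q.1, ξ, q.2))) with hr
  have e : (fun q : E n × E n => a x (z + q.1) ξ * p (z + q.1) (ξ + q.2)) = fun q =>
      (∑ k ∈ Finset.range N, ∑ α ∈ Finset.piAntidiag (Finset.univ : Finset (Fin n)) k, f α q) +
        ∑ α ∈ Finset.piAntidiag (Finset.univ : Finset (Fin n)) N, r α q := by
    ext q
    have := taylor hp.1 N (z + q.1) ξ q.2
    simp only at this
    rw [this, mul_add]
    simp only [Finset.mul_sum, f, r]
    congr 1
    · refine Finset.sum_congr rfl fun k _ => Finset.sum_congr rfl fun α _ => ?_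
      ring
    · refine Finset.sum_congr rfl fun α _ => ?_
      ring
  let K : ℝ := |m₂ + t₁| + |t₂ - N| + N
  have osc_f₀ : ∀ α, IsOsc (|m₂ + t₁| + 0 + (∑ j, α j : ℕ)) fun q : E n × E n =>
      monom α q.2 * (a x (z + q.1) ξ * mD dirη α P (z + q.1, ξ)) := fun α =>
    (isOsc_amp_mul le_rfl ha.sym (sym_frozen (hp.sym α)) x z ξ).monom_mul α
  have osc_f : ∀ k ∈ Finset.range N, ∀ α ∈ Finset.piAntidiag (Finset.univ : Finset (Fin n)) k,
      IsOsc K (f α) := by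
    intro k hk α hα
    have h1 : (((∑ j, α j : ℕ) : ℝ)) ≤ N := by
      rw [(Finset.mem_piAntidiag.1 hα).1]
      exact_mod_cast (Finset.mem_range.1 hk).le
    exact ((osc_f₀ α).const_mul _).mono (by
      have := abs_nonneg (t₂ - N)
      simp only [K]
      linarith)
  have osc_r₀ : ∀ α ∈ Finset.piAntidiag (Finset.univ : Finset (Fin n)) N,
      IsOsc (|m₂ + t₁| + |t₂ - N|) fun q : E n × E n =>
        a x (z + q.1) ξ * taylorRem N (mD dirη α P) (z + q.1, ξ, q.2) := by
    intro α hα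
    have h := isOsc_amp_mul (abs_nonneg _) ha.sym (sym_taylorRem (hp.sym α) N) x z ξ
    rwa [(Finset.mem_piAntidiag.1 hα).1] at h
  have osc_r₁ : ∀ α ∈ Finset.piAntidiag (Finset.univ : Finset (Fin n)) N,
      IsOsc K fun q : E n × E n =>
        monom α q.2 * (a x (z + q.1) ξ * taylorRem N (mD dirη α P) (z + q.1, ξ, q.2)) := by
    intro α hα
    have h := (osc_r₀ α hα).monom_mul α
    rwa [(Finset.mem_piAntidiag.1 hα).1] at h
  rw [compAmp, e, os_add (K := K)
      (Sym.sum _ fun k hk => Sym.sum _ fun α hα => osc_f k hk α hα)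
      (Sym.sum _ fun α hα => (osc_r₁ α hα).const_mul _),
    os_sum _ fun k hk => Sym.sum _ fun α hα => osc_f k hk α hα,
    os_sum _ fun α hα => (osc_r₁ α hα).const_mul _]
  congr 1
  · refine Finset.sum_congr rfl fun k hk => ?_
    rw [os_sum _ fun α hα => osc_f k hk α hα, compositionTerm]
    refine Finset.sum_congr rfl fun α hα => ?_
    rw [hf, os_const_mul _ (osc_f₀ α), os_compositionTerm ha hp α x z ξ]
    ring
  · refine Finset.sum_congr rfl fun α hα => ?_
    rw [os_const_mul _ (osc_r₁ α hα), os_monom_mul α (osc_r₀ α hα)]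

/-- The remainder of the expansion after the terms of order less than `N` is of order `N` lower in
`ξ`, as every `∂_η^α p` with `|α| = N` is. -/
theorem sym_compAmp_sub {m₁ m₂ m₃ t₁ t₂ : ℝ} {a : E n → E n → E n → ℂ}
    (ha : IsAmplitude m₁ m₂ m₃ a) {p : E n → E n → ℂ} (hp : IsSymbol t₁ t₂ p) (N : ℕ) :
    Sym (fun (_ : Unit) => ampWt m₁ (m₂ + t₁) (m₃ + (t₂ - N)))
      (fun _ (q : E n × E n × E n) => compAmp a p q.1 q.2.1 q.2.2 -
        ∑ k ∈ Finset.range N, compositionTerm a p k q.1 q.2.1 q.2.2) := by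
  refine Sym.congr (f := fun (_ : Unit) (v : E n × E n × E n) =>
      ∑ α ∈ Finset.piAntidiag (Finset.univ : Finset (Fin n)) N,
        ((∏ j, (α j).factorial : ℕ) : ℂ)⁻¹ * (Complex.I ^ (∑ j, α j) *
          Os (mD dirY α fun q : E n × E n => a v.1 (v.2.1 + q.1) v.2.2 *
            taylorRem N (mD dirη α fun q : E n × E n => p q.1 q.2) (v.2.1 + q.1, v.2.2, q.2)))) ?_
    fun _ v => by rw [compAmp_eq ha hp N, add_sub_cancel_left]
  refine Sym.sum _ fun α hα => ((?_ : Sym _ _).const_mul _).const_mul _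
  have h := sym_amp_mul (abs_nonneg _) ha.sym (sym_taylorRem (hp.sym α) N)
  rw [(Finset.mem_piAntidiag.1 hα).1] at h
  have h1 := Sym.os (V := E n × E n × E n) (K := |m₂ + t₁| + |t₂ - N|)
    (G := mD (fun j => (0, dirY j)) α fun v : (E n × E n × E n) × (E n × E n) =>
      a v.1.1 (v.1.2.1 + v.2.1) v.1.2.2 *
        taylorRem N (mD dirη α fun q : E n × E n => p q.1 q.2) (v.1.2.1 + v.2.1, v.1.2.2, v.2.2))
    (continuous_ampWt m₁ (m₂ + t₁) (m₃ + (t₂ - N))) (mD_mono h _ α)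
  refine h1.congr fun _ v => ?_
  congr 1
  have h2 := mD_comp_affine (h.contDiff ())
    (ContinuousLinearMap.inr ℝ (E n × E n × E n) (E n × E n)) (v, 0) dirY α
  simp only [ContinuousLinearMap.inr_apply, Prod.mk_add_mk, zero_add, add_zero] at h2
  exact h2

theorem expansion_compAmp {m₁ m₂ m₃ t₁ t₂ : ℝ} {a : E n → E n → E n → ℂ}
    (ha : IsAmplitude m₁ m₂ m₃ a) {p : E n → E n → ℂ} (hp : IsSymbol t₁ t₂ p) :
    ExpansionImprovingInXi m₁ (m₂ + t₁) (m₃ + t₂) (compAmp a p) (compositionTerm a p) := by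
  intro α β γ M
  refine ⟨⌈M⌉₊, fun N hN => Sym.mixedD₃_le (Sym.mono_le (sym_compAmp_sub ha hp N) fun _ q => ?_)
    α β γ⟩
  have hM : M ≤ N := Nat.ceil_le.1 hN
  exact mul_le_mul_of_nonneg_left (bracket_rpow_le_rpow _ (by linarith))
    (mul_pos (bracket_rpow_pos _ _) (bracket_rpow_pos _ _)).le

end Expansion

end FIOCalc

end

theorem mainTheorem4 (n : ℕ) (m₁ m₂ m₃ t₁ t₂ : ℝ)
    (a : E n → E n → E n → ℂ) (ha : IsAmplitude m₁ m₂ m₃ a)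
    (p : E n → E n → ℂ) (hp : IsSymbol t₁ t₂ p) :
    ∃ P : SchwartzMap (E n) ℂ →ₗ[ℂ] SchwartzMap (E n) ℂ,
      IsPDO p (fun u => ⇑(P u)) ∧
      ∃ c : E n → E n → E n → ℂ,
        IsAmplitude m₁ (m₂ + t₁) (m₃ + t₂) c ∧
        ExpansionImprovingInXi m₁ (m₂ + t₁) (m₃ + t₂) c (compositionTerm a p) ∧
        ∀ φ : E n → E n → ℝ, (∀ x, AEMeasurable (φ x) (volume : Measure (E n))) →
          ∃ T : SchwartzMap (E n) ℂ →ₗ[ℂ] (E n → ℂ),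
            IsFIO φ a T ∧ IsFIO φ c (T ∘ₗ P) := by
  refine ⟨pdo hp, isPDO_pdo hp, compAmp a p, isAmplitude_compAmp ha hp, expansion_compAmp ha hp,
    fun φ hφ => ⟨fioLin ha hφ, isFIO_fioOp ha hφ, ?_⟩⟩
  have h := isFIO_fioOp (isAmplitude_compAmp ha hp) hφ
  have e : (fun u : SchwartzMap (E n) ℂ => fioOp φ (compAmp a p) u) =
      (fioLin ha hφ ∘ₗ pdo hp : SchwartzMap (E n) ℂ →ₗ[ℂ] (E n → ℂ)) := by
    ext u x
    exact fioOp_compAmp ha hp φ u x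
  rwa [e] at h
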